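/- **Setting.** Let $k$ be a field of prime characteristic $p$ and let $q\ge 2$ be an integer. For a permutation $\rho$ of $\mathbb N$ let ${\rm supp}\,\rho$ be the set of points it moves, and for a set $X$ of permutations let ${\rm supp}\,X=\bigcup_{\rho\in X}{\rm supp}\,\rho$. Let $\mathcal F$ be the set of all finite non-empty sets $X\ne\{1\}$ of permutations of $\mathbb N$ with finite support. Let $\mathcal S^q\subset\mathcal F$ consist of those $X$ such that every $\rho\in X$ is a product of disjoint $q$-cycles and ${\rm supp}\,\rho={\rm supp}\,X$. Two sets $X,Y$ are *equivalent* if $Y=X^\sigma$ for some $\sigma\in{\rm Sym}(\mathbb N)$. For $X,Y\in\mathcal F$ the product $X*Y$ is the image of $X\times Y$ under an embedding ${\rm Sym}({\rm supp}\,X)\times{\rm Sym}({\rm supp}\,Y)\to{\rm Sym}(\mathbb N)$ that lets the two factors act on disjoint copies of ${\rm supp}\,X$ and ${\rm supp}\,Y$; it is well defined up to equivalence, and commutative and associative up to equivalence. $X^s$ is the $s$-fold product $X*\dots*X$. The set $X\in\mathcal F$ is *irreducible* if it is not equivalent to $Y*Z$ for any $Y,Z\in\mathcal F$. For $X\in\mathcal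 S^q$ let $G_X={\rm Sym}({\rm supp}\,X)$, let $\Xi_X=\bigcup_{g\in G_X}X^g$, on which $G_X$ acts by conjugation, let $S_X=C_{G_X}(X)$ be the pointwise stabilizer of $X$, and let $Q_X$ be a Sylow $p$-subgroup of $S_X$. A *vertex* of an indecomposable $kG_X$-module $M$ is a subgroup $H\le G_X$ that is minimal subject to $M$ being isomorphic to a direct summand of ${\rm Ind}_H^{G_X}(L)$ for some $kH$-module $L$. The set $X$ is a *fixed point set* if some indecomposable direct summand of the permutation module $k\Xi_X$ has a vertex $Q$ with $X={\rm Fix}_{\Xi_X}(Q)$. The set $X$ is *exact* if ${\rm supp}\,Q_X={\rm supp}\,X$. **Theorem.** Let $t\ge 1$, let $Y_1,\dots,Y_t\in\mathcal S^q$ be pairwise inequivalent irreducible exact fixed point sets, and let $s_1,\dots,s_t$ be positive integers with $s_i<p$ for every $i$. Then $Y_1^{s_1}*Y_2^{s_2}*\dots*Y_t^{s_t}$ (that is, every set in this equivalence class) belongs to $\mathcal S^q$ and is a fixed point set. -/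

import Mathlib

namespace FixedPointSets

open Equiv (Perm)

universe u

section Modules

variable {k : Type u} [Field k] {G : Type} [Group G]

/-- `σ` is a component of `ρ`: it is isomorphic to a direct summand of `ρ`, that is, there are
`kG`-maps `i : σ → ρ` and `r : ρ → σ` with `r ∘ i = id`. -/
def IsComponent {V W : Type u} [AddCommGroup V] [Module k V] [AddCommGroup W] [Module k W]
    (σ : Representation k G V) (ρ : Representation k G W) : Prop :=
  ∃ (i : Representation.IntertwiningMap σ ρ) (r : Representation.IntertwiningMap ρ σ),
    r.comp i = Representation.IntertwiningMap.id σ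

/-- `ρ` is nonzero and in every decomposition into two subrepresentations one of them is zero. -/
def IsIndecomposable {V : Type u} [AddCommGroup V] [Module k V]
    (ρ : Representation k G V) : Prop :=
  Nontrivial V ∧ ∀ U W : Subrepresentation ρ, IsCompl U W → U = ⊥ ∨ W = ⊥

/-- `ρ` is a component of a module induced from the subgroup `H`. -/
def IsRelativelyProjective (H : Subgroup G) {V : Type u} [AddCommGroup V] [Module k V]
    (ρ : Representation k G V) : Prop :=
  ∃ (L : Type u) (_ : AddCommGroup L) (_ : Module k L) (τ : Representation k H L),
    IsComponent ρ (Representation.ind H.subtype τ)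

/-- `Q` is a vertex of `ρ`: a subgroup minimal subject to `ρ` being a component of a module
induced from it. -/
def IsVertex (Q : Subgroup G) {V : Type u} [AddCommGroup V] [Module k V]
    (ρ : Representation k G V) : Prop :=
  Minimal (fun H : Subgroup G => IsRelativelyProjective H ρ) Q

variable (k G) in
/-- For a `G`-set `Ω`, the subset `X` of `Ω` is a fixed point set if `X = Fix_Ω(Q)` for a vertex
`Q` of some indecomposable component of the permutation module `kΩ`. -/
def IsFixedPointSetOf {Ω : Type} [MulAction G Ω] (X : Set Ω) : Prop :=
  ∃ (V : Type u) (_ : AddCommGroup V) (_ : Module k V) (ρ : Representation k G V)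
    (Q : Subgroup G),
    IsComponent ρ (Representation.ofMulAction k G Ω) ∧ IsIndecomposable ρ ∧ IsVertex Q ρ ∧
      X = MulAction.fixedPoints Q Ω

end Modules

/-- The support of a set of permutations: the union of the supports of its elements. -/
def supp (X : Set (Perm ℕ)) : Set ℕ := {n | ∃ ρ ∈ X, ρ n ≠ n}

/-- The finite non-empty sets of finitary permutations of `ℕ`, except the set `{1}`. -/
def classF : Set (Set (Perm ℕ)) :=
  {X | (∀ ρ ∈ X, (supp {ρ}).Finite) ∧ X.Nonempty ∧ X.Finite ∧ X ≠ {1}}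

/-- A (finitary) permutation is a product of disjoint `q`-cycles: every moved point lies in a
cycle of length `q`. -/
def IsProdOfCycles (q : ℕ) (ρ : Perm ℕ) : Prop :=
  ∀ n, ρ n ≠ n → Function.minimalPeriod ρ n = q

/-- The members `X` of `classF` all of whose elements are products of disjoint `q`-cycles and have
the same support as `X`. -/
def classS (q : ℕ) : Set (Set (Perm ℕ)) :=
  {X | X ∈ classF ∧ (∀ ρ ∈ X, IsProdOfCycles q ρ) ∧ ∀ ρ ∈ X, supp {ρ} = supp X}

/-- `X` and `Y` are equivalent if they are conjugate under `Sym(ℕ)`. -/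
def Equivalent (X Y : Set (Perm ℕ)) : Prop :=
  ∃ σ : Perm ℕ, Y = (fun x => σ * x * σ⁻¹) '' X

/-- The product `X * Y`: the image of the Cartesian product `X × Y` under the embedding of the
product of two symmetric groups into a third one that lets the first factor act on the even and
the second one on the odd numbers (any other choice of disjoint copies of the two supports gives
an equivalent set). -/
def starMul (X Y : Set (Perm ℕ)) : Set (Perm ℕ) :=
  Set.image2 (fun x y => Equiv.natSumNatEquivNat.permCongr (Equiv.Perm.sumCongr x y)) X Y

/-- The `s`-fold product `X * ⋯ * X`. -/
def starPow (X : Set (Perm ℕ)) : ℕ → Set (Perm ℕ)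
  | 0 => {1}
  | s + 1 => starMul X (starPow X s)

/-- The product of a list; `{1}` is neutral for `starMul` up to equivalence. -/
def starProd : List (Set (Perm ℕ)) → Set (Perm ℕ)
  | [] => {1}
  | X :: L => starMul X (starProd L)

/-- `X` is irreducible: it is not (up to equivalence) a product of two members of `classF`. -/
def IsIrred (X : Set (Perm ℕ)) : Prop :=
  ¬ ∃ Y ∈ classF, ∃ Z ∈ classF, Equivalent X (starMul Y Z)

/-- The subgroup `Sym(A)` of `Sym(ℕ)`, for `A ⊆ ℕ`. -/
def symOn (A : Set ℕ) : Subgroup (Perm ℕ) where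
  carrier := {g | ∀ n, n ∉ A → g n = n}
  mul_mem' := by
    intro a b ha hb n hn
    rw [Equiv.Perm.mul_apply, hb n hn, ha n hn]
  one_mem' := by
    intro n _
    rfl
  inv_mem' := by
    intro a ha n hn
    rw [Equiv.Perm.inv_eq_iff_eq]
    exact (ha n hn).symm

/-- The group `G_X = Sym(supp X)`. -/
abbrev symSupp (X : Set (Perm ℕ)) : Subgroup (Perm ℕ) := symOn (supp X)

/-- `Ξ_X`, the union of the conjugates of `X` under `G_X`. -/
def conjClosure (X : Set (Perm ℕ)) : Set (Perm ℕ) :=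
  {h | ∃ g ∈ symSupp X, ∃ x ∈ X, h = g * x * g⁻¹}

/-- `G_X` acts on `Ξ_X` by conjugation. -/
instance conjMulAction (X : Set (Perm ℕ)) : MulAction (symSupp X) (conjClosure X) where
  smul g h := ⟨(g : Perm ℕ) * h * (g : Perm ℕ)⁻¹, by
    obtain ⟨a, ha, x, hx, e⟩ := h.2
    exact ⟨g * a, mul_mem g.2 ha, x, hx, by rw [e]; group⟩⟩
  one_smul h := Subtype.ext (by
    change ((1 : symSupp X) : Perm ℕ) * h * ((1 : symSupp X) : Perm ℕ)⁻¹ = h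
    simp)
  mul_smul a b h := Subtype.ext (by
    change ((a * b : symSupp X) : Perm ℕ) * h * ((a * b : symSupp X) : Perm ℕ)⁻¹
      = (a : Perm ℕ) * ((b : Perm ℕ) * h * (b : Perm ℕ)⁻¹) * (a : Perm ℕ)⁻¹
    simp [mul_assoc])

/-- `X` is a fixed point set over `k`, for the conjugation action of `G_X` on `Ξ_X`. -/
def IsFixedPointSet (k : Type u) [Field k] (X : Set (Perm ℕ)) : Prop :=
  IsFixedPointSetOf k (symSupp X) {h : conjClosure X | (h : Perm ℕ) ∈ X}

/-- `S_X`, the pointwise stabilizer of `X` in `G_X` under conjugation, that is, the centralizer of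
`X` in `G_X`. -/
def pointStab (X : Set (Perm ℕ)) : Subgroup (Perm ℕ) :=
  symSupp X ⊓ Subgroup.centralizer X

/-- `X` is exact at `p`: a Sylow `p`-subgroup `Q_X` of `S_X` satisfies `supp Q_X = supp X`. (For
`X` in `classF` the group `S_X` is finite, so this does not depend on the choice of `Q_X`.) -/
def IsExact (p : ℕ) (X : Set (Perm ℕ)) : Prop :=
  ∀ Q : Sylow p (pointStab X), supp ((fun g : pointStab X => (g : Perm ℕ)) '' Q) = supp X

end FixedPointSets

open FixedPointSets

/-! A `p`-subgroup `Q` of `G` is a vertex of a component of `kΩ` exactly when the permutation module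
on `Fix(Q)` has a projective summand over `N(Q)/Q`, that is, when the trace from `1` to `N(Q)/Q` of
some linear endomorphism of `k Fix(Q)` is not nilpotent. `HasBrauerTrace` is this criterion in
matrix form. Its trace may run from `Q` to all of `G`, because in characteristic `p` only cosets
inside `N(Q)` contribute at fixed points of `Q`. The two implications are
`hasBrauerTrace_of_isVertex` and `HasBrauerTrace.isFixedPointSetOf`; they rest on Higman's
criterion, Fitting's lemma and the Brauer homomorphism.

For `X` in `classS q` the set `Ξ_X` consists of all permutations of `supp X` whose cycles all have
length `q` (`regPerm`). Exactness of `Y i` means that its vertex group `Q i`, which is a Sylow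
subgroup of the pointwise stabilizer, moves every point of `supp (Y i)` (`exists_hasBrauerTrace`).

Now take one block for each factor of the product, counted with multiplicity, and let `Q` be the
direct product of the groups `Q b` of the blocks. Since each `Q b` moves all points of its block, a
permutation centralized by `Q` preserves the blocks. Hence the fixed points of `Q` are the tuples of
fixed points of the `Q b` (`mem_fixedPoints_blockSub`), which is the product set. The normalizer
`N(Q)` acts on this set, and irreducibility of the factors forces it to permute the blocks
(`fst_apply_eq_of_mem_normalizer`). Inequivalent factors cannot be exchanged, so `N(Q)` modulo the
product of the `N(Q b)` embeds into a product of symmetric groups of degrees `s i < p` and has order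
prime to `p`.

Up to this invertible index, the trace to `N(Q)` of a tensor product of endomorphisms is therefore
the tensor product of the traces to the `N(Q b)`, provided equal factors carry equal data. A tensor
product of non-nilpotent matrices is not nilpotent, so the criterion passes to the product
(`hasBrauerTrace_blockSub`). -/

namespace FixedPointSets

open Equiv (Perm)

universe u

set_option linter.unusedSectionVars false

/-! ### Sums over the cosets of a subgroup. -/

section CosetSums

variable {G : Type*} [Group G] {M : Type*} [AddCommMonoid M]

/-- `F` is constant on the left cosets of `H`. -/
def CosetInvariant (H : Subgroup G) {M : Type*} (F : G → M) : Prop :=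
  ∀ g, ∀ h ∈ H, F (g * h) = F g

/-- The sum over the left cosets of `H` of a function that is constant on these cosets. -/
noncomputable def cosetSum (H : Subgroup G) (F : G → M) : M :=
  ∑ᶠ c : G ⧸ H, F c.out

theorem CosetInvariant.apply_out {H : Subgroup G} {F : G → M} (hF : CosetInvariant H F) (g : G) :
    F (g : G ⧸ H).out = F g := by
  obtain ⟨h, hh⟩ := QuotientGroup.mk_out_eq_mul H g
  rw [hh, hF g h h.2]

theorem CosetInvariant.mul_left {H : Subgroup G} {F : G → M} (hF : CosetInvariant H F) (g : G) :
    CosetInvariant H (fun x => F (g * x)) := by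
  intro x h hh
  simp only [← mul_assoc]
  exact hF _ h hh

/-- A sum over `K/H` is written throughout as a sum over `G/H` of a function cut off outside `K`.
The cut-off stays constant on cosets because `H ≤ K`. -/
theorem CosetInvariant.indicator {H K : Subgroup G} (hHK : H ≤ K) {F : G → M}
    (hF : CosetInvariant H F) : CosetInvariant H ((K : Set G).indicator F) := by
  intro g h hh
  by_cases hg : g ∈ K
  · rw [Set.indicator_of_mem (K.mul_mem hg (hHK hh)), Set.indicator_of_mem hg, hF g h hh]
  · rw [Set.indicator_of_notMem, Set.indicator_of_notMem hg]
    intro h'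
    exact hg ((K.mul_mem_cancel_right (hHK hh)).1 h')

variable [Finite G]

theorem cosetSum_eq_sum (H : Subgroup G) [Fintype (G ⧸ H)] (F : G → M) :
    cosetSum H F = ∑ c : G ⧸ H, F c.out :=
  finsum_eq_sum_of_fintype _

theorem cosetSum_congr {H : Subgroup G} {F F' : G → M} (h : ∀ g, F g = F' g) :
    cosetSum H F = cosetSum H F' := by
  rw [funext h]

theorem map_cosetSum {N : Type*} [AddCommMonoid N] (φ : M →+ N) (H : Subgroup G) (F : G → M) :
    φ (cosetSum H F) = cosetSum H (fun g => φ (F g)) :=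
  φ.map_finsum (Set.toFinite _)

theorem cosetSum_const (H : Subgroup G) (m : M) : cosetSum H (fun _ => m) = H.index • m := by
  have := Fintype.ofFinite (G ⧸ H)
  rw [cosetSum_eq_sum, Finset.sum_const, Finset.card_univ, Subgroup.index, Nat.card_eq_fintype_card]

theorem cosetSum_sum {ι : Type*} (s : Finset ι) (H : Subgroup G) (F : ι → G → M) :
    cosetSum H (fun g => ∑ i ∈ s, F i g) = ∑ i ∈ s, cosetSum H (F i) := by
  have := Fintype.ofFinite (G ⧸ H)
  simp only [cosetSum_eq_sum]
  exact Finset.sum_comm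

theorem cosetSum_mul_left {H : Subgroup G} {F : G → M} (hF : CosetInvariant H F) (g : G) :
    cosetSum H (fun x => F (g * x)) = cosetSum H F := by
  refine finsum_eq_of_bijective (fun c : G ⧸ H => g • c) (MulAction.bijective g) fun c => ?_
  induction c using QuotientGroup.induction_on with
  | H x =>
    rw [MulAction.Quotient.smul_coe, hF.apply_out, smul_eq_mul]
    exact (hF.mul_left g).apply_out x

/-- Summation in stages. -/
theorem cosetSum_tower {H K : Subgroup G} (hHK : H ≤ K) {F : G → M} (hF : CosetInvariant H F) :
    cosetSum H F =
      cosetSum K (fun g => cosetSum H ((K : Set G).indicator (fun x => F (g * x)))) := by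
  classical
  have := Fintype.ofFinite (G ⧸ H)
  have := Fintype.ofFinite (G ⧸ K)
  have hmk : ∀ c : G ⧸ H, ∃ d : G ⧸ K, d = (c.out : G ⧸ K) := fun c => ⟨_, rfl⟩
  simp only [cosetSum_eq_sum]
  rw [← Finset.sum_fiberwise (s := Finset.univ) (g := fun c : G ⧸ H => (c.out : G ⧸ K))]
  refine Finset.sum_congr rfl fun d _ => ?_
  rw [Finset.sum_filter]
  symm
  -- Left translation by the representative of `d` carries the cosets of `H` inside `K` to those
  -- inside `d`.
  refine Fintype.sum_bijective (fun c : G ⧸ H => d.out • c) (MulAction.bijective d.out) _ _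
    fun c => ?_
  induction c using QuotientGroup.induction_on with
  | H x =>
    rw [((hF.mul_left d.out).indicator hHK).apply_out x, MulAction.Quotient.smul_coe,
      hF.apply_out, smul_eq_mul]
    have key : (((d.out * x : G) : G ⧸ H).out : G ⧸ K) = d ↔ x ∈ K := by
      obtain ⟨h, hh⟩ := QuotientGroup.mk_out_eq_mul H (d.out * x)
      rw [hh]
      nth_rewrite 2 [← QuotientGroup.out_eq' d]
      rw [eq_comm, QuotientGroup.eq]
      simp only [mul_assoc, inv_mul_cancel_left]
      exact K.mul_mem_cancel_right (hHK h.2)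
    by_cases hx : x ∈ K
    · rw [Set.indicator_of_mem (show x ∈ (K : Set G) from hx), if_pos (key.2 hx)]
    · rw [Set.indicator_of_notMem (show x ∉ (K : Set G) from hx), if_neg (fun h => hx (key.1 h))]

theorem cosetSum_indicator_const {H K : Subgroup G} (hHK : H ≤ K) (m : M) :
    cosetSum H ((K : Set G).indicator fun _ => m) = H.relIndex K • m := by
  classical
  have := Fintype.ofFinite (G ⧸ H)
  rw [cosetSum_eq_sum]
  simp only [Set.indicator_apply]
  rw [← Finset.sum_filter, Finset.sum_const]
  congr 1
  rw [Subgroup.relIndex, Subgroup.index, ← Set.ncard_coe_finset, ← Nat.card_coe_set_eq]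
  have hmem : ∀ c : K ⧸ H.subgroupOf K, (((c.out : K) : G) : G ⧸ H).out ∈ K := by
    intro c
    obtain ⟨h, hh⟩ := QuotientGroup.mk_out_eq_mul H ((c.out : K) : G)
    rw [hh]
    exact K.mul_mem c.out.2 (hHK h.2)
  symm
  refine Nat.card_eq_of_bijective (fun c : K ⧸ H.subgroupOf K =>
    ⟨(((c.out : K) : G) : G ⧸ H), by simpa using hmem c⟩) ⟨?_, ?_⟩
  · intro c d hcd
    have h2 : (((c.out : K) : G) : G ⧸ H) = ((d.out : K) : G) := congrArg Subtype.val hcd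
    rw [QuotientGroup.eq] at h2
    rw [← QuotientGroup.out_eq' c, ← QuotientGroup.out_eq' d, QuotientGroup.eq]
    exact h2
  · rintro ⟨c, hc⟩
    have hc : c.out ∈ K := by simpa using hc
    refine ⟨((⟨c.out, hc⟩ : K) : K ⧸ H.subgroupOf K), Subtype.ext ?_⟩
    change _ = c
    nth_rewrite 2 [← QuotientGroup.out_eq' c]
    have := QuotientGroup.eq.1 (QuotientGroup.out_eq' ((⟨c.out, hc⟩ : K) : K ⧸ H.subgroupOf K))
    rw [QuotientGroup.eq]
    exact this

theorem cosetSum_map_mulEquiv {G' : Type*} [Group G'] (φ : G ≃* G') {H : Subgroup G} {F : G' → M}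
    (hF : CosetInvariant (H.map φ.toMonoidHom) F) :
    cosetSum (H.map φ.toMonoidHom) F = cosetSum H (fun g => F (φ g)) := by
  symm
  have hF' : CosetInvariant H (fun g => F (φ g)) := by
    intro g h hh
    simp only [map_mul]
    exact hF _ _ (Subgroup.mem_map_of_mem _ hh)
  have e : ∀ a b : G, (a : G ⧸ H) = b ↔ (φ a : G' ⧸ H.map φ.toMonoidHom) = φ b := by
    intro a b
    rw [QuotientGroup.eq, QuotientGroup.eq, ← map_inv, ← map_mul]
    exact (Subgroup.mem_map_iff_mem φ.injective).symm
  refine finsum_eq_of_bijective (fun c : G ⧸ H => (φ c.out : G' ⧸ H.map φ.toMonoidHom)) ⟨?_, ?_⟩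
    fun c => ?_
  · intro c d hcd
    have := (e _ _).2 hcd
    rwa [QuotientGroup.out_eq', QuotientGroup.out_eq'] at this
  · intro c
    refine ⟨((φ.symm c.out : G) : G ⧸ H), ?_⟩
    change ((φ ((φ.symm c.out : G) : G ⧸ H).out : G') : G' ⧸ H.map φ.toMonoidHom) = c
    have := (e ((φ.symm c.out : G) : G ⧸ H).out (φ.symm c.out)).1 (QuotientGroup.out_eq' _)
    rw [this, MulEquiv.apply_symm_apply, QuotientGroup.out_eq']
  · exact (hF.apply_out _).symm

end CosetSums

/-! ### Sums invariant under a `p`-group in characteristic `p`. -/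

section PGroupSums

variable {M : Type*} [AddCommMonoid M] {p : ℕ} [Fact p.Prime]

/-- In characteristic `p`, only the fixed points contribute to the sum of a function that is
invariant under a `p`-group. -/
theorem IsPGroup.sum_eq_sum_fixedPoints {R : Type*} [Group R] [Finite R] (hR : IsPGroup p R)
    (hM : ∀ m : M, p • m = 0) {C : Type*} [MulAction R C] [Fintype C] (F : C → M)
    (hF : ∀ (r : R) c, F (r • c) = F c) [DecidablePred (· ∈ MulAction.fixedPoints R C)] :
    ∑ c, F c = ∑ c with c ∈ MulAction.fixedPoints R C, F c := by
  classical
  have := Fintype.ofFinite (MulAction.orbitRel.Quotient R C)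
  rw [← Finset.sum_filter_add_sum_filter_not Finset.univ (· ∈ MulAction.fixedPoints R C)]
  convert add_zero _
  -- `F` is constant on each orbit, and the length of a nontrivial orbit is a multiple of `p`.
  rw [← Finset.sum_fiberwise (g := fun c => (Quotient.mk'' c : MulAction.orbitRel.Quotient R C))]
  refine Finset.sum_eq_zero fun ω _ => ?_
  induction ω using Quotient.inductionOn' with
  | h d =>
    have hconst : ∀ c ∈ Finset.filter (fun c => (Quotient.mk'' c : MulAction.orbitRel.Quotient R C)
        = Quotient.mk'' d) (Finset.univ.filter (· ∉ MulAction.fixedPoints R C)), F c = F d := by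
      intro c hc
      obtain ⟨r, rfl⟩ := MulAction.orbitRel_apply.1 (Quotient.exact' (Finset.mem_filter.1 hc).2)
      exact hF r d
    rw [Finset.sum_congr rfl hconst, Finset.sum_const]
    by_cases hd : d ∈ MulAction.fixedPoints R C
    · rw [Finset.card_eq_zero.2, zero_smul]
      refine Finset.eq_empty_of_forall_notMem fun c hc => ?_
      simp only [Finset.mem_filter, Finset.mem_univ, true_and] at hc
      obtain ⟨r, rfl⟩ := MulAction.orbitRel_apply.1 (Quotient.exact' hc.2)
      simp only [hd r] at hc
      exact hc.1 hd
    · have hcard : (Finset.filter (fun c => (Quotient.mk'' c : MulAction.orbitRel.Quotient R C)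
          = Quotient.mk'' d) (Finset.univ.filter (· ∉ MulAction.fixedPoints R C))).card =
          Nat.card (MulAction.orbit R d) := by
        rw [← Set.ncard_coe_finset, ← Nat.card_coe_set_eq]
        congr 3
        ext c
        simp only [Finset.coe_filter, Finset.mem_filter, Finset.mem_univ, true_and,
          Set.mem_ofPred_eq]
        constructor
        · intro hc
          exact MulAction.orbitRel_apply.1 (Quotient.exact' hc.2)
        · intro hc
          refine ⟨?_, Quotient.sound' (MulAction.orbitRel_apply.2 hc)⟩
          obtain ⟨r, rfl⟩ := hc
          intro h
          have h1 := h r⁻¹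
          simp only [inv_smul_smul] at h1
          exact hd (h1 ▸ h)
      have hdvd : p ∣ Nat.card (MulAction.orbit R d) := by
        obtain ⟨n, hn⟩ := hR.card_orbit d
        rw [hn]
        refine dvd_pow_self p ?_
        rintro rfl
        have hf : Fintype (MulAction.orbit R d) := Fintype.ofFinite _
        rw [pow_zero, Nat.card_eq_fintype_card] at hn
        exact hd (MulAction.mem_fixedPoints_iff_card_orbit_eq_one.2 hn)
      obtain ⟨m, hm⟩ := hdvd
      rw [hcard, hm, mul_comm, mul_smul, hM, smul_zero]

/-- In characteristic `p`, a function on the cosets of `H` that is invariant under a `p`-group `R`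
can be summed over the cosets `gH` with `R ≤ gHg⁻¹` only. -/
theorem cosetSum_eq_cosetSum_indicator {G : Type*} [Group G] [Finite G] {R H : Subgroup G}
    (hR : IsPGroup p R) (hM : ∀ m : M, p • m = 0) {F : G → M} (hF : CosetInvariant H F)
    (hRF : ∀ r ∈ R, ∀ g, F (r * g) = F g) :
    cosetSum H F = cosetSum H (Set.indicator {g | ∀ r ∈ R, g⁻¹ * r * g ∈ H} F) := by
  classical
  have := Fintype.ofFinite (G ⧸ H)
  rw [cosetSum_eq_sum, cosetSum_eq_sum,
    IsPGroup.sum_eq_sum_fixedPoints hR hM (C := G ⧸ H) (fun c => F c.out), Finset.sum_filter]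
  · refine Finset.sum_congr rfl fun c _ => ?_
    rw [Set.indicator_apply]
    refine if_congr ?_ rfl rfl
    rw [MulAction.mem_fixedPoints, Subtype.forall]
    refine forall₂_congr fun r hr => ?_
    change r • c = c ↔ _
    nth_rewrite 2 [← QuotientGroup.out_eq' c]
    nth_rewrite 1 [← QuotientGroup.out_eq' c]
    rw [MulAction.Quotient.smul_coe, eq_comm, QuotientGroup.eq, smul_eq_mul, mul_assoc]
  · rintro ⟨r, hr⟩ c
    induction c using QuotientGroup.induction_on with
    | H x =>
      change F (r • (x : G ⧸ H)).out = _
      rw [MulAction.Quotient.smul_coe, hF.apply_out, hF.apply_out, smul_eq_mul, hRF r hr]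

end PGroupSums

/-! ### Idempotents in algebraic algebras. -/

section Idempotents

open Polynomial in
/-- In an algebraic algebra every element has a power that is absorbed by an idempotent which is a
polynomial multiple of that power. -/
theorem exists_idempotent_polynomial {k E : Type*} [Field k] [Ring E] [Algebra k E] {f : E}
    (hf : IsIntegral k f) : ∃ (n : ℕ) (P : k[X]),
      (f ^ (n + 1) * aeval f P) * (f ^ (n + 1) * aeval f P) = f ^ (n + 1) * aeval f P ∧
      f ^ (n + 1) * (f ^ (n + 1) * aeval f P) = f ^ (n + 1) := by
  -- Write the minimal polynomial as `X ^ n * g` with `g` prime to `X`. With a Bézout relation `a *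
  -- X ^ (n + 1) + b * g = 1` the idempotent is `f ^ (n + 1) * a(f)`. The exponent `n + 1` keeps it
  -- a multiple of `f` even when `n = 0`.
  obtain ⟨g, hg, hndvd⟩ := exists_eq_pow_rootMultiplicity_mul_and_not_dvd (minpoly k f)
    (minpoly.ne_zero hf) 0
  set n := rootMultiplicity 0 (minpoly k f)
  rw [C_0, sub_zero] at hg hndvd
  have hcop : IsCoprime ((X : k[X]) ^ (n + 1)) g :=
    ((Polynomial.prime_X.irreducible.coprime_iff_not_dvd).2 hndvd).pow_left
  obtain ⟨a, b, hab⟩ := hcop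
  have h0 : f ^ (n + 1) * aeval f g = 0 := by
    have h1 : aeval f ((X : k[X]) * minpoly k f) = 0 := by rw [map_mul, minpoly.aeval, mul_zero]
    rw [hg, ← mul_assoc, ← pow_succ'] at h1
    simpa using h1
  have h2 : aeval f a * f ^ (n + 1) + aeval f b * aeval f g = 1 := by
    simpa using congrArg (aeval f) hab
  have hc : ∀ P : k[X], f ^ (n + 1) * aeval f P = aeval f P * f ^ (n + 1) := by
    intro P
    have := congrArg (aeval f) (mul_comm ((X : k[X]) ^ (n + 1)) P)
    simpa using this
  have hcc : ∀ P Q : k[X], aeval f P * aeval f Q = aeval f Q * aeval f P := by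
    intro P Q
    rw [← map_mul, mul_comm, map_mul]
  have h3 : f ^ (n + 1) * (f ^ (n + 1) * aeval f a) = f ^ (n + 1) := by
    calc f ^ (n + 1) * (f ^ (n + 1) * aeval f a)
        = f ^ (n + 1) * (aeval f a * f ^ (n + 1) + aeval f b * aeval f g)
            - (f ^ (n + 1) * aeval f g) * aeval f b := by
          rw [hc a, mul_add, hcc b g, ← mul_assoc (f ^ (n + 1)) (aeval f g)]
          abel
      _ = f ^ (n + 1) := by rw [h2, h0, zero_mul, mul_one, sub_zero]
  refine ⟨n, a, ?_, h3⟩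
  nth_rewrite 1 [hc a]
  rw [mul_assoc, h3, hc a]

end Idempotents

/-! ### Fitting's lemma and local endomorphism rings. -/

section Indecomposable

variable {k : Type u} [Field k] {G : Type} [Group G] {V : Type u} [AddCommGroup V] [Module k V]
  {ρ : Representation k G V}

/-- The range of an endomorphism that commutes with the action. -/
def rangeSub (ρ : Representation k G V) (e : Module.End k V) (he : ∀ g, Commute (ρ g) e) :
    Subrepresentation ρ where
  toSubmodule := LinearMap.range e
  apply_mem_toSubmodule g v := by
    rintro ⟨w, rfl⟩
    exact ⟨ρ g w, (LinearMap.congr_fun (he g).eq w).symm⟩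

theorem isCompl_rangeSub {e : Module.End k V} (hidem : e * e = e) (he : ∀ g, Commute (ρ g) e) :
    IsCompl (rangeSub ρ e he) (rangeSub ρ (1 - e) fun g => (Commute.one_right _).sub_right (he g)) := by
  constructor
  · rw [disjoint_iff_inf_le]
    intro v hv
    have hv : v ∈ LinearMap.range e ∧ v ∈ LinearMap.range (1 - e) := hv
    obtain ⟨⟨w, rfl⟩, x, hx⟩ := hv
    have h1 : e (e w) = e w := LinearMap.congr_fun hidem w
    have h2 : e ((1 - e) x) = 0 := by
      have : e * (1 - e) = 0 := by rw [mul_sub, mul_one, hidem, sub_self]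
      exact LinearMap.congr_fun this x
    rw [hx, h1] at h2
    change e w ∈ (⊥ : Submodule k V)
    rw [h2]
    exact zero_mem _
  · rw [codisjoint_iff_le_sup]
    intro v _
    change v ∈ LinearMap.range e ⊔ LinearMap.range (1 - e)
    rw [Submodule.mem_sup]
    exact ⟨e v, ⟨v, rfl⟩, (1 - e) v, ⟨v, rfl⟩, by simp⟩

theorem IsIndecomposable.idempotent_eq (hρ : IsIndecomposable ρ) {e : Module.End k V}
    (hidem : e * e = e) (he : ∀ g, Commute (ρ g) e) : e = 0 ∨ e = 1 := by
  have key : ∀ f : Module.End k V, ∀ hf : ∀ g, Commute (ρ g) f, rangeSub ρ f hf = ⊥ → f = 0 := by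
    intro f hf h
    ext v
    have h1 : f v ∈ rangeSub ρ f hf := ⟨v, rfl⟩
    rw [h] at h1
    exact h1
  rcases hρ.2 _ _ (isCompl_rangeSub hidem he) with h | h
  · exact Or.inl (key _ _ h)
  · exact Or.inr (sub_eq_zero.1 (key _ _ h)).symm

theorem commute_aeval {g : G} {f : Module.End k V} (h : Commute (ρ g) f) (P : Polynomial k) :
    Commute (ρ g) (Polynomial.aeval f P) := by
  induction P using Polynomial.induction_on' with
  | add a b ha hb => rw [map_add]; exact ha.add_right hb
  | monomial n a =>
    rw [Polynomial.aeval_monomial]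
    exact Commute.mul_right (Algebra.commutes a (ρ g)).symm (h.pow_right n)

/-- Fitting's lemma for an endomorphism of an indecomposable module. -/
theorem IsIndecomposable.isUnit_or_isNilpotent [FiniteDimensional k V] (hρ : IsIndecomposable ρ)
    {f : Module.End k V} (hf : ∀ g, Commute (ρ g) f) : IsUnit f ∨ IsNilpotent f := by
  obtain ⟨n, P, h1, h2⟩ := exists_idempotent_polynomial (Algebra.IsIntegral.isIntegral (R := k) f)
  rcases hρ.idempotent_eq h1 (fun g => ((hf g).pow_right _).mul_right (commute_aeval (hf g) P)) with
    h | h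
  · rw [h, mul_zero] at h2
    exact Or.inr ⟨_, h2.symm⟩
  · left
    rw [pow_succ', mul_assoc] at h
    exact IsUnit.of_mul_eq_one _ h

/-- The endomorphism ring of an indecomposable module is local. -/
theorem IsIndecomposable.exists_isUnit_of_isUnit_sum [FiniteDimensional k V]
    (hρ : IsIndecomposable ρ) {ι : Type*} (s : Finset ι) {t : ι → Module.End k V}
    (ht : ∀ i ∈ s, ∀ g, Commute (ρ g) (t i)) (hs : IsUnit (∑ i ∈ s, t i)) :
    ∃ i ∈ s, IsUnit (t i) := by
  classical
  have := hρ.1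
  induction s using Finset.induction_on with
  | empty =>
    rw [Finset.sum_empty] at hs
    exact absurd hs not_isUnit_zero
  | insert a s ha ih =>
    rw [Finset.sum_insert ha] at hs
    obtain ⟨U, hU⟩ := hs
    have hUc : ∀ g, Commute (ρ g) (U : Module.End k V) := by
      intro g
      rw [hU]
      exact (ht a (Finset.mem_insert_self _ _) g).add_right
        (Commute.sum_right _ _ _ fun i hi => ht i (Finset.mem_insert_of_mem hi) g)
    rcases hρ.isUnit_or_isNilpotent (f := ↑U⁻¹ * t a) (fun g =>
      ((hUc g).units_inv_right).mul_right (ht a (Finset.mem_insert_self _ _) g)) with h | h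
    · exact ⟨a, Finset.mem_insert_self _ _, (Units.isUnit_units_mul U⁻¹ (t a)).1 h⟩
    -- If `U⁻¹ * t a` is nilpotent, then `1 - U⁻¹ * t a` is a unit, and so is the sum of the
    -- remaining terms.
    · have h1 : ↑U⁻¹ * (∑ i ∈ s, t i) = 1 - ↑U⁻¹ * t a := by
        rw [eq_sub_iff_add_eq, ← mul_add, add_comm, ← hU, Units.inv_mul]
      have h2 := h.isUnit_one_sub
      rw [← h1] at h2
      obtain ⟨i, hi, hi'⟩ := ih (fun i hi => ht i (Finset.mem_insert_of_mem hi))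
        ((Units.isUnit_units_mul U⁻¹ _).1 h2)
      exact ⟨i, Finset.mem_insert_of_mem hi, hi'⟩

end Indecomposable

/-! ### Relative traces of endomorphisms. -/

section RelativeTrace

variable {k : Type*} [Field k] {G : Type} [Group G] {V W : Type*} [AddCommGroup V] [Module k V]
  [AddCommGroup W] [Module k W]

/-- The relative trace of an endomorphism that commutes with the action of `H`. -/
noncomputable def relTrace (ρ : Representation k G V) (H : Subgroup G) (f : Module.End k V) :
    Module.End k V :=
  cosetSum H fun g => ρ g * f * ρ g⁻¹

variable {ρ : Representation k G V} {H : Subgroup G}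

theorem cosetInvariant_conj {f : Module.End k V} (hf : ∀ h ∈ H, Commute (ρ h) f) :
    CosetInvariant H fun g => ρ g * f * ρ g⁻¹ := by
  intro g h hh
  simp only [mul_inv_rev, map_mul]
  rw [mul_assoc (ρ g), (hf h hh).eq, ← mul_assoc, ← mul_assoc, mul_assoc (ρ g * f), ← map_mul,
    mul_inv_cancel, map_one, mul_one]

variable [Finite G]

theorem commute_relTrace {f : Module.End k V} (hf : ∀ h ∈ H, Commute (ρ h) f) (x : G) :
    Commute (ρ x) (relTrace ρ H f) := by
  have h1 := map_cosetSum (AddMonoidHom.mulLeft (ρ x)) H fun g => ρ g * f * ρ g⁻¹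
  have h2 := map_cosetSum (AddMonoidHom.mulRight (ρ x)) H fun g => ρ g * f * ρ g⁻¹
  change ρ x * relTrace ρ H f = _ at h1
  change relTrace ρ H f * ρ x = _ at h2
  have hinv : CosetInvariant H fun g => ρ g * f * ρ g⁻¹ * ρ x := by
    intro g h hh
    exact congrArg (· * ρ x) (cosetInvariant_conj hf g h hh)
  rw [Commute, SemiconjBy, h1, h2]
  refine (Eq.trans ?_ (cosetSum_mul_left hinv x))
  refine cosetSum_congr fun g => ?_
  simp only [AddMonoidHom.coe_mulLeft, map_mul, mul_inv_rev, mul_assoc]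
  rw [← map_mul, inv_mul_cancel, map_one, mul_one]

/-- A `kG`-sandwich of a relative trace is a relative trace. -/
theorem comp_relTrace_comp {σ : Representation k G W} (i : Representation.IntertwiningMap σ ρ)
    (r : Representation.IntertwiningMap ρ σ) (f : Module.End k V) :
    r.toLinearMap ∘ₗ relTrace ρ H f ∘ₗ i.toLinearMap =
      relTrace σ H (r.toLinearMap ∘ₗ f ∘ₗ i.toLinearMap) := by
  let Φ : Module.End k V →+ Module.End k W :=
    AddMonoidHom.mk' (fun a => r.toLinearMap ∘ₗ a ∘ₗ i.toLinearMap)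
      fun a b => by rw [LinearMap.add_comp, LinearMap.comp_add]
  refine (map_cosetSum Φ H _).trans (cosetSum_congr fun g => ?_)
  ext w
  have h1 := i.isIntertwining _ _ g⁻¹ w
  have h2 := r.isIntertwining _ _ g (f (i (σ g⁻¹ w)))
  simpa [Φ, ← h1] using h2

/-- Together with `relTrace_mul`, this makes the traces of `H`-endomorphisms a two-sided ideal in
the ring of `kG`-endomorphisms. -/
theorem mul_relTrace {u : Module.End k V} (hu : ∀ g, Commute (ρ g) u) (f : Module.End k V) :
    u * relTrace ρ H f = relTrace ρ H (u * f) := by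
  refine (map_cosetSum (AddMonoidHom.mulLeft u) H _).trans (cosetSum_congr fun g => ?_)
  simp only [AddMonoidHom.coe_mulLeft, ← mul_assoc, (hu g).eq]

theorem relTrace_mul {u : Module.End k V} (hu : ∀ g, Commute (ρ g) u) (f : Module.End k V) :
    relTrace ρ H f * u = relTrace ρ H (f * u) := by
  refine (map_cosetSum (AddMonoidHom.mulRight u) H _).trans (cosetSum_congr fun g => ?_)
  simp only [AddMonoidHom.mulRight_apply, mul_assoc, (hu g⁻¹).eq]

theorem relTrace_sum {ι : Type*} (s : Finset ι) (f : ι → Module.End k V) :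
    relTrace ρ H (∑ i ∈ s, f i) = ∑ i ∈ s, relTrace ρ H (f i) := by
  refine Eq.trans (cosetSum_congr fun g => ?_) (cosetSum_sum s H fun i g => ρ g * f i * ρ g⁻¹)
  rw [Finset.mul_sum, Finset.sum_mul]

/-- Transitivity of the relative trace. -/
theorem relTrace_tower {K : Subgroup G} (hHK : H ≤ K) {f : Module.End k V}
    (hf : ∀ h ∈ H, Commute (ρ h) f) :
    relTrace ρ H f =
      relTrace ρ K (cosetSum H ((K : Set G).indicator fun g => ρ g * f * ρ g⁻¹)) := by
  rw [relTrace, cosetSum_tower hHK (cosetInvariant_conj hf)]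
  refine cosetSum_congr fun g => ?_
  let Φ : Module.End k V →+ Module.End k V :=
    (AddMonoidHom.mulRight (ρ g⁻¹)).comp (AddMonoidHom.mulLeft (ρ g))
  refine Eq.symm ((map_cosetSum Φ H _).trans (cosetSum_congr fun x => ?_))
  by_cases hx : x ∈ (K : Set G)
  · simp only [Set.indicator_of_mem hx, Φ, AddMonoidHom.coe_comp, Function.comp_apply,
      AddMonoidHom.coe_mulLeft, AddMonoidHom.mulRight_apply, map_mul, mul_inv_rev, mul_assoc]
  · simp only [Set.indicator_of_notMem hx, map_zero]

end RelativeTrace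

/-! ### Higman's criterion for relative projectivity. -/

section Higman

variable {k : Type u} [Field k] {G : Type} [Group G] [Finite G] {V : Type u} [AddCommGroup V]
  [Module k V] {ρ : Representation k G V} {H : Subgroup G}

open Representation MonoidAlgebra

/-- The projection of an induced module onto the summand that belongs to the trivial coset. -/
noncomputable def indProj {L : Type*} [AddCommGroup L] [Module k L] (τ : Representation k H L) :
    Module.End k (IndV H.subtype τ) :=
  Coinvariants.map _ _ ⟨LinearMap.rTensor L
    ((Finsupp.linearCombination k
      ((H : Set G).indicator fun g => (MonoidAlgebra.single g (1 : k)))) ∘ₗ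
      (MonoidAlgebra.coeffLinearEquiv k).toLinearMap), by
    intro h
    ext g a
    by_cases hg : g ∈ H
    · simp [Set.indicator, hg, H.mul_mem h.2 hg]
    · simp [Set.indicator, hg, H.mul_mem_cancel_left h.2]⟩

open Classical in
theorem indProj_mk {L : Type*} [AddCommGroup L] [Module k L] (τ : Representation k H L) (x : G)
    (a : L) : indProj τ (IndV.mk H.subtype τ x a) =
      if x ∈ H then IndV.mk H.subtype τ x a else 0 := by
  by_cases hx : x ∈ H <;> simp [indProj, Set.indicator, hx]

/-- The conjugates of `indProj` are the projections onto the summands belonging to the different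
cosets, and these add up to the identity. -/
theorem relTrace_indProj {L : Type*} [AddCommGroup L] [Module k L] (τ : Representation k H L) :
    relTrace (ind H.subtype τ) H (indProj τ) = 1 := by
  classical
  refine IndV.hom_ext _ _ fun x => LinearMap.ext fun a => ?_
  let Φ : Module.End k (IndV H.subtype τ) →+ IndV H.subtype τ :=
    (LinearMap.applyₗ (IndV.mk H.subtype τ x a)).toAddMonoidHom
  refine (map_cosetSum Φ H _).trans ?_
  have h1 : ∀ g : G, Φ (ind H.subtype τ g * indProj τ * ind H.subtype τ g⁻¹) =
      if x * g ∈ H then IndV.mk H.subtype τ x a else 0 := by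
    intro g
    change ind H.subtype τ g (indProj τ (ind H.subtype τ g⁻¹ (IndV.mk H.subtype τ x a))) = _
    rw [ind_mk, indProj_mk, inv_inv, apply_ite (ind H.subtype τ g), ind_mk, map_zero,
      mul_inv_cancel_right]
  rw [cosetSum_congr h1]
  -- In this model of induction `IndV.mk x a` lies in the summand of the right coset `Hx`, so
  -- exactly the left coset `x⁻¹H` contributes.
  refine (finsum_eq_single _ ((x⁻¹ : G) : G ⧸ H) fun c hc => ?_).trans ?_
  · refine if_neg fun hm => hc ?_

    rw [← QuotientGroup.out_eq' c, eq_comm, QuotientGroup.eq, inv_inv]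
    exact hm
  · have := (QuotientGroup.eq (s := H) (a := x⁻¹) (b := ((x⁻¹ : G) : G ⧸ H).out)).1
      (QuotientGroup.out_eq' _).symm
    rw [inv_inv] at this
    exact if_pos this

theorem commute_indProj {L : Type*} [AddCommGroup L] [Module k L] (τ : Representation k H L)
    (h : G) (hh : h ∈ H) : Commute (ind H.subtype τ h) (indProj τ) := by
  classical
  refine IndV.hom_ext _ _ fun x => LinearMap.ext fun a => ?_
  change ind H.subtype τ h (indProj τ (IndV.mk H.subtype τ x a)) =
    indProj τ (ind H.subtype τ h (IndV.mk H.subtype τ x a))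
  rw [ind_mk, indProj_mk, indProj_mk, apply_ite (ind H.subtype τ h), ind_mk, map_zero]
  exact if_congr (H.mul_mem_cancel_right (H.inv_mem hh)).symm rfl rfl

theorem indV_mk_mul {L : Type*} [AddCommGroup L] [Module k L] (τ : Representation k H L)
    (h : H) (x : G) (a : L) : IndV.mk H.subtype τ (h * x) (τ h a) = IndV.mk H.subtype τ x a := by
  have := Coinvariants.mk_self_apply (Representation.tprod ((leftRegular k G).comp H.subtype) τ) h
    (MonoidAlgebra.single x (1 : k) ⊗ₜ[k] a)
  simpa using this

/-- Higman's criterion. -/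
theorem isRelativelyProjective_iff :
    IsRelativelyProjective H ρ ↔
      ∃ f : Module.End k V, (∀ h ∈ H, Commute (ρ h) f) ∧ relTrace ρ H f = 1 := by
  constructor
  · rintro ⟨L, _, _, τ, i, r, hri⟩
    refine ⟨r.toLinearMap ∘ₗ indProj τ ∘ₗ i.toLinearMap, ?_, ?_⟩
    · intro h hh
      refine LinearMap.ext fun v => ?_
      change ρ h (r (indProj τ (i v))) = r (indProj τ (i (ρ h v)))
      rw [i.isIntertwining, ← r.isIntertwining]
      congr 1
      exact LinearMap.congr_fun (commute_indProj τ h hh).eq (i v)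
    · rw [← comp_relTrace_comp, relTrace_indProj]
      exact congrArg (fun f : IntertwiningMap ρ ρ => f.toLinearMap) hri
  · rintro ⟨f, hf, hf1⟩
    -- `L` is the restriction of `V` to `H`. In tensor notation `V` embeds by `v ↦ ∑ g ⊗ f(g⁻¹v)`,
    -- and the retraction is `g ⊗ v ↦ gv`; their composite is the trace of `f`. Since `IndV.mk` uses
    -- right cosets, `g` appears inverted below.
    let τ : Representation k H V := ρ.comp H.subtype
    let F : G → (V →ₗ[k] IndV H.subtype τ) := fun g => IndV.mk H.subtype τ g⁻¹ ∘ₗ f ∘ₗ ρ g⁻¹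
    have hF : CosetInvariant H F := by
      intro g h hh
      refine LinearMap.ext fun v => ?_
      change IndV.mk H.subtype τ (g * h)⁻¹ (f (ρ (g * h)⁻¹ v)) = IndV.mk H.subtype τ g⁻¹ (f (ρ g⁻¹ v))
      rw [mul_inv_rev, map_mul]
      have h1 : f (ρ h⁻¹ (ρ g⁻¹ v)) = ρ h⁻¹ (f (ρ g⁻¹ v)) :=
        (LinearMap.congr_fun (hf h⁻¹ (H.inv_mem hh)).eq (ρ g⁻¹ v)).symm
      rw [Module.End.mul_apply, h1]
      exact indV_mk_mul τ ⟨h⁻¹, H.inv_mem hh⟩ g⁻¹ (f (ρ g⁻¹ v))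
    have hi : ∀ x : G, cosetSum H F ∘ₗ ρ x = ind H.subtype τ x ∘ₗ cosetSum H F := by
      intro x
      have h1 := map_cosetSum (AddMonoidHom.mk' (fun a : V →ₗ[k] IndV H.subtype τ =>
        a ∘ₗ ρ x) fun a b => LinearMap.add_comp _ _ _) H F
      have h2 := map_cosetSum (AddMonoidHom.mk' (fun a : V →ₗ[k] IndV H.subtype τ =>
        ind H.subtype τ x ∘ₗ a) fun a b => LinearMap.comp_add _ _ _) H F
      refine h1.trans (Eq.trans ?_ h2.symm)
      have hinv : CosetInvariant H fun g => F g ∘ₗ ρ x := by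
        intro g h hh
        simp only [hF g h hh]
      refine Eq.trans (cosetSum_mul_left hinv x).symm (cosetSum_congr fun g => ?_)
      refine LinearMap.ext fun v => ?_
      change IndV.mk H.subtype τ (x * g)⁻¹ (f (ρ (x * g)⁻¹ (ρ x v))) =
        ind H.subtype τ x (IndV.mk H.subtype τ g⁻¹ (f (ρ g⁻¹ v)))
      rw [ind_mk, mul_inv_rev, ← Module.End.mul_apply (ρ _) (ρ _), ← map_mul, inv_mul_cancel_right]
    let R : IndV H.subtype τ →ₗ[k] V := Coinvariants.lift _
      (TensorProduct.lift ((Finsupp.lift _ _ _ fun h => ρ h⁻¹) ∘ₗ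
        (MonoidAlgebra.coeffLinearEquiv k).toLinearMap)) (by
        intro h
        ext g v
        simp [τ, ← Module.End.mul_apply, ← map_mul])
    have hR : ∀ x v, R (IndV.mk H.subtype τ x v) = ρ x⁻¹ v := by
      intro x v
      simp [R]
    refine ⟨V, inferInstance, inferInstance, τ, ⟨cosetSum H F, hi⟩, ⟨R, ?_⟩, ?_⟩
    · intro x
      refine IndV.hom_ext _ _ fun y => LinearMap.ext fun v => ?_
      change R (ind H.subtype τ x (IndV.mk H.subtype τ y v)) = ρ x (R (IndV.mk H.subtype τ y v))
      rw [ind_mk, hR, hR, mul_inv_rev, inv_inv, map_mul, Module.End.mul_apply]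
    · refine IntertwiningMap.ext ?_
      change R ∘ₗ cosetSum H F = LinearMap.id
      have h1 := map_cosetSum (AddMonoidHom.mk' (fun a : V →ₗ[k] IndV H.subtype τ =>
        R ∘ₗ a) fun a b => LinearMap.comp_add _ _ _) H F
      refine h1.trans (Eq.trans (cosetSum_congr fun g => ?_) hf1)
      refine LinearMap.ext fun v => ?_
      change R (IndV.mk H.subtype τ g⁻¹ (f (ρ g⁻¹ v))) = ρ g (f (ρ g⁻¹ v))
      rw [hR, inv_inv]

end Higman

/-! ### Powers of matrices and non-nilpotency. -/

section KernelPowers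

variable {k : Type*} [Field k] {X : Type*}

/-- The powers (with exponents shifted by one) of a square matrix. -/
noncomputable def kernelPow (T : X → X → k) : ℕ → X → X → k
  | 0 => T
  | n + 1 => fun x y => ∑ᶠ z, T x z * kernelPow T n z y

/-- No power of the matrix `T` vanishes. -/
def NonNilpotent (T : X → X → k) : Prop := ∀ n, ∃ x y, kernelPow T n x y ≠ 0

theorem kernelPow_eq [Fintype X] [DecidableEq X] (T : Matrix X X k) (n : ℕ) :
    kernelPow T n = (T ^ (n + 1) : Matrix X X k) := by
  induction n with
  | zero => rw [zero_add, pow_one]; rfl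
  | succ n ih =>
    rw [pow_succ']
    funext x y
    simp only [kernelPow, ih, Matrix.mul_apply]
    exact finsum_eq_sum_of_fintype _

theorem kernelPow_comp_equiv {X' : Type*} (e : X' ≃ X) (T : X → X → k) (n : ℕ) (x y : X') :
    kernelPow (fun a b => T (e a) (e b)) n x y = kernelPow T n (e x) (e y) := by
  induction n generalizing x with
  | zero => rfl
  | succ n ih =>
    simp only [kernelPow, ih]
    exact finsum_comp_equiv e (f := fun z => T (e x) z * kernelPow T n z (e y))

theorem NonNilpotent.comp_equiv {X' : Type*} (e : X' ≃ X) {T : X → X → k} (hT : NonNilpotent T) :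
    NonNilpotent fun a b => T (e a) (e b) := by
  intro n
  obtain ⟨x, y, h⟩ := hT n
  refine ⟨e.symm x, e.symm y, ?_⟩
  rwa [kernelPow_comp_equiv, e.apply_symm_apply, e.apply_symm_apply]

theorem kernelPow_smul (c : k) (T : X → X → k) (n : ℕ) (x y : X) :
    kernelPow (fun a b => c * T a b) n x y = c ^ (n + 1) * kernelPow T n x y := by
  induction n generalizing x with
  | zero => simp [kernelPow]
  | succ n ih =>
    simp only [kernelPow, ih]
    rw [← smul_eq_mul (c ^ _), smul_finsum]
    refine finsum_congr fun z => ?_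
    rw [smul_eq_mul]
    ring

theorem NonNilpotent.const_mul {c : k} (hc : c ≠ 0) {T : X → X → k} (hT : NonNilpotent T) :
    NonNilpotent fun a b => c * T a b := by
  intro n
  obtain ⟨x, y, h⟩ := hT n
  refine ⟨x, y, ?_⟩
  rw [kernelPow_smul]
  exact mul_ne_zero (pow_ne_zero _ hc) h

end KernelPowers

/-! ### Permutation modules and the Brauer homomorphism. -/

section PermutationModule

variable (k : Type u) [Field k] (p : ℕ) {G : Type} [Group G] {Ω : Type} [MulAction G Ω]

/-- `Q` is a `p`-group, and the trace from `1` to `N(Q)/Q` of some endomorphism of the permutation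
module on the fixed points of `Q` is not nilpotent. The trace is computed as the restriction of a
trace from `Q` to `G`. -/
def HasBrauerTrace (Q : Subgroup G) (Ω : Type) [MulAction G Ω] : Prop :=
  IsPGroup p Q ∧ ∃ a : Ω → Ω → k, (∀ h ∈ Q, ∀ x y, a (h • x) (h • y) = a x y) ∧
    NonNilpotent fun x y : MulAction.fixedPoints Q Ω =>
      cosetSum Q fun g => a (g⁻¹ • (x : Ω)) (g⁻¹ • (y : Ω))

variable {k p}

theorem cosetInvariant_matrix {Q : Subgroup G} {a : Ω → Ω → k}
    (ha : ∀ h ∈ Q, ∀ x y, a (h • x) (h • y) = a x y) (x y : Ω) :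
    CosetInvariant Q fun g => a (g⁻¹ • x) (g⁻¹ • y) := by
  intro g h hh
  simp only [mul_inv_rev, mul_smul]
  exact ha _ (Q.inv_mem hh) _ _

/-- A nonzero trace from `H`, evaluated at fixed points of a `p`-group `R`, forces `R` to be
subconjugate to `H`. -/
theorem card_le_of_cosetSum_ne_zero [Fact p.Prime] [CharP k p] [Finite G] {R H : Subgroup G}
    (hR : IsPGroup p R) {a : Ω → Ω → k} (ha : ∀ h ∈ H, ∀ x y, a (h • x) (h • y) = a x y) {x y : Ω}
    (hx : ∀ r ∈ R, r • x = x) (hy : ∀ r ∈ R, r • y = y)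
    (h : cosetSum H (fun g => a (g⁻¹ • x) (g⁻¹ • y)) ≠ 0) : Nat.card R ≤ Nat.card H := by
  rw [cosetSum_eq_cosetSum_indicator hR (fun m => by simp) (cosetInvariant_matrix ha x y)] at h
  -- If `R` is larger than `H`, no conjugate of `R` lies in `H`, so every term vanishes.
  · by_contra hlt
    apply h
    rw [cosetSum_congr (F' := fun _ => 0), cosetSum_const, smul_zero]
    intro g
    refine Set.indicator_of_notMem (fun hg => hlt ?_) _
    have hg : ∀ r ∈ R, g⁻¹ * r * g ∈ H := hg
    refine Nat.card_le_card_of_injective (fun r : R => (⟨g⁻¹ * r * g, hg r r.2⟩ : H)) ?_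
    intro r s hrs
    have := congrArg Subtype.val hrs
    simpa using this
  · intro r hr g
    have h1 : r⁻¹ • x = x := hx _ (R.inv_mem hr)
    have h2 : r⁻¹ • y = y := hy _ (R.inv_mem hr)
    simp only [mul_inv_rev, mul_smul, h1, h2]

variable (k Ω) in
/-- The basis of the permutation module. -/
noncomputable def permBasis : Module.Basis Ω k (MonoidAlgebra k Ω) :=
  .ofRepr (MonoidAlgebra.coeffLinearEquiv k)

variable [Fintype Ω] [DecidableEq Ω]

variable (k Ω) in
/-- The matrix of an endomorphism of the permutation module. -/
noncomputable def permMatrix : Module.End k (MonoidAlgebra k Ω) ≃ₐ[k] Matrix Ω Ω k :=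
  LinearMap.toMatrixAlgEquiv (permBasis k Ω)

theorem permMatrix_apply (f : Module.End k (MonoidAlgebra k Ω)) (x y : Ω) :
    permMatrix k Ω f x y = (f (MonoidAlgebra.single y 1)).coeff x := by
  rw [permMatrix, LinearMap.toMatrixAlgEquiv_apply]
  rfl

local notation "π" => Representation.ofMulAction k G Ω

theorem permMatrix_conj (f : Module.End k (MonoidAlgebra k Ω)) (g : G) (x y : Ω) :
    permMatrix k Ω (π g * f * π g⁻¹) x y = permMatrix k Ω f (g⁻¹ • x) (g⁻¹ • y) := by
  rw [permMatrix_apply, permMatrix_apply, Module.End.mul_apply, Module.End.mul_apply,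
    Representation.ofMulAction_single, Representation.coeff_ofMulAction]

theorem commute_iff_permMatrix (f : Module.End k (MonoidAlgebra k Ω)) (g : G) :
    Commute (π g) f ↔ ∀ x y, permMatrix k Ω f (g • x) (g • y) = permMatrix k Ω f x y := by
  have h1 : Commute (π g) f ↔ π g⁻¹ * f * π g = f := by
    constructor
    · intro h
      rw [mul_assoc, ← h.eq, ← mul_assoc, ← map_mul, inv_mul_cancel, map_one, one_mul]
    · intro h
      rw [Commute, SemiconjBy]
      nth_rewrite 1 [← h]
      rw [← mul_assoc, ← mul_assoc, ← map_mul, mul_inv_cancel, map_one, one_mul]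
  rw [h1, ← (permMatrix k Ω).injective.eq_iff, ← Matrix.ext_iff]
  have h2 := fun x y => permMatrix_conj f g⁻¹ x y
  simp only [inv_inv] at h2
  simp only [h2]

theorem permMatrix_relTrace [Finite G] (H : Subgroup G) (f : Module.End k (MonoidAlgebra k Ω))
    (x y : Ω) : permMatrix k Ω (relTrace π H f) x y =
      cosetSum H fun g => permMatrix k Ω f (g⁻¹ • x) (g⁻¹ • y) := by
  let Φ : Module.End k (MonoidAlgebra k Ω) →+ k :=
    AddMonoidHom.mk' (fun f => permMatrix k Ω f x y) fun a b => by simp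
  refine (map_cosetSum Φ H _).trans (cosetSum_congr fun g => ?_)
  exact permMatrix_conj f g x y

/-- The restriction of the matrix of an endomorphism to the fixed points of `Q`. -/
noncomputable def brauer (Q : Subgroup G) (f : Module.End k (MonoidAlgebra k Ω)) :
    Matrix (MulAction.fixedPoints Q Ω) (MulAction.fixedPoints Q Ω) k :=
  (permMatrix k Ω f).submatrix Subtype.val Subtype.val

theorem brauer_add (Q : Subgroup G) (f f' : Module.End k (MonoidAlgebra k Ω)) :
    brauer Q (f + f') = brauer Q f + brauer Q f' := by
  ext x y
  simp [brauer]

variable [Fact p.Prime] [CharP k p] [Finite G] [∀ Q : Subgroup G, Fintype (MulAction.fixedPoints Q Ω)]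

/-- The Brauer homomorphism is multiplicative. -/
theorem brauer_mul {Q : Subgroup G} (hQ : IsPGroup p Q) {f f' : Module.End k (MonoidAlgebra k Ω)}
    (hf : ∀ h ∈ Q, Commute (π h) f) (hf' : ∀ h ∈ Q, Commute (π h) f') :
    brauer Q (f * f') = brauer Q f * brauer Q f' := by
  classical
  ext x y
  -- As `x` and `y` are fixed by `Q`, the summand is a `Q`-invariant function of the middle index,
  -- so only fixed middle indices survive.
  rw [brauer, Matrix.submatrix_apply, map_mul, Matrix.mul_apply, Matrix.mul_apply,
    IsPGroup.sum_eq_sum_fixedPoints hQ (fun m => by simp)]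
  · rw [← Finset.sum_subtype_of_mem (p := (· ∈ MulAction.fixedPoints Q Ω))
      (fun z => permMatrix k Ω f x z * permMatrix k Ω f' z y) (fun z hz => (Finset.mem_filter.1 hz).2)]
    refine Finset.sum_congr ?_ fun z _ => rfl
    ext z
    simpa using fun h hh => z.2 ⟨h, hh⟩
  · rintro ⟨h, hh⟩ z
    have h1 := (commute_iff_permMatrix f h).1 (hf h hh) x z
    have h2 := (commute_iff_permMatrix f' h).1 (hf' h hh) z y
    rw [show h • (x : Ω) = x from x.2 ⟨h, hh⟩] at h1
    rw [show h • (y : Ω) = y from y.2 ⟨h, hh⟩] at h2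
    change permMatrix k Ω f x (h • z) * permMatrix k Ω f' (h • z) y = _
    rw [h1, h2]

theorem brauer_pow {Q : Subgroup G} (hQ : IsPGroup p Q) {f : Module.End k (MonoidAlgebra k Ω)}
    (hf : ∀ h ∈ Q, Commute (π h) f) (n : ℕ) : brauer Q (f ^ (n + 1)) = brauer Q f ^ (n + 1) := by
  induction n with
  | zero => simp
  | succ n ih =>
    rw [pow_succ, brauer_mul hQ (fun h hh => (hf h hh).pow_right _) hf, ih, ← pow_succ]

end PermutationModule

/-- These are the two projections of the decomposition; each differs from `1` because the other
summand is nonzero. In `HasBrauerTrace.isFixedPointSetOf` they give idempotents of smaller rank. -/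
theorem exists_idempotents_of_isCompl {k : Type*} [Field k] {G : Type} [Group G] {V : Type*}
    [AddCommGroup V] [Module k V] {ρ : Representation k G V} {U W : Subrepresentation ρ}
    (hUW : IsCompl U W) (hU : U ≠ ⊥) (hW : W ≠ ⊥) :
    ∃ ψ ψ' : Module.End k V, ψ * ψ = ψ ∧ ψ' * ψ' = ψ' ∧ (∀ g, Commute (ρ g) ψ) ∧
      (∀ g, Commute (ρ g) ψ') ∧ ψ ≠ 1 ∧ ψ' ≠ 1 ∧ ψ + ψ' = 1 := by
  have hUW' : IsCompl U.toSubmodule W.toSubmodule := by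
    constructor
    · rw [disjoint_iff_inf_le]
      have h : U ⊓ W ≤ ⊥ := disjoint_iff_inf_le.1 hUW.1
      exact h
    · rw [codisjoint_iff_le_sup]
      have h : ⊤ ≤ U ⊔ W := codisjoint_iff_le_sup.1 hUW.2
      exact h
  let ψ : Module.End k V := U.toSubmodule.projection W.toSubmodule hUW'
  have hψU : ∀ v ∈ U.toSubmodule, ψ v = v := fun v hv =>
    Submodule.projection_apply_of_mem_left hUW' hv
  have hψW : ∀ v ∈ W.toSubmodule, ψ v = 0 := fun v hv =>
    (Submodule.projection_apply_eq_zero_iff hUW').2 hv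
  have hdec : ∀ v, ∃ u ∈ U.toSubmodule, ∃ w ∈ W.toSubmodule, u + w = v := fun v =>
    Submodule.mem_sup.1 (hUW'.sup_eq_top ▸ Submodule.mem_top)
  have hψ : ψ * ψ = ψ := by
    refine LinearMap.ext fun v => ?_
    obtain ⟨u, hu, w, hw, rfl⟩ := hdec v
    simp only [Module.End.mul_apply, map_add, hψU u hu, hψW w hw, map_zero, add_zero]
  have hψc : ∀ g, Commute (ρ g) ψ := by
    intro g
    refine LinearMap.ext fun v => ?_
    obtain ⟨u, hu, w, hw, rfl⟩ := hdec v
    simp only [Module.End.mul_apply, map_add, hψU u hu, hψW w hw, map_zero, add_zero,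
      hψU _ (U.apply_mem_toSubmodule g hu), hψW _ (W.apply_mem_toSubmodule g hw)]
  refine ⟨ψ, 1 - ψ, hψ, IsIdempotentElem.one_sub hψ, hψc,
    fun g => (Commute.one_right _).sub_right (hψc g), fun h => hW ?_, fun h => hU ?_,
    add_sub_cancel _ _⟩
  · apply Subrepresentation.toSubmodule_injective
    refine (Submodule.eq_bot_iff _).2 fun w hw => ?_
    rw [← hψW w hw, h]
    rfl
  · apply Subrepresentation.toSubmodule_injective
    refine (Submodule.eq_bot_iff _).2 fun u hu => ?_
    rw [← hψU u hu, sub_eq_self.1 h]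
    rfl

/-! ### Vertices of components of permutation modules. -/

section Vertices

variable {k : Type u} [Field k] {p : ℕ} [Fact p.Prime] [CharP k p] {G : Type} [Group G] [Finite G]

/-- Vertices are `p`-groups. -/
theorem IsVertex.isPGroup {V : Type u} [AddCommGroup V] [Module k V] {ρ : Representation k G V}
    {Q : Subgroup G} (hQ : IsVertex Q ρ) : IsPGroup p Q := by
  obtain ⟨f, hf, hf1⟩ := isRelativelyProjective_iff.1 hQ.prop
  obtain ⟨S⟩ : Nonempty (Sylow p Q) := inferInstance
  -- For a Sylow subgroup `H` of `Q`, the trace of `f` from `H` to `Q` is `m • f` with `m = |Q : H|`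
  -- prime to `p`. Dividing by `m` shows relative `H`-projectivity, and minimality of `Q` gives `Q =
  -- H`.
  let H : Subgroup G := (S : Subgroup Q).map Q.subtype
  have hHQ : H ≤ Q := Subgroup.map_subtype_le _
  have hHp : IsPGroup p H := S.isPGroup'.map _
  have hfH : ∀ h ∈ H, Commute (ρ h) f := fun h hh => hf h (hHQ hh)
  obtain ⟨m, hm⟩ : ∃ m : ℕ, cosetSum H ((Q : Set G).indicator fun g => ρ g * f * ρ g⁻¹) = m • f ∧
      ¬ p ∣ m := by
    have hS : H.subgroupOf Q = S := Subgroup.comap_map_eq_self_of_injective Q.subtype_injective _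
    refine ⟨H.relIndex Q, ?_, by rw [Subgroup.relIndex, hS]; exact S.not_dvd_index⟩
    rw [← cosetSum_indicator_const hHQ]
    refine cosetSum_congr fun g => ?_
    by_cases hg : g ∈ (Q : Set G)
    · rw [Set.indicator_of_mem hg, Set.indicator_of_mem hg, (hf g hg).eq, mul_assoc, ← map_mul,
        mul_inv_cancel, map_one, mul_one]
    · rw [Set.indicator_of_notMem hg, Set.indicator_of_notMem hg]
  have hproj : IsRelativelyProjective H ρ := by
    have hm0 : (m : k) ≠ 0 := fun h => hm.2 ((CharP.cast_eq_zero_iff k p m).1 h)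
    refine isRelativelyProjective_iff.2 ⟨(m : k)⁻¹ • f, fun h hh => (hfH h hh).smul_right _, ?_⟩
    have h2 : relTrace ρ H f = (m : k) • 1 := by
      rw [relTrace_tower hHQ hfH, hm.1, ← hf1]
      let Φ : Module.End k V →+ Module.End k V := (m : k) • AddMonoidHom.id _
      refine Eq.trans ?_ (map_cosetSum Φ Q _).symm
      refine cosetSum_congr fun g => ?_
      change ρ g * m • f * ρ g⁻¹ = (m : k) • (ρ g * f * ρ g⁻¹)
      rw [Nat.cast_smul_eq_nsmul, mul_smul_comm, smul_mul_assoc]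
    let Φ : Module.End k V →+ Module.End k V := (m : k)⁻¹ • AddMonoidHom.id _
    have h3 := map_cosetSum Φ H fun g => ρ g * f * ρ g⁻¹
    change (m : k)⁻¹ • relTrace ρ H f = _ at h3
    rw [h2, smul_smul, inv_mul_cancel₀ hm0, one_smul] at h3
    rw [h3]
    refine cosetSum_congr fun g => ?_
    simp [Φ]
  have hQH : Q ≤ H := hQ.le_of_le hproj hHQ
  exact le_antisymm hQH hHQ ▸ hHp

variable {Ω : Type} [MulAction G Ω]

local notation "π" => Representation.ofMulAction k G Ω

/-- Orbit sums with a proper stabilizer are traces from proper subgroups. -/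
theorem relTrace_orbit_restriction [Fintype Ω] [DecidableEq Ω] {Q : Subgroup G} {a : Ω → Ω → k}
    (ha : ∀ h ∈ Q, ∀ x y, a (h • x) (h • y) = a x y) (x₀ y₀ : Ω)
    [DecidablePred (· ∈ MulAction.orbit Q (x₀, y₀))] :
    relTrace π Q ((permMatrix k Ω).symm (Matrix.of fun x y =>
        if (x, y) ∈ MulAction.orbit Q (x₀, y₀) then a x y else 0)) =
      relTrace π (Q ⊓ MulAction.stabilizer G (x₀, y₀))
        ((permMatrix k Ω).symm (Matrix.single x₀ y₀ (a x₀ y₀))) := by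
  set R := Q ⊓ MulAction.stabilizer G (x₀, y₀)
  have hinv : ∀ r ∈ R, Commute (π r) ((permMatrix k Ω).symm (Matrix.single x₀ y₀ (a x₀ y₀))) := by
    intro r hr
    rw [commute_iff_permMatrix]
    intro x y
    obtain ⟨hx, hy⟩ := Prod.ext_iff.1 (MulAction.mem_stabilizer_iff.1 hr.2)
    have hx : r • x₀ = x₀ := hx
    have hy : r • y₀ = y₀ := hy
    rw [AlgEquiv.apply_symm_apply, Matrix.single_apply, Matrix.single_apply]
    refine if_congr ?_ rfl rfl
    nth_rewrite 1 [← hx, ← hy]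
    rw [smul_left_cancel_iff, smul_left_cancel_iff]
  -- It remains to see that the trace from `R` to `Q` of the elementary matrix is the orbit matrix:
  -- the cosets of `R` in `Q` correspond to the points of the orbit.
  rw [relTrace_tower inf_le_left hinv]
  congr 1
  apply (permMatrix k Ω).injective
  rw [AlgEquiv.apply_symm_apply]
  ext x y
  let Φ : Module.End k (MonoidAlgebra k Ω) →+ k :=
    AddMonoidHom.mk' (fun f => permMatrix k Ω f x y) fun a b => by simp
  refine Eq.trans ?_ (map_cosetSum Φ R _).symm
  classical
  have hval : ∀ g : G, Φ ((Q : Set G).indicator (fun g => π g *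
      (permMatrix k Ω).symm (Matrix.single x₀ y₀ (a x₀ y₀)) * π g⁻¹) g) =
      if g ∈ Q ∧ g • (x₀, y₀) = (x, y) then a x₀ y₀ else 0 := by
    intro g
    by_cases hg : g ∈ Q
    · rw [Set.indicator_of_mem (show g ∈ (Q : Set G) from hg)]
      change permMatrix k Ω (π g * _ * π g⁻¹) x y = _
      rw [permMatrix_conj, AlgEquiv.apply_symm_apply, Matrix.single_apply]
      refine if_congr ?_ rfl rfl
      rw [eq_inv_smul_iff, eq_inv_smul_iff, Prod.smul_mk, Prod.mk.injEq]
      exact (and_iff_right hg).symm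
    · rw [Set.indicator_of_notMem (show g ∉ (Q : Set G) from hg), map_zero, if_neg (fun h => hg h.1)]
  rw [cosetSum_congr hval, Matrix.of_apply]
  by_cases hxy : (x, y) ∈ MulAction.orbit Q (x₀, y₀)
  · rw [if_pos hxy]
    obtain ⟨⟨g, hg⟩, hgxy⟩ := hxy
    have hgxy : g • (x₀, y₀) = (x, y) := hgxy
    obtain ⟨hx, hy⟩ := Prod.ext_iff.1 hgxy
    have hx : g • x₀ = x := hx
    have hy : g • y₀ = y := hy
    symm
    refine (finsum_eq_single _ (g : G ⧸ R) fun c hc => if_neg fun h => hc ?_).trans ?_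
    · rw [← QuotientGroup.out_eq' c, eq_comm, QuotientGroup.eq]
      refine ⟨Q.mul_mem (Q.inv_mem hg) h.1, ?_⟩
      change (g⁻¹ * c.out) • (x₀, y₀) = (x₀, y₀)
      rw [mul_smul, h.2, ← hgxy, inv_smul_smul]
    · obtain ⟨r, hr⟩ := QuotientGroup.mk_out_eq_mul R g
      rw [if_pos, ← hx, ← hy, ha g hg]
      rw [hr, mul_smul, show (r : G) • (x₀, y₀) = (x₀, y₀) from r.2.2]
      exact ⟨Q.mul_mem hg r.2.1, hgxy⟩
  · rw [if_neg hxy, cosetSum_congr (F' := fun _ => 0), cosetSum_const, smul_zero]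
    intro g
    exact if_neg fun h => hxy ⟨⟨g, h.1⟩, h.2⟩

/-- A vertex of a component of a permutation module has a nonzero Brauer trace. -/
theorem hasBrauerTrace_of_isVertex [Finite Ω] {V : Type u} [AddCommGroup V] [Module k V]
    {ρ : Representation k G V} {Q : Subgroup G} (hcomp : IsComponent ρ π)
    (hind : IsIndecomposable ρ) (hQ : IsVertex Q ρ) : HasBrauerTrace k p Q Ω := by
  classical
  have := Fintype.ofFinite Ω
  have hQp : IsPGroup p Q := hQ.isPGroup
  refine ⟨hQp, ?_⟩
  obtain ⟨i, r, hri⟩ := hcomp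
  have hri' : r.toLinearMap ∘ₗ i.toLinearMap = 1 :=
    congrArg (fun f : Representation.IntertwiningMap ρ ρ => f.toLinearMap) hri
  obtain ⟨f, hf, hf1⟩ := isRelativelyProjective_iff.1 hQ.prop
  have : FiniteDimensional k (MonoidAlgebra k Ω) := (permBasis k Ω).finiteDimensional_of_finite
  have : FiniteDimensional k V := FiniteDimensional.of_injective i.toLinearMap
    (Function.LeftInverse.injective (g := r.toLinearMap) fun v => LinearMap.congr_fun hri' v)
  -- `e` is the idempotent that projects onto the component, and it is the trace of `a` because the
  -- trace of `f` is `1`.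
  let a : Module.End k (MonoidAlgebra k Ω) := i.toLinearMap ∘ₗ f ∘ₗ r.toLinearMap
  let e : Module.End k (MonoidAlgebra k Ω) := i.toLinearMap ∘ₗ r.toLinearMap
  have hee : e * e = e := by
    change i.toLinearMap ∘ₗ (r.toLinearMap ∘ₗ i.toLinearMap) ∘ₗ r.toLinearMap = _
    rw [hri']
    rfl
  have hea : e * a = a := by
    change i.toLinearMap ∘ₗ (r.toLinearMap ∘ₗ i.toLinearMap) ∘ₗ f ∘ₗ r.toLinearMap = _
    rw [hri']
    rfl
  have he : ∀ g, Commute (π g) e := by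
    intro g
    refine LinearMap.ext fun v => ?_
    change π g (i (r v)) = i (r (π g v))
    rw [r.isIntertwining, i.isIntertwining]
  have ha : ∀ h ∈ Q, Commute (π h) a := by
    intro h hh
    refine LinearMap.ext fun v => ?_
    change π h (i (f (r v))) = i (f (r (π h v)))
    rw [r.isIntertwining, ← i.isIntertwining]
    congr 1
    exact LinearMap.congr_fun (hf h hh).eq (r v)
  have hae : relTrace π Q a = e := by
    rw [← comp_relTrace_comp, hf1]
    rfl
  have ha' : ∀ h ∈ Q, ∀ x y, permMatrix k Ω a (h • x) (h • y) = permMatrix k Ω a x y :=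
    fun h hh => (commute_iff_permMatrix a h).1 (ha h hh)
  refine ⟨permMatrix k Ω a, ha', ?_⟩
  have hT : (fun x y : MulAction.fixedPoints Q Ω =>
      cosetSum Q fun g => permMatrix k Ω a (g⁻¹ • (x : Ω)) (g⁻¹ • (y : Ω))) = brauer Q e := by
    funext x y
    rw [← permMatrix_relTrace, hae]
    rfl
  rw [hT]
  have hidem : brauer Q e * brauer Q e = brauer Q e := by
    rw [← brauer_mul hQp (fun h _ => he h) (fun h _ => he h), hee]
  -- A nonzero idempotent matrix is not nilpotent.
  suffices hne : brauer Q e ≠ 0 by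
    intro n
    by_contra! hcon
    apply hne
    have hpow : brauer Q e ^ (n + 1) = brauer Q e := IsIdempotentElem.pow_succ_eq n hidem
    ext x y
    have := hcon x y
    rwa [kernelPow_eq, hpow] at this
  intro h0
  -- From `a = e * a` it follows that `a` vanishes on pairs of fixed points of `Q`. Next, `a` is
  -- decomposed along the `Q`-orbits on `Ω × Ω`; each piece has the same trace as an elementary
  -- matrix over a stabilizer in `Q`.
  have hba : brauer Q a = 0 := by
    rw [← hea, brauer_mul hQp (fun h _ => he h) ha, h0, zero_mul]
  let P := MulAction.orbitRel.Quotient Q (Ω × Ω)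
  have := Fintype.ofFinite P
  let A : P → Module.End k (MonoidAlgebra k Ω) := fun O => (permMatrix k Ω).symm
    (Matrix.of fun x y => if (x, y) ∈ MulAction.orbit Q (O.out.1, O.out.2) then
      permMatrix k Ω a x y else 0)
  have hsum : ∑ O, A O = a := by
    apply (permMatrix k Ω).injective
    rw [map_sum]
    ext x y
    rw [Matrix.sum_apply, Finset.sum_eq_single (Quotient.mk'' (x, y) : P)]
    · rw [AlgEquiv.apply_symm_apply, Matrix.of_apply, if_pos]
      refine MulAction.orbitRel_apply.1 (Quotient.exact' ?_)
      exact (Quotient.out_eq' _).symm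
    · intro O _ hO
      rw [AlgEquiv.apply_symm_apply, Matrix.of_apply, if_neg]
      intro h
      apply hO
      rw [← Quotient.out_eq' O]
      exact (Quotient.sound' (MulAction.orbitRel_apply.2 h)).symm
    · intro h
      exact absurd (Finset.mem_univ _) h
  have htr := fun O : P => relTrace_orbit_restriction ha' O.out.1 O.out.2
  let E : P → Module.End k (MonoidAlgebra k Ω) := fun O => (permMatrix k Ω).symm
    (Matrix.single O.out.1 O.out.2 (permMatrix k Ω a O.out.1 O.out.2))
  let R : P → Subgroup G := fun O => Q ⊓ MulAction.stabilizer G (O.out.1, O.out.2)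
  let t : P → Module.End k V := fun O => relTrace ρ (R O) (r.toLinearMap ∘ₗ E O ∘ₗ i.toLinearMap)
  have ht : ∑ O, t O = 1 := by
    have h1 : ∀ O, t O = r.toLinearMap ∘ₗ relTrace π Q (A O) ∘ₗ i.toLinearMap := by
      intro O
      rw [htr O]
      exact (comp_relTrace_comp i r _).symm
    rw [Finset.sum_congr rfl fun O _ => h1 O]
    have h2 : r.toLinearMap ∘ₗ relTrace π Q (∑ O, A O) ∘ₗ i.toLinearMap =
        ∑ O, r.toLinearMap ∘ₗ relTrace π Q (A O) ∘ₗ i.toLinearMap := by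
      rw [relTrace_sum]
      refine LinearMap.ext fun v => ?_
      simp
    rw [← h2, hsum, hae]
    change (r.toLinearMap ∘ₗ i.toLinearMap) ∘ₗ (r.toLinearMap ∘ₗ i.toLinearMap) = _
    rw [hri']
    rfl
  have hRE : ∀ O, ∀ h ∈ R O, Commute (ρ h) (r.toLinearMap ∘ₗ E O ∘ₗ i.toLinearMap) := by
    intro O h hh
    have hE : Commute (π h) (E O) := by
      rw [commute_iff_permMatrix]
      intro x y
      obtain ⟨hx, hy⟩ := Prod.ext_iff.1 (MulAction.mem_stabilizer_iff.1 hh.2)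
      have hx : h • O.out.1 = O.out.1 := hx
      have hy : h • O.out.2 = O.out.2 := hy
      rw [AlgEquiv.apply_symm_apply, Matrix.single_apply, Matrix.single_apply]
      refine if_congr ?_ rfl rfl
      rw [← inv_smul_eq_iff, ← inv_smul_eq_iff, inv_smul_eq_iff.2 hx.symm, inv_smul_eq_iff.2 hy.symm]
    refine LinearMap.ext fun v => ?_
    change ρ h (r (E O (i v))) = r (E O (i (ρ h v)))
    rw [i.isIntertwining, ← r.isIntertwining]
    congr 1
    exact LinearMap.congr_fun hE.eq (i v)
  -- The traces of the pieces add up to `1` in a local ring, so one of them is invertible, and the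
  -- module is projective relative to its stabilizer `R O`. Minimality of `Q` makes the pair a pair
  -- of fixed points, where the entry of `a` is zero.
  obtain ⟨O, _, hO⟩ := hind.exists_isUnit_of_isUnit_sum Finset.univ
    (fun O _ g => commute_relTrace (hRE O) g) (ht ▸ isUnit_one)
  obtain ⟨U, hU⟩ := hO
  have hUc : ∀ g, Commute (ρ g) (↑U⁻¹ : Module.End k V) := by
    intro g
    have : Commute (ρ g) (U : Module.End k V) := by
      rw [hU]
      exact commute_relTrace (hRE O) g
    exact this.units_inv_right
  have hproj : IsRelativelyProjective (R O) ρ := by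
    refine isRelativelyProjective_iff.2
      ⟨↑U⁻¹ * (r.toLinearMap ∘ₗ E O ∘ₗ i.toLinearMap),
        fun h hh => (hUc h).mul_right (hRE O h hh), ?_⟩
    rw [← mul_relTrace hUc]
    exact hU ▸ U.inv_mul
  have hQR : Q ≤ R O := hQ.le_of_le hproj inf_le_left
  have hfix : ∀ h ∈ Q, h • O.out.1 = O.out.1 ∧ h • O.out.2 = O.out.2 :=
    fun h hh => Prod.ext_iff.1 (MulAction.mem_stabilizer_iff.1 (hQR hh).2)
  have hz : permMatrix k Ω a O.out.1 O.out.2 = 0 :=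
    congrFun (congrFun hba ⟨O.out.1, fun h => (hfix h h.2).1⟩) ⟨O.out.2, fun h => (hfix h h.2).2⟩
  have hE0 : E O = 0 := by
    simp only [E, hz, Matrix.single_zero, map_zero]
  have ht0 : t O = 0 := by
    have h1 := relTrace_sum (ρ := ρ) (H := R O) ∅ fun _ : Unit => (0 : Module.End k V)
    simp only [Finset.sum_empty] at h1
    simp only [t, hE0, LinearMap.zero_comp, LinearMap.comp_zero]
    exact h1
  have := hind.1
  exact U.ne_zero (hU.trans ht0)

/-- A subgroup with a nonzero Brauer trace is a vertex of a component of the permutation module. -/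
theorem HasBrauerTrace.isFixedPointSetOf [Finite Ω] {Q : Subgroup G}
    (h : HasBrauerTrace k p Q Ω) : IsFixedPointSetOf k G (MulAction.fixedPoints Q Ω) := by
  classical
  have := Fintype.ofFinite Ω
  have : FiniteDimensional k (MonoidAlgebra k Ω) := (permBasis k Ω).finiteDimensional_of_finite
  obtain ⟨hQp, a', ha', hT⟩ := h
  let a := (permMatrix k Ω).symm (Matrix.of a')
  have ha : ∀ h ∈ Q, Commute (π h) a := by
    intro h hh
    rw [commute_iff_permMatrix, AlgEquiv.apply_symm_apply]
    exact ha' h hh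
  -- Among the idempotents that are traces from `Q` and survive the Brauer homomorphism, one of
  -- minimal rank will be shown to have an indecomposable image with vertex `Q`. Existence follows
  -- by taking an idempotent polynomial in the trace of `a`.
  let S : Set (Module.End k (MonoidAlgebra k Ω)) := {e | e * e = e ∧ (∀ g, Commute (π g) e) ∧
    (∃ c, (∀ h ∈ Q, Commute (π h) c) ∧ e = relTrace π Q c) ∧ brauer Q e ≠ 0}
  have hS : S.Nonempty := by
    let b := relTrace π Q a
    have hb : ∀ g, Commute (π g) b := commute_relTrace ha
    obtain ⟨n, P, h1, h2⟩ := exists_idempotent_polynomial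
      (Algebra.IsIntegral.isIntegral (R := k) b)
    have hc := fun g => commute_aeval (hb g) P
    refine ⟨_, h1, fun g => ((hb g).pow_right _).mul_right (hc g),
      ⟨a * (b ^ n * Polynomial.aeval b P), fun h hh =>
        (ha h hh).mul_right (((hb h).pow_right _).mul_right (hc h)), ?_⟩, fun h0 => ?_⟩
    · rw [← relTrace_mul (fun g => ((hb g).pow_right _).mul_right (hc g)), ← mul_assoc, ← pow_succ']
    · have h3 : brauer Q b ^ (n + 1) = 0 := by
        rw [← brauer_pow hQp (fun h _ => hb h), ← h2, brauer_mul hQp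
          (fun h _ => (hb h).pow_right _) (fun h _ => ((hb h).pow_right _).mul_right (hc h)), h0,
          mul_zero]
      have hbT : brauer Q b = (fun x y : MulAction.fixedPoints Q Ω =>
          cosetSum Q fun g => a' (g⁻¹ • (x : Ω)) (g⁻¹ • (y : Ω))) := by
        funext x y
        change permMatrix k Ω (relTrace π Q a) x y = _
        rw [permMatrix_relTrace, AlgEquiv.apply_symm_apply]
        rfl
      obtain ⟨x, y, hxy⟩ := hT n
      rw [← hbT, kernelPow_eq, h3] at hxy
      exact hxy rfl
  let rk : Module.End k (MonoidAlgebra k Ω) → ℕ := fun e => Module.finrank k (LinearMap.range e)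
  obtain ⟨e, ⟨hidem, he, ⟨c, hcQ, hc⟩, hbr⟩, hmin⟩ := WellFounded.has_min (measure rk).wf S hS
  let N := rangeSub π e he
  let ρ := N.toRepresentation
  let i : Representation.IntertwiningMap ρ π := ⟨N.toSubmodule.subtype, fun g => rfl⟩
  let r : Representation.IntertwiningMap π ρ := ⟨LinearMap.rangeRestrict e, fun g => by
    refine LinearMap.ext fun v => Subtype.ext ?_
    exact (LinearMap.congr_fun (he g).eq v).symm⟩
  have hri : r.toLinearMap ∘ₗ i.toLinearMap = 1 := by
    refine LinearMap.ext fun v => Subtype.ext ?_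
    obtain ⟨w, hw⟩ := v.2
    change e (v : MonoidAlgebra k Ω) = v
    rw [← hw]
    exact LinearMap.congr_fun hidem w
  have hir : i.toLinearMap ∘ₗ r.toLinearMap = e := rfl
  -- A proper idempotent of the image `N` gives an idempotent of smaller rank that is again a trace
  -- from `Q`, by the ideal property. By minimality the Brauer homomorphism kills it.
  have hsmall : ∀ ψ : Module.End k N.toSubmodule, ψ * ψ = ψ → (∀ g, Commute (ρ g) ψ) → ψ ≠ 1 →
      brauer Q (i.toLinearMap ∘ₗ ψ ∘ₗ r.toLinearMap) = 0 := by
    intro ψ hψ hψc hψ1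
    by_contra hne
    have hψe : (i.toLinearMap ∘ₗ ψ ∘ₗ r.toLinearMap) * e = i.toLinearMap ∘ₗ ψ ∘ₗ r.toLinearMap := by
      rw [← hir]
      change i.toLinearMap ∘ₗ ψ ∘ₗ (r.toLinearMap ∘ₗ i.toLinearMap) ∘ₗ r.toLinearMap = _
      rw [hri]
      rfl
    have hcm : ∀ g, Commute (π g) (i.toLinearMap ∘ₗ ψ ∘ₗ r.toLinearMap) := by
      intro g
      refine LinearMap.ext fun v => ?_
      change π g (i (ψ (r v))) = i (ψ (r (π g v)))
      rw [r.isIntertwining, ← i.isIntertwining]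
      congr 1
      exact LinearMap.congr_fun (hψc g).eq (r v)
    refine hmin (i.toLinearMap ∘ₗ ψ ∘ₗ r.toLinearMap) ⟨?_, hcm, ?_, hne⟩ ?_
    · change i.toLinearMap ∘ₗ ψ ∘ₗ (r.toLinearMap ∘ₗ i.toLinearMap) ∘ₗ ψ ∘ₗ r.toLinearMap = _
      rw [hri]
      change i.toLinearMap ∘ₗ (ψ * ψ) ∘ₗ r.toLinearMap = _
      rw [hψ]
    · refine ⟨(i.toLinearMap ∘ₗ ψ ∘ₗ r.toLinearMap) * c,
        fun h hh => (hcm h).mul_right (hcQ h hh), ?_⟩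
      rw [← mul_relTrace hcm, ← hc, hψe]
    · have hlt : LinearMap.range ψ < ⊤ := by
        refine lt_top_iff_ne_top.2 fun htop => hψ1 ?_
        refine LinearMap.ext fun v => ?_
        obtain ⟨w, rfl⟩ := LinearMap.range_eq_top.1 htop v
        exact LinearMap.congr_fun hψ w
      calc Module.finrank k (LinearMap.range (i.toLinearMap ∘ₗ ψ ∘ₗ r.toLinearMap))
          ≤ Module.finrank k (LinearMap.range (ψ ∘ₗ r.toLinearMap)) := by
            rw [LinearMap.range_comp]
            exact Submodule.finrank_map_le _ _
        _ ≤ Module.finrank k (LinearMap.range ψ) :=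
            Submodule.finrank_mono (LinearMap.range_comp_le_range _ _)
        _ < Module.finrank k N.toSubmodule := Submodule.finrank_lt hlt.ne
  refine ⟨N.toSubmodule, inferInstance, inferInstance, ρ, Q,
    ⟨i, r, Representation.IntertwiningMap.ext hri⟩, ⟨?_, ?_⟩, ⟨?_, ?_⟩, rfl⟩
  · rw [Submodule.nontrivial_iff_ne_bot]
    intro hbot
    apply hbr
    have : e = 0 := LinearMap.range_eq_bot.1 hbot
    rw [this]
    ext x y
    simp [brauer]
  · intro U W hUW
    by_contra! hne
    obtain ⟨ψ, ψ', hψ, hψ', hψc, hψc', h1, h2, hadd⟩ :=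
      exists_idempotents_of_isCompl hUW hne.1 hne.2
    apply hbr
    have h3 := hsmall ψ hψ hψc h1
    have h4 := hsmall ψ' hψ' hψc' h2
    have h5 : e = (i.toLinearMap ∘ₗ ψ ∘ₗ r.toLinearMap) +
        (i.toLinearMap ∘ₗ ψ' ∘ₗ r.toLinearMap) := by
      rw [← LinearMap.comp_add, ← LinearMap.add_comp, hadd]
      rfl
    rw [h5, brauer_add, h3, h4, add_zero]
  · change IsRelativelyProjective Q ρ
    refine isRelativelyProjective_iff.2 ⟨r.toLinearMap ∘ₗ c ∘ₗ i.toLinearMap, ?_, ?_⟩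
    · intro h hh
      refine LinearMap.ext fun v => ?_
      change ρ h (r (c (i v))) = r (c (i (ρ h v)))
      rw [i.isIntertwining, ← r.isIntertwining]
      congr 1
      exact LinearMap.congr_fun (hcQ h hh).eq (i v)
    · rw [← comp_relTrace_comp, ← hc, ← hir]
      change (r.toLinearMap ∘ₗ i.toLinearMap) ∘ₗ (r.toLinearMap ∘ₗ i.toLinearMap) = _
      rw [hri]
      rfl
  -- If `H ≤ Q` also suffices, then `e` is a trace from `H` with a nonzero entry at fixed points of
  -- `Q`, which forces `|Q| ≤ |H|`.
  · intro H hH hHQ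
    obtain ⟨f, hf, hf1⟩ := isRelativelyProjective_iff.1 (show IsRelativelyProjective H ρ from hH)
    have hef : e = relTrace π H (i.toLinearMap ∘ₗ f ∘ₗ r.toLinearMap) := by
      rw [← comp_relTrace_comp, hf1]
      rfl
    have hcm : ∀ h ∈ H, Commute (π h) (i.toLinearMap ∘ₗ f ∘ₗ r.toLinearMap) := by
      intro h hh
      refine LinearMap.ext fun v => ?_
      change π h (i (f (r v))) = i (f (r (π h v)))
      rw [r.isIntertwining, ← i.isIntertwining]
      congr 1
      exact LinearMap.congr_fun (hf h hh).eq (r v)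
    obtain ⟨x, y, hxy⟩ : ∃ x y, brauer Q e x y ≠ 0 := by
      by_contra! hcon
      exact hbr (Matrix.ext hcon)
    rw [hef] at hxy
    change permMatrix k Ω _ (x : Ω) (y : Ω) ≠ 0 at hxy
    rw [permMatrix_relTrace] at hxy
    have hcard := card_le_of_cosetSum_ne_zero hQp
      (fun h hh => (commute_iff_permMatrix _ h).1 (hcm h hh)) (fun q hq => x.2 ⟨q, hq⟩)
      (fun q hq => y.2 ⟨q, hq⟩) hxy
    exact (Subgroup.eq_of_le_of_card_ge hHQ hcard).ge

end Vertices

/-! ### Tensor products of matrices and coset sums over direct products. -/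

section Products

variable {k : Type*} [Field k] {I : Type*} [Fintype I]

/-- Powers of a tensor product of matrices. -/
theorem kernelPow_prod {X : I → Type*} [∀ b, Finite (X b)] (T : ∀ b, X b → X b → k) (n : ℕ)
    (x y : ∀ b, X b) : kernelPow (fun x y : ∀ b, X b => ∏ b, T b (x b) (y b)) n x y =
      ∏ b, kernelPow (T b) n (x b) (y b) := by
  classical
  have := fun b => Fintype.ofFinite (X b)
  induction n generalizing x with
  | zero => rfl
  | succ n ih =>
    simp only [kernelPow, ih, ← Finset.prod_mul_distrib]
    simp only [finsum_eq_sum_of_fintype]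
    rw [Finset.prod_univ_sum, Fintype.piFinset_univ]

/-- Powers are taken factor by factor, so a nonzero entry chosen in each factor yields a nonzero
entry of the product. -/
theorem NonNilpotent.prod {X : I → Type*} [∀ b, Finite (X b)] {T : ∀ b, X b → X b → k}
    (hT : ∀ b, NonNilpotent (T b)) :
    NonNilpotent fun x y : ∀ b, X b => ∏ b, T b (x b) (y b) := by
  intro n
  choose x y h using fun b => hT b n
  refine ⟨x, y, ?_⟩
  rw [kernelPow_prod]
  exact Finset.prod_ne_zero_iff.2 fun b _ => h b

/-- A coset sum over a product of groups is a product of coset sums. -/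
theorem cosetSum_pi {G : Type*} [Group G] [Finite G] {Γ : I → Type*} [∀ b, Group (Γ b)]
    [∀ b, Finite (Γ b)] {φ : (∀ b, Γ b) →* G} (hφ : Function.Injective φ)
    {H : ∀ b, Subgroup (Γ b)} {F : G → k}
    (hF : CosetInvariant ((Subgroup.pi Set.univ H).map φ) F) (h0 : ∀ g, g ∉ φ.range → F g = 0)
    {f : ∀ b, Γ b → k} (hf : ∀ v, F (φ v) = ∏ b, f b (v b)) :
    cosetSum ((Subgroup.pi Set.univ H).map φ) F = ∏ b, cosetSum (H b) (f b) := by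
  classical
  have := Fintype.ofFinite (G ⧸ (Subgroup.pi Set.univ H).map φ)
  have := fun b => Fintype.ofFinite (Γ b ⧸ H b)
  simp only [cosetSum_eq_sum]
  rw [Finset.prod_univ_sum, Fintype.piFinset_univ]
  symm
  have hmk : ∀ v w : ∀ b, Γ b, (φ v : G ⧸ (Subgroup.pi Set.univ H).map φ) = φ w ↔
      ∀ b, (v b : Γ b ⧸ H b) = w b := by
    intro v w
    rw [QuotientGroup.eq, ← map_inv, ← map_mul, Subgroup.mem_map_iff_mem hφ, Subgroup.mem_pi]
    simp [QuotientGroup.eq]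
  -- Tuples of cosets embed into the cosets in `G`, and the cosets that are missed lie outside the
  -- range of `φ`, where `F` is zero.
  refine Finset.sum_of_injOn (fun c => ((φ fun b => (c b).out : G) :
    G ⧸ (Subgroup.pi Set.univ H).map φ)) ?_ (fun _ _ => Finset.mem_coe.2 (Finset.mem_univ _)) ?_ ?_
  · intro c _ d _ hcd
    funext b
    have := (hmk _ _).1 hcd b
    rwa [QuotientGroup.out_eq', QuotientGroup.out_eq'] at this
  · intro c _ hc
    apply h0
    rintro ⟨v, hv⟩
    apply hc
    refine ⟨fun b => (v b : Γ b ⧸ H b), Finset.mem_coe.2 (Finset.mem_univ _), ?_⟩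
    change ((φ fun b => (v b : Γ b ⧸ H b).out : G) : G ⧸ (Subgroup.pi Set.univ H).map φ) = c
    rw [← QuotientGroup.out_eq' c, ← hv, hmk]
    exact fun b => QuotientGroup.out_eq' _
  · intro c _
    rw [hF.apply_out, hf]

end Products

/-- An element of the normalizer permutes the fixed points. -/
theorem smul_mem_fixedPoints_of_mem_normalizer {G Ω : Type*} [Group G] [MulAction G Ω]
    {Q : Subgroup G} {g : G} (hg : g ∈ Subgroup.normalizer (Q : Set G)) {z : Ω}
    (hz : z ∈ MulAction.fixedPoints Q Ω) : g • z ∈ MulAction.fixedPoints Q Ω := by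
  rintro ⟨r, hr⟩
  change r • g • z = g • z
  have h1 : (g⁻¹ * r * g) • z = z := hz ⟨_, (Subgroup.mem_normalizer_iff''.1 hg r).1 hr⟩
  nth_rewrite 2 [← h1]
  rw [← mul_smul, ← mul_smul]
  congr 1
  group

/-! ### Brauer traces and normalizers. -/

section BrauerTraces

variable {k : Type u} [Field k] {p : ℕ} {G : Type} [Group G] {Ω : Type} [MulAction G Ω]

/-- Transport of structure. -/
theorem HasBrauerTrace.map {G' : Type} [Group G'] {Ω' : Type} [MulAction G' Ω'] [Finite G]
    {Q : Subgroup G} (h : HasBrauerTrace k p Q Ω) (φ : G ≃* G') (ψ : Ω ≃ Ω')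
    (hψ : ∀ g x, ψ (g • x) = φ g • ψ x) : HasBrauerTrace k p (Q.map φ.toMonoidHom) Ω' := by
  obtain ⟨hQ, a, ha, hT⟩ := h
  have hψ' : ∀ g x, ψ.symm (φ g • x) = g • ψ.symm x := by
    intro g x
    rw [Equiv.symm_apply_eq, hψ, Equiv.apply_symm_apply]
  have ha' : ∀ h ∈ Q.map φ.toMonoidHom, ∀ x y : Ω',
      a (ψ.symm (h • x)) (ψ.symm (h • y)) = a (ψ.symm x) (ψ.symm y) := by
    rintro _ ⟨h, hh, rfl⟩ x y
    change a (ψ.symm (φ h • x)) (ψ.symm (φ h • y)) = _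
    rw [hψ', hψ', ha h hh]
  refine ⟨hQ.map _, fun x y => a (ψ.symm x) (ψ.symm y), ha', ?_⟩
  have : Finite G' := Finite.of_equiv G φ.toEquiv
  let e : MulAction.fixedPoints (Q.map φ.toMonoidHom) Ω' ≃ MulAction.fixedPoints Q Ω :=
    ψ.symm.subtypeEquiv fun x => by
      constructor
      · rintro hx ⟨g, hg⟩
        have h1 := hx ⟨φ g, g, hg, rfl⟩
        change φ g • x = x at h1
        change g • ψ.symm x = ψ.symm x
        rw [← hψ', h1]
      · rintro hx ⟨_, g, hg, rfl⟩
        have h1 := hx ⟨g, hg⟩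
        change g • ψ.symm x = ψ.symm x at h1
        change φ g • x = x
        rw [← hψ', ψ.symm.injective.eq_iff] at h1
        exact h1
  convert hT.comp_equiv e using 3 with x y
  rw [cosetSum_map_mulEquiv φ (F := fun g => a (ψ.symm (g⁻¹ • (x : Ω'))) (ψ.symm (g⁻¹ • (y : Ω'))))
    (cosetInvariant_matrix (a := fun x y => a (ψ.symm x) (ψ.symm y)) ha' x y)]
  refine cosetSum_congr fun g => ?_
  simp only [← map_inv, hψ']
  rfl

variable [Fact p.Prime] [CharP k p] [Finite G]

/-- On fixed points, the trace from `Q` to `G` is the trace from `Q` to its normalizer. -/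
theorem cosetSum_eq_cosetSum_normalizer {Q : Subgroup G} (hQ : IsPGroup p Q) {a : Ω → Ω → k}
    (ha : ∀ h ∈ Q, ∀ x y, a (h • x) (h • y) = a x y) {x y : Ω}
    (hx : x ∈ MulAction.fixedPoints Q Ω) (hy : y ∈ MulAction.fixedPoints Q Ω) :
    cosetSum Q (fun g => a (g⁻¹ • x) (g⁻¹ • y)) =
      cosetSum Q (((Subgroup.normalizer (Q : Set G) : Subgroup G) : Set G).indicator
        fun g => a (g⁻¹ • x) (g⁻¹ • y)) := by
  rw [cosetSum_eq_cosetSum_indicator hQ (fun m => by simp) (cosetInvariant_matrix ha x y)]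
  · congr 2
    ext g
    change (∀ r ∈ Q, g⁻¹ * r * g ∈ Q) ↔ g ∈ Subgroup.normalizer (Q : Set G)
    rw [Subgroup.mem_normalizer_iff'']
    refine ⟨fun hg r => ⟨fun hr => hg r hr, fun hr => ?_⟩, fun hg r => (hg r).1⟩
    -- An inclusion `g⁻¹Qg ≤ Q` is an equality because `Q` is finite.
    let ψ : Q → Q := fun r => ⟨g⁻¹ * r * g, hg r r.2⟩
    have hinj : Function.Injective ψ := by
      intro r s hrs
      have := congrArg Subtype.val hrs
      simpa [ψ] using this
    obtain ⟨s, hs⟩ := (Finite.injective_iff_surjective.1 hinj) ⟨_, hr⟩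
    have : g⁻¹ * s * g = g⁻¹ * r * g := congrArg Subtype.val hs
    have hsr : (s : G) = r := by simpa using this
    exact hsr ▸ s.2
  · intro r hr g
    have h1 : r⁻¹ • x = x := hx ⟨r⁻¹, Q.inv_mem hr⟩
    have h2 : r⁻¹ • y = y := hy ⟨r⁻¹, Q.inv_mem hr⟩
    simp only [mul_inv_rev, mul_smul, h1, h2]

/-- A nonzero Brauer trace, written as a trace to the normalizer. -/
theorem HasBrauerTrace.exists_normalizer_invariant {Q : Subgroup G} (h : HasBrauerTrace k p Q Ω) :
    ∃ a T : Ω → Ω → k, (∀ h ∈ Q, ∀ x y, a (h • x) (h • y) = a x y) ∧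
      (∀ x y, T x y = cosetSum Q (((Subgroup.normalizer (Q : Set G) : Subgroup G) : Set G).indicator
        fun g => a (g⁻¹ • x) (g⁻¹ • y))) ∧
      (∀ g ∈ Subgroup.normalizer (Q : Set G), ∀ x y, T (g • x) (g • y) = T x y) ∧
      NonNilpotent fun x y : MulAction.fixedPoints Q Ω => T x y := by
  obtain ⟨hQ, a, ha, hT⟩ := h
  -- The cut-off sum is invariant under the normalizer on all of `Ω`; agreement with the trace to
  -- `G` is needed only at fixed points.
  refine ⟨a, fun x y => cosetSum Q (((Subgroup.normalizer (Q : Set G) : Subgroup G) : Set G).indicator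
        fun g => a (g⁻¹ • x) (g⁻¹ • y)), ha, fun _ _ => rfl, ?_, ?_⟩
  · intro n hn x y
    have hinv := (cosetInvariant_matrix ha x y).indicator Subgroup.le_normalizer
    refine Eq.trans (cosetSum_congr fun g => ?_) (cosetSum_mul_left hinv n⁻¹)
    have hmem : n⁻¹ * g ∈ Subgroup.normalizer (Q : Set G) ↔ g ∈ Subgroup.normalizer (Q : Set G) :=
      Subgroup.mul_mem_cancel_left _ (inv_mem hn)
    by_cases hg : g ∈ Subgroup.normalizer (Q : Set G)
    · rw [Set.indicator_of_mem (SetLike.mem_coe.2 hg),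
        Set.indicator_of_mem (SetLike.mem_coe.2 (hmem.2 hg)), mul_inv_rev, inv_inv, mul_smul,
        mul_smul]
    · rw [Set.indicator_of_notMem (fun h => hg h),
        Set.indicator_of_notMem (fun h => hg (hmem.1 h))]
  · convert hT using 3 with x y
    exact (cosetSum_eq_cosetSum_normalizer hQ ha x.2 y.2).symm

/-- It suffices to take the trace to a subgroup of the normalizer of index prime to `p`. -/
theorem hasBrauerTrace_of_subgroup {Q P : Subgroup G} (hQ : IsPGroup p Q) (hQP : Q ≤ P)
    (hPN : P ≤ Subgroup.normalizer (Q : Set G))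
    (hindex : ¬ p ∣ P.relIndex (Subgroup.normalizer (Q : Set G))) {a T : Ω → Ω → k}
    (ha : ∀ h ∈ Q, ∀ x y, a (h • x) (h • y) = a x y)
    (hTa : ∀ x ∈ MulAction.fixedPoints Q Ω, ∀ y ∈ MulAction.fixedPoints Q Ω,
      T x y = cosetSum Q ((P : Set G).indicator fun g => a (g⁻¹ • x) (g⁻¹ • y)))
    (hT : ∀ g ∈ Subgroup.normalizer (Q : Set G), ∀ x ∈ MulAction.fixedPoints Q Ω,
      ∀ y ∈ MulAction.fixedPoints Q Ω, T (g • x) (g • y) = T x y)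
    (hnn : NonNilpotent fun x y : MulAction.fixedPoints Q Ω => T x y) :
    HasBrauerTrace k p Q Ω := by
  refine ⟨hQ, a, ha, ?_⟩
  have hc : (P.relIndex (Subgroup.normalizer (Q : Set G)) : k) ≠ 0 :=
    fun h => hindex ((CharP.cast_eq_zero_iff k p _).1 h)
  convert hnn.const_mul hc using 3 with x y
  have hinv := cosetInvariant_matrix ha (x : Ω) y
  -- The trace from `Q` to the normalizer is the trace from `P` to the normalizer of `T`. As `T` is
  -- invariant already, this multiplies `T` by the index, which is nonzero in `k`.
  rw [cosetSum_eq_cosetSum_normalizer hQ ha x.2 y.2,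
    cosetSum_tower hQP (hinv.indicator Subgroup.le_normalizer), ← nsmul_eq_mul,
    ← cosetSum_indicator_const hPN]
  refine cosetSum_congr fun g => ?_
  by_cases hg : g ∈ Subgroup.normalizer (Q : Set G)
  · rw [Set.indicator_of_mem (SetLike.mem_coe.2 hg), ← hT g⁻¹ (inv_mem hg) x x.2 y y.2,
      hTa _ (smul_mem_fixedPoints_of_mem_normalizer (inv_mem hg) x.2) _
        (smul_mem_fixedPoints_of_mem_normalizer (inv_mem hg) y.2)]
    refine cosetSum_congr fun u => ?_
    by_cases hu : u ∈ P
    · rw [Set.indicator_of_mem (SetLike.mem_coe.2 hu), Set.indicator_of_mem (SetLike.mem_coe.2 hu),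
        Set.indicator_of_mem (SetLike.mem_coe.2 (mul_mem hg (hPN hu))), mul_inv_rev, mul_smul,
        mul_smul]
    · rw [Set.indicator_of_notMem (fun h => hu h), Set.indicator_of_notMem (fun h => hu h)]
  · rw [Set.indicator_of_notMem (fun h => hg h), cosetSum_congr (F' := fun _ => 0), cosetSum_const,
      smul_zero]
    intro u
    by_cases hu : u ∈ P
    · rw [Set.indicator_of_mem (SetLike.mem_coe.2 hu), Set.indicator_of_notMem]
      exact fun h => hg ((Subgroup.mul_mem_cancel_right _ (hPN hu)).1 h)
    · rw [Set.indicator_of_notMem (fun h => hu h)]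

end BrauerTraces

/-! ### Permutations with all cycles of length `q`, and splittings. -/

section RegularPermutations

theorem minimalPeriod_of_semiconj {α β : Type*} {f : α → β} (hf : Function.Injective f) {g : α → α}
    {h : β → β} (hfg : ∀ x, h (f x) = f (g x)) (x : α) :
    Function.minimalPeriod h (f x) = Function.minimalPeriod g x := by
  rw [Function.minimalPeriod_eq_minimalPeriod_iff]
  intro n
  have : h^[n] (f x) = f (g^[n] x) :=
    (Function.Semiconj.iterate_right (f := f) (ga := g) (gb := h) (fun x => (hfg x).symm) n x).symm
  rw [Function.IsPeriodicPt, Function.IsPeriodicPt, Function.IsFixedPt, Function.IsFixedPt, this,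
    hf.eq_iff]

/-- The permutations all of whose cycles, including the trivial ones, have length `q`. -/
def regPerm (q : ℕ) (α : Type*) : Set (Perm α) := {h | ∀ n, Function.minimalPeriod h n = q}

theorem permCongr_mem_regPerm {q : ℕ} {α β : Type*} (φ : α ≃ β) {h : Perm α} (hh : h ∈ regPerm q α) :
    φ.permCongr h ∈ regPerm q β := by
  intro n
  obtain ⟨x, rfl⟩ := φ.surjective n
  rw [minimalPeriod_of_semiconj φ.injective (g := h) (fun x => by simp), hh x]

/-- The map between sets of regular permutations that is induced by a bijection. -/
def regPermCongr {q : ℕ} {α β : Type*} (φ : α ≃ β) (h : regPerm q α) : regPerm q β :=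
  ⟨φ.permCongr h, permCongr_mem_regPerm φ h.2⟩

instance regPermMulAction (q : ℕ) (α : Type*) : MulAction (Perm α) (regPerm q α) where
  smul g h := ⟨g * h * g⁻¹, permCongr_mem_regPerm g h.2⟩
  one_smul h := Subtype.ext (by
    change (1 : Perm α) * h * (1 : Perm α)⁻¹ = h
    simp)
  mul_smul a b h := Subtype.ext (by
    change a * b * h * (a * b)⁻¹ = a * (b * h * b⁻¹) * a⁻¹
    simp [mul_assoc])

theorem coe_smul_regPerm {q : ℕ} {α : Type*} (g : Perm α) (h : regPerm q α) :
    ((g • h : regPerm q α) : Perm α) = g * h * g⁻¹ := rfl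

theorem smul_eq_self_iff {q : ℕ} {α : Type*} {g : Perm α} {h : regPerm q α} :
    g • h = h ↔ ∀ x, g ((h : Perm α) x) = (h : Perm α) (g x) := by
  rw [← Subtype.coe_inj, coe_smul_regPerm, mul_inv_eq_iff_eq_mul, Equiv.ext_iff]
  rfl

/-- `A` is a union of orbits such that the permutations in `W` can be chosen independently on `A`
and on its complement. -/
def IsSplit {α : Type*} (W : Set (Perm α)) (A : Set α) : Prop :=
  (∀ h ∈ W, ∀ x ∈ A, h x ∈ A) ∧
    ∀ h ∈ W, ∀ h' ∈ W, ∃ h'' ∈ W, (∀ x ∈ A, h'' x = h x) ∧ ∀ x ∉ A, h'' x = h' x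

end RegularPermutations

/-! ### Direct products of permutation groups acting on blocks. -/

section Blocks

variable {I : Type} {β : I → Type}

local notation "σ" => Equiv.Perm.sigmaCongrRightHom β

theorem sigmaHom_apply (v : ∀ b, Perm (β b)) (b : I) (e : β b) : σ v ⟨b, e⟩ = ⟨b, v b e⟩ := rfl

theorem exists_sigmaHom_eq [∀ b, Finite (β b)] (h : Perm (Σ b, β b)) (hh : ∀ x, (h x).1 = x.1) :
    ∃ v, σ v = h := by
  have h1 : ∀ b (e : β b), ∃ e' : β b, h ⟨b, e⟩ = ⟨b, e'⟩ := by
    intro b e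
    have h2 := hh ⟨b, e⟩
    rcases hx : h ⟨b, e⟩ with ⟨b', e'⟩
    rw [hx] at h2
    change b' = b at h2
    subst h2
    exact ⟨e', rfl⟩
  choose f hf using h1
  have hinj : ∀ b, Function.Injective (f b) := by
    intro b e e' hee
    have : h ⟨b, e⟩ = h ⟨b, e'⟩ := by rw [hf, hf, hee]
    simpa using h.injective this
  refine ⟨fun b => Equiv.ofBijective (f b) (Finite.injective_iff_bijective.1 (hinj b)), ?_⟩
  ext1 ⟨b, e⟩
  rw [hf]
  rfl

/-- The product of the groups `Q b`, acting on the disjoint union. -/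
def blockSub (Q : ∀ b, Subgroup (Perm (β b))) : Subgroup (Perm (Σ b, β b)) :=
  (Subgroup.pi Set.univ Q).map σ

theorem sigmaHom_mem_blockSub {Q : ∀ b, Subgroup (Perm (β b))} {v : ∀ b, Perm (β b)} :
    σ v ∈ blockSub Q ↔ ∀ b, v b ∈ Q b := by
  rw [blockSub, Subgroup.mem_map_iff_mem Equiv.Perm.sigmaCongrRightHom_injective, Subgroup.mem_pi]
  simp

theorem exists_of_mem_blockSub {Q : ∀ b, Subgroup (Perm (β b))} {u : Perm (Σ b, β b)}
    (hu : u ∈ blockSub Q) : ∃ v, (∀ b, v b ∈ Q b) ∧ σ v = u := by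
  obtain ⟨v, hv, rfl⟩ := hu
  exact ⟨v, fun b => hv b (Set.mem_univ b), rfl⟩

theorem sigmaHom_mulSingle_mem [DecidableEq I] {Q : ∀ b, Subgroup (Perm (β b))} {b : I}
    {u : Perm (β b)} : σ (Pi.mulSingle b u) ∈ blockSub Q ↔ u ∈ Q b := by
  rw [sigmaHom_mem_blockSub]
  constructor
  · intro h
    have := h b
    rwa [Pi.mulSingle_eq_same] at this
  · intro h b'
    rcases eq_or_ne b' b with rfl | hne
    · rwa [Pi.mulSingle_eq_same]
    · rw [Pi.mulSingle_eq_of_ne hne]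
      exact one_mem _

theorem sigmaHom_mulSingle_apply [DecidableEq I] {b : I} (u : Perm (β b)) (e : β b) :
    σ (Pi.mulSingle b u) ⟨b, e⟩ = ⟨b, u e⟩ := by
  rw [sigmaHom_apply, Pi.mulSingle_eq_same]

theorem sigmaHom_mulSingle_apply_of_ne [DecidableEq I] {b b' : I} (hne : b' ≠ b) (u : Perm (β b))
    (e : β b') : σ (Pi.mulSingle b u) ⟨b', e⟩ = ⟨b', e⟩ := by
  rw [sigmaHom_apply, Pi.mulSingle_eq_of_ne hne]
  rfl

variable {q : ℕ}

/-- The permutation of the disjoint union that is composed of regular permutations of the blocks. -/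
def glue (y : ∀ b, regPerm q (β b)) : regPerm q (Σ b, β b) :=
  ⟨σ fun b => y b, by
    rintro ⟨b, e⟩
    rw [minimalPeriod_of_semiconj (f := Sigma.mk b) sigma_mk_injective (g := (y b : Perm (β b)))
      (fun _ => rfl), (y b).2 e]⟩

theorem coe_glue (y : ∀ b, regPerm q (β b)) : (glue y : Perm (Σ b, β b)) = σ fun b => y b := rfl

theorem glue_injective : Function.Injective (glue (β := β) (q := q)) := by
  intro y z hyz
  have := Equiv.Perm.sigmaCongrRightHom_injective (congrArg Subtype.val hyz)
  funext b
  exact Subtype.ext (congrFun this b)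

theorem smul_glue (v : ∀ b, Perm (β b)) (y : ∀ b, regPerm q (β b)) :
    σ v • glue y = glue fun b => v b • y b := by
  apply Subtype.ext
  rw [coe_smul_regPerm, coe_glue, coe_glue, ← map_inv, ← map_mul, ← map_mul]
  rfl

variable {Q : ∀ b, Subgroup (Perm (β b))} [∀ b, Finite (β b)]

/-- Suppose that `z` commutes with the product and sends `e` from block `b` to another block. An
element `u` of `Q b` moving `e` fixes `z e`, hence also `e`, a contradiction. So `z` preserves the
blocks, and its components are centralized separately. -/
theorem mem_fixedPoints_blockSub (hfree : ∀ b e, ∃ u ∈ Q b, u e ≠ e) {z : regPerm q (Σ b, β b)} :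
    z ∈ MulAction.fixedPoints (blockSub Q) (regPerm q (Σ b, β b)) ↔
      ∃ y : ∀ b, regPerm q (β b), (∀ b, y b ∈ MulAction.fixedPoints (Q b) (regPerm q (β b))) ∧
        glue y = z := by
  classical
  constructor
  · intro hz
    have hcomm : ∀ u ∈ blockSub Q, ∀ x, u ((z : Perm (Σ b, β b)) x) = (z : Perm (Σ b, β b)) (u x) :=
      fun u hu => smul_eq_self_iff.1 (hz ⟨u, hu⟩)
    obtain ⟨v, hv⟩ := exists_sigmaHom_eq (z : Perm (Σ b, β b)) (by
      rintro ⟨b, e⟩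
      by_contra hne
      obtain ⟨u, hu, hue⟩ := hfree b e
      have h1 := hcomm _ (sigmaHom_mulSingle_mem.2 hu) ⟨b, e⟩
      rcases hx : (z : Perm (Σ b, β b)) ⟨b, e⟩ with ⟨b', e'⟩
      rw [hx] at hne h1
      rw [sigmaHom_mulSingle_apply_of_ne hne, sigmaHom_mulSingle_apply, ← hx] at h1
      have := (z : Perm (Σ b, β b)).injective h1
      exact hue (sigma_mk_injective this).symm)
    have hreg : ∀ b, v b ∈ regPerm q (β b) := by
      intro b e
      rw [← z.2 ⟨b, e⟩, ← hv]
      exact (minimalPeriod_of_semiconj (f := Sigma.mk b) sigma_mk_injective (fun _ => rfl) e).symm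
    refine ⟨fun b => ⟨v b, hreg b⟩, ?_, Subtype.ext hv⟩
    rintro b ⟨u, hu⟩
    refine smul_eq_self_iff.2 fun e => ?_
    have h1 := hcomm _ (sigmaHom_mulSingle_mem.2 hu) ⟨b, e⟩
    rw [← hv, sigmaHom_mulSingle_apply, sigmaHom_apply v b e, sigmaHom_mulSingle_apply,
      sigmaHom_apply v] at h1
    exact sigma_mk_injective h1
  · rintro ⟨y, hy, rfl⟩ ⟨u, hu⟩
    obtain ⟨v, hv, rfl⟩ := exists_of_mem_blockSub hu
    change σ v • glue y = glue y
    rw [smul_glue]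
    congr 1
    funext b
    exact hy b ⟨v b, hv b⟩

/-- If the blocks do not split, then they are permuted by the normalizer. -/
theorem fst_apply_eq_of_mem_normalizer (hfree : ∀ b e, ∃ u ∈ Q b, u e ≠ e)
    (hne : ∀ b, (MulAction.fixedPoints (Q b) (regPerm q (β b))).Nonempty)
    (hirr : ∀ b A, IsSplit (Subtype.val '' MulAction.fixedPoints (Q b) (regPerm q (β b))) A →
      A = ∅ ∨ A = Set.univ)
    {g : Perm (Σ b, β b)} (hg : g ∈ Subgroup.normalizer (blockSub Q : Set (Perm (Σ b, β b))))
    {b : I} (e e' : β b) : (g ⟨b, e⟩).1 = (g ⟨b, e'⟩).1 := by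
  classical
  let X := fun b => MulAction.fixedPoints (Q b) (regPerm q (β b))
  -- The points of block `b` that `g` sends to the same block as `e`. It is enough to show that they
  -- split off.
  let A : Set (β b) := {x | (g ⟨b, x⟩).1 = (g ⟨b, e⟩).1}
  have key : ∀ y : ∀ b, regPerm q (β b), (∀ b, y b ∈ X b) →
      ∃ y' : ∀ b, regPerm q (β b), (∀ b, y' b ∈ X b) ∧
        ∀ x, g (σ (fun b => y b) x) = σ (fun b => y' b) (g x) := by
    intro y hy
    obtain ⟨y', hy', hyy'⟩ := (mem_fixedPoints_blockSub hfree).1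
      (smul_mem_fixedPoints_of_mem_normalizer hg ((mem_fixedPoints_blockSub hfree).2 ⟨y, hy, rfl⟩))
    refine ⟨y', hy', fun x => ?_⟩
    have h1 := congrArg Subtype.val hyy'
    rw [coe_smul_regPerm, coe_glue, coe_glue, eq_mul_inv_iff_mul_eq] at h1
    exact (Equiv.ext_iff.1 h1 x).symm
  have keyinv : ∀ y : ∀ b, regPerm q (β b), (∀ b, y b ∈ X b) →
      ∃ y' : ∀ b, regPerm q (β b), (∀ b, y' b ∈ X b) ∧
        ∀ x, g (σ (fun b => y' b) x) = σ (fun b => y b) (g x) := by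
    intro y hy
    obtain ⟨y', hy', hyy'⟩ := (mem_fixedPoints_blockSub hfree).1
      (smul_mem_fixedPoints_of_mem_normalizer (inv_mem hg)
        ((mem_fixedPoints_blockSub hfree).2 ⟨y, hy, rfl⟩))
    refine ⟨y', hy', fun x => ?_⟩
    have h1 := congrArg Subtype.val hyy'
    rw [coe_smul_regPerm, coe_glue, coe_glue, inv_inv, mul_assoc, eq_inv_mul_iff_mul_eq] at h1
    exact Equiv.ext_iff.1 h1 x
  choose w hw using hne
  have hext : ∀ h ∈ X b, ∃ y : ∀ b, regPerm q (β b), (∀ b, y b ∈ X b) ∧ y b = h := by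
    intro h hh
    refine ⟨Function.update w b h, fun b' => ?_, Function.update_self _ _ _⟩
    rcases eq_or_ne b' b with rfl | hne
    · rwa [Function.update_self]
    · rw [Function.update_of_ne hne]
      exact hw b'
  have hsplit : IsSplit (Subtype.val '' X b) A := by
    constructor
    · rintro _ ⟨h, hh, rfl⟩ x hx
      obtain ⟨y, hy, rfl⟩ := hext h hh
      obtain ⟨y', hy', hyy'⟩ := key y hy
      have h1 := hyy' ⟨b, x⟩
      rw [sigmaHom_apply] at h1
      change (g ⟨b, (y b : Perm (β b)) x⟩).1 = _
      rw [h1]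
      exact hx
    · rintro _ ⟨h, hh, rfl⟩ _ ⟨h', hh', rfl⟩
      obtain ⟨y, hy, rfl⟩ := hext h hh
      obtain ⟨z, hz, rfl⟩ := hext h' hh'
      obtain ⟨y', hy', hyy'⟩ := key y hy
      obtain ⟨z', hz', hzz'⟩ := key z hz
      -- To combine `y` on `A` with `z` off `A`, conjugate both by `g`, take the component of the
      -- first at the target block of `e` and those of the second elsewhere, and conjugate back.
      obtain ⟨t, ht, htt⟩ := keyinv (Function.update z' (g ⟨b, e⟩).1 (y' (g ⟨b, e⟩).1)) (by
        intro b'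
        rcases eq_or_ne b' (g ⟨b, e⟩).1 with h | hne
        · subst h
          rw [Function.update_self]
          exact hy' _
        · rw [Function.update_of_ne hne]
          exact hz' b')
      refine ⟨t b, ⟨t b, ht b, rfl⟩, fun x hx => ?_, fun x hx => ?_⟩
      · have h1 := htt ⟨b, x⟩
        have hx : (g ⟨b, x⟩).1 = (g ⟨b, e⟩).1 := hx
        rw [← hx] at h1
        have h2 : σ (fun b' => ((Function.update z' (g ⟨b, x⟩).1 (y' (g ⟨b, x⟩).1) b' :
            regPerm q (β b')) : Perm (β b'))) (g ⟨b, x⟩) = σ (fun b => y' b) (g ⟨b, x⟩) := by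
          rcases hgx : g ⟨b, x⟩ with ⟨b', x'⟩
          rw [sigmaHom_apply, sigmaHom_apply, Function.update_self]
        rw [h2, ← hyy'] at h1
        exact sigma_mk_injective (g.injective h1)
      · have h1 := htt ⟨b, x⟩
        have hx : ¬ (g ⟨b, x⟩).1 = (g ⟨b, e⟩).1 := hx
        have h2 : σ (fun b' => ((Function.update z' (g ⟨b, e⟩).1 (y' (g ⟨b, e⟩).1) b' :
            regPerm q (β b')) : Perm (β b'))) (g ⟨b, x⟩) = σ (fun b => z' b) (g ⟨b, x⟩) := by
          generalize g ⟨b, x⟩ = u at hx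
          obtain ⟨b', x'⟩ := u
          rw [sigmaHom_apply, sigmaHom_apply, Function.update_of_ne hx]
        rw [h2, ← hzz'] at h1
        exact sigma_mk_injective (g.injective h1)
  rcases hirr b A hsplit with h | h
  · have : e ∈ A := rfl
    rw [h] at this
    exact this.elim
  · have : e' ∈ A := h ▸ Set.mem_univ e'
    exact this.symm

end Blocks

/-! ### The normalizer of a product of block groups. -/

section NormalizerOfBlocks

variable {I : Type} {β : I → Type}

local notation "σ" => Equiv.Perm.sigmaCongrRightHom β

theorem isPGroup_blockSub [Finite I] {p : ℕ} {Q : ∀ b, Subgroup (Perm (β b))}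
    (hQ : ∀ b, IsPGroup p (Q b)) : IsPGroup p (blockSub Q) := by
  have := Fintype.ofFinite I
  rintro ⟨u, hu⟩
  obtain ⟨v, hv, rfl⟩ := exists_of_mem_blockSub hu
  choose n hn using fun b => hQ b ⟨v b, hv b⟩
  refine ⟨∑ b, n b, Subtype.ext ?_⟩
  change σ v ^ p ^ (∑ b, n b) = 1
  rw [← map_pow]
  convert map_one σ
  funext b
  have h1 : v b ^ p ^ n b = 1 := congrArg Subtype.val (hn b)
  have h2 : p ^ n b ∣ p ^ ∑ b, n b :=
    pow_dvd_pow p (Finset.single_le_sum (fun _ _ => Nat.zero_le _) (Finset.mem_univ b))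
  obtain ⟨m, hm⟩ := h2
  rw [Pi.pow_apply, hm, pow_mul, h1, one_pow]
  rfl

theorem conj_mulSingle [DecidableEq I] (n : ∀ b, Perm (β b)) (b : I) (u : Perm (β b)) :
    n * Pi.mulSingle b u * n⁻¹ = Pi.mulSingle b (n b * u * (n b)⁻¹) := by
  funext b'
  rcases eq_or_ne b' b with rfl | hne
  · simp
  · simp [Pi.mulSingle_eq_of_ne hne]

variable {Q : ∀ b, Subgroup (Perm (β b))}

theorem sigmaHom_mem_normalizer_iff {n : ∀ b, Perm (β b)} :
    σ n ∈ Subgroup.normalizer (blockSub Q : Set (Perm (Σ b, β b))) ↔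
      ∀ b, n b ∈ Subgroup.normalizer (Q b : Set (Perm (β b))) := by
  classical
  constructor
  · intro h b
    rw [Subgroup.mem_normalizer_iff]
    intro u
    rw [← sigmaHom_mulSingle_mem, Subgroup.mem_normalizer_iff.1 h, ← map_inv, ← map_mul, ← map_mul,
      conj_mulSingle, sigmaHom_mulSingle_mem]
  · intro h
    have key : ∀ n : ∀ b, Perm (β b), (∀ b, n b ∈ Subgroup.normalizer (Q b : Set (Perm (β b)))) →
        ∀ u ∈ blockSub Q, σ n * u * (σ n)⁻¹ ∈ blockSub Q := by
      intro n hn u hu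
      obtain ⟨v, hv, rfl⟩ := exists_of_mem_blockSub hu
      rw [← map_inv, ← map_mul, ← map_mul, sigmaHom_mem_blockSub]
      exact fun b => (Subgroup.mem_normalizer_iff.1 (hn b) (v b)).1 (hv b)
    rw [Subgroup.mem_normalizer_iff]
    refine fun u => ⟨key n h u, fun hu => ?_⟩
    have h1 := key n⁻¹ (fun b => inv_mem (h b)) _ hu
    rw [map_inv] at h1
    convert h1 using 1
    group

/-- The normalizer of `blockSub Q` acts on the set of blocks. -/
theorem exists_blockAction [Nonempty I] [∀ b, Nonempty (β b)] [∀ b, Finite (β b)]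
    (hfst : ∀ g ∈ Subgroup.normalizer (blockSub Q : Set (Perm (Σ b, β b))), ∀ b (e e' : β b),
      (g ⟨b, e⟩).1 = (g ⟨b, e'⟩).1) :
    ∃ τ : Subgroup.normalizer (blockSub Q : Set (Perm (Σ b, β b))) →* Perm I,
      (∀ (g : Subgroup.normalizer (blockSub Q : Set (Perm (Σ b, β b)))) b e,
        ((g : Perm (Σ b, β b)) ⟨b, e⟩).1 = τ g b) ∧
      τ.ker = (blockSub fun b => Subgroup.normalizer (Q b : Set (Perm (β b)))).subgroupOf
        (Subgroup.normalizer (blockSub Q : Set (Perm (Σ b, β b)))) := by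
  let pt : ∀ b, β b := fun b => Classical.arbitrary _
  let Ψ : Subgroup.normalizer (blockSub Q : Set (Perm (Σ b, β b))) →* Function.End I :=
    { toFun := fun g b => ((g : Perm (Σ b, β b)) ⟨b, pt b⟩).1
      map_one' := rfl
      map_mul' := fun g h => by
        funext b
        change ((g : Perm (Σ b, β b)) ((h : Perm (Σ b, β b)) ⟨b, pt b⟩)).1 =
          ((g : Perm (Σ b, β b)) ⟨((h : Perm (Σ b, β b)) ⟨b, pt b⟩).1, pt _⟩).1
        exact hfst g g.2 _ _ _ }
  have hτ : ∀ (g : Subgroup.normalizer (blockSub Q : Set (Perm (Σ b, β b)))) b e,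
      ((g : Perm (Σ b, β b)) ⟨b, e⟩).1 = Ψ.toHomPerm g b :=
    fun g b e => hfst g g.2 b e (pt b)
  refine ⟨Ψ.toHomPerm, hτ, ?_⟩
  ext g
  rw [MonoidHom.mem_ker, Subgroup.mem_subgroupOf]
  constructor
  · intro hg
    obtain ⟨n, hn⟩ := exists_sigmaHom_eq (g : Perm (Σ b, β b)) (by
      rintro ⟨b, e⟩
      rw [hτ, hg]
      rfl)
    rw [← hn, sigmaHom_mem_blockSub]
    refine sigmaHom_mem_normalizer_iff.1 ?_
    rw [hn]
    exact g.2
  · intro hg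
    obtain ⟨n, -, hn⟩ := exists_of_mem_blockSub hg
    ext b
    rw [← hτ g b (pt b), ← hn]
    rfl

/-- The order of the group of permutations preserving a map with small fibres is prime to `p`. -/
theorem not_dvd_card_fibre_preserving [Finite I] {p : ℕ} [hp : Fact p.Prime] {J : Type} [Finite J]
    {c : I → J} (hc : ∀ j, Nat.card {b // c b = j} < p) {S : Subgroup (Perm I)}
    (hS : ∀ g ∈ S, ∀ b, c (g b) = c b) : ¬ p ∣ Nat.card S := by
  classical
  have := Fintype.ofFinite I
  have := Fintype.ofFinite J
  let S' : Subgroup (Perm I) :=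
    { carrier := {g | c ∘ g = c}
      mul_mem' := fun {g h} hg hh => by
        have hg : c ∘ g = c := hg
        have hh : c ∘ h = c := hh
        change (c ∘ g) ∘ h = c
        rw [hg, hh]
      one_mem' := rfl
      inv_mem' := fun {g} hg => by
        have hg : c ∘ g = c := hg
        change c ∘ (g⁻¹ : Perm I) = c
        nth_rewrite 1 [← hg]
        funext b
        simp }
  have hSS' : S ≤ S' := fun g hg => funext fun b => hS g hg b
  intro hdvd
  have h1 : p ∣ Nat.card S' := hdvd.trans (Subgroup.card_dvd_of_le hSS')
  -- The full group preserving `c` is the product of the symmetric groups of the fibres; `p` divides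
  -- no factorial of a number smaller than `p`.
  have h2 : Nat.card S' = ∏ j, (Fintype.card {b // c b = j}).factorial := by
    rw [← DomMulAct.stabilizer_card c, ← Nat.card_eq_fintype_card]
    rfl
  rw [h2, Prime.dvd_finsetProd_iff hp.out.prime] at h1
  obtain ⟨j, -, hj⟩ := h1
  rw [hp.out.dvd_factorial, ← Nat.card_eq_fintype_card] at hj
  exact absurd (hc j) (not_lt.2 hj)

/-- An element of the normalizer induces bijections between the blocks. -/
theorem exists_blockEquiv {g : Perm (Σ b, β b)}
    (hg : g ∈ Subgroup.normalizer (blockSub Q : Set (Perm (Σ b, β b)))) {π : Perm I}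
    (hπ : ∀ b e, (g ⟨b, e⟩).1 = π b) :
    ∃ φ : ∀ b, β b ≃ β (π b), (∀ b e, g ⟨b, e⟩ = ⟨π b, φ b e⟩) ∧
      ∀ b u, u ∈ Q b ↔ (φ b).permCongr u ∈ Q (π b) := by
  classical
  have h1 : ∀ b (e : β b), ∃ e' : β (π b), g ⟨b, e⟩ = ⟨π b, e'⟩ := by
    intro b e
    have h2 := hπ b e
    rcases hx : g ⟨b, e⟩ with ⟨b', e'⟩
    rw [hx] at h2
    change b' = π b at h2
    subst h2
    exact ⟨e', rfl⟩
  choose f hf using h1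
  have hbij : ∀ b, Function.Bijective (f b) := by
    intro b
    constructor
    · intro e e' hee
      have : g ⟨b, e⟩ = g ⟨b, e'⟩ := by rw [hf, hf, hee]
      simpa using g.injective this
    · intro e'
      obtain ⟨⟨b', e⟩, hx⟩ := g.surjective ⟨π b, e'⟩
      have hb : b' = b := by
        have := hπ b' e
        rw [hx] at this
        exact (π.injective this).symm
      subst hb
      refine ⟨e, ?_⟩
      rw [hf] at hx
      exact sigma_mk_injective hx
  refine ⟨fun b => Equiv.ofBijective (f b) (hbij b), hf, fun b u => ?_⟩
  rw [← sigmaHom_mulSingle_mem, Subgroup.mem_normalizer_iff.1 hg]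
  have : g * σ (Pi.mulSingle b u) * g⁻¹ =
      σ (Pi.mulSingle (π b) ((Equiv.ofBijective (f b) (hbij b)).permCongr u)) := by
    rw [mul_inv_eq_iff_eq_mul]
    ext1 ⟨b', e⟩
    rw [Equiv.Perm.mul_apply, Equiv.Perm.mul_apply]
    rcases eq_or_ne b' b with rfl | hne
    · rw [sigmaHom_mulSingle_apply, hf, hf, sigmaHom_mulSingle_apply]
      congr 1
      change _ = f b' (u ((Equiv.ofBijective (f b') (hbij b')).symm
        (Equiv.ofBijective (f b') (hbij b') e)))
      rw [Equiv.symm_apply_apply]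
    · rw [sigmaHom_mulSingle_apply_of_ne hne, hf, sigmaHom_mulSingle_apply_of_ne]
      exact fun h => hne (π.injective h)
  rw [this, sigmaHom_mulSingle_mem]

end NormalizerOfBlocks

/-! ### The Brauer trace of a product. -/

section BlockTrace

variable {k : Type u} [Field k] {p : ℕ} [Fact p.Prime] [CharP k p] {I : Type} [Finite I]
  [Nonempty I] {β : I → Type} [∀ b, Finite (β b)] [∀ b, Nonempty (β b)] {q : ℕ}
  {Q : ∀ b, Subgroup (Perm (β b))}

local notation "σ" => Equiv.Perm.sigmaCongrRightHom β

/-- The tensor product of functions in two variables on the sets of regular permutations of the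
blocks, extended by zero. -/
noncomputable def tensor [Fintype I] (T : ∀ b, regPerm q (β b) → regPerm q (β b) → k)
    (z z' : regPerm q (Σ b, β b)) : k :=
  Function.extend (Prod.map glue glue)
    (fun w : (∀ b, regPerm q (β b)) × (∀ b, regPerm q (β b)) => ∏ b, T b (w.1 b) (w.2 b)) 0 (z, z')

theorem tensor_glue [Fintype I] (T : ∀ b, regPerm q (β b) → regPerm q (β b) → k)
    (x y : ∀ b, regPerm q (β b)) : tensor T (glue x) (glue y) = ∏ b, T b (x b) (y b) :=
  (glue_injective.prodMap glue_injective).extend_apply _ _ (x, y)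

/-- The image of `glue` is stable under blockwise conjugation, so the extension by zero stays
invariant. -/
theorem tensor_smul [Fintype I] {T : ∀ b, regPerm q (β b) → regPerm q (β b) → k}
    {v : ∀ b, Perm (β b)} (hv : ∀ b x y, T b (v b • x) (v b • y) = T b x y)
    (z z' : regPerm q (Σ b, β b)) : tensor T (σ v • z) (σ v • z') = tensor T z z' := by
  have hr : ∀ z : regPerm q (Σ b, β b), (∃ x, glue x = σ v • z) ↔ ∃ x, glue x = z := by
    intro z
    constructor
    · rintro ⟨x, hx⟩
      refine ⟨fun b => v⁻¹ b • x b, ?_⟩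
      rw [← smul_glue, hx, map_inv, inv_smul_smul]
    · rintro ⟨x, rfl⟩
      exact ⟨_, (smul_glue v x).symm⟩
  by_cases h : (∃ x, glue x = z) ∧ ∃ y, glue y = z'
  · obtain ⟨⟨x, rfl⟩, ⟨y, rfl⟩⟩ := h
    rw [smul_glue, smul_glue, tensor_glue, tensor_glue]
    exact Finset.prod_congr rfl fun b _ => hv b _ _
  · have h' : ¬ ((∃ x, glue x = σ v • z) ∧ ∃ y, glue y = σ v • z') := by rwa [hr, hr]
    rw [tensor, tensor, Function.extend_apply', Function.extend_apply']
    · rfl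
    · rintro ⟨⟨x, y⟩, hxy⟩
      exact h ⟨⟨x, (Prod.ext_iff.1 hxy).1⟩, ⟨y, (Prod.ext_iff.1 hxy).2⟩⟩
    · rintro ⟨⟨x, y⟩, hxy⟩
      exact h' ⟨⟨x, (Prod.ext_iff.1 hxy).1⟩, ⟨y, (Prod.ext_iff.1 hxy).2⟩⟩

/-- The Brauer trace of a product of sets that do not split. -/
theorem hasBrauerTrace_blockSub {J : Type} [Finite J] {c : I → J}
    (hc : ∀ j, Nat.card {b // c b = j} < p) (hQ : ∀ b, IsPGroup p (Q b))
    (hfree : ∀ b e, ∃ u ∈ Q b, u e ≠ e)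
    (hirr : ∀ b A, IsSplit (Subtype.val '' MulAction.fixedPoints (Q b) (regPerm q (β b))) A →
      A = ∅ ∨ A = Set.univ)
    {a T : ∀ b, regPerm q (β b) → regPerm q (β b) → k}
    (ha : ∀ b, ∀ h ∈ Q b, ∀ x y, a b (h • x) (h • y) = a b x y)
    (hTa : ∀ b x y, T b x y = cosetSum (Q b)
      (((Subgroup.normalizer (Q b : Set (Perm (β b))) : Subgroup (Perm (β b))) :
        Set (Perm (β b))).indicator fun g => a b (g⁻¹ • x) (g⁻¹ • y)))
    (hT : ∀ b b' (φ : β b ≃ β b'), (∀ u, u ∈ Q b ↔ φ.permCongr u ∈ Q b') → c b = c b' ∧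
      ∀ x y, T b' (regPermCongr φ x) (regPermCongr φ y) = T b x y)
    (hnn : ∀ b, NonNilpotent fun x y : MulAction.fixedPoints (Q b) (regPerm q (β b)) => T b x y) :
    HasBrauerTrace k p (blockSub Q) (regPerm q (Σ b, β b)) := by
  classical
  have := Fintype.ofFinite I
  have hne : ∀ b, (MulAction.fixedPoints (Q b) (regPerm q (β b))).Nonempty := by
    intro b
    obtain ⟨x, -⟩ := hnn b 0
    exact ⟨x, x.2⟩
  obtain ⟨τ, hτ, hker⟩ := exists_blockAction (Q := Q)
    fun g hg b e e' => fst_apply_eq_of_mem_normalizer hfree hne hirr hg e e'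
  let P := blockSub fun b => Subgroup.normalizer (Q b : Set (Perm (β b)))
  have hQP : blockSub Q ≤ P := by
    intro u hu
    obtain ⟨v, hv, rfl⟩ := exists_of_mem_blockSub hu
    exact sigmaHom_mem_blockSub.2 fun b => Subgroup.le_normalizer (hv b)
  have hPN : P ≤ Subgroup.normalizer (blockSub Q : Set (Perm (Σ b, β b))) := by
    intro u hu
    obtain ⟨v, hv, rfl⟩ := exists_of_mem_blockSub hu
    exact sigmaHom_mem_normalizer_iff.2 hv
  have haQ : ∀ h ∈ blockSub Q, ∀ x y, tensor a (h • x) (h • y) = tensor a x y := by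
    intro h hh x y
    obtain ⟨v, hv, rfl⟩ := exists_of_mem_blockSub hh
    exact tensor_smul (fun b => ha b (v b) (hv b)) x y
  refine hasBrauerTrace_of_subgroup (isPGroup_blockSub hQ) hQP hPN ?_ (a := tensor a)
    (T := tensor T) haQ ?_ ?_ ?_
  -- `P` is the kernel of the action on the blocks inside the normalizer, so its index is the order
  -- of the group of induced block permutations. These preserve the colouring `c`.
  · rw [Subgroup.relIndex, ← hker, Subgroup.index_ker]
    refine not_dvd_card_fibre_preserving hc ?_
    rintro _ ⟨g, rfl⟩ b
    obtain ⟨φ, -, hφ⟩ := exists_blockEquiv g.2 (hτ g)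
    exact (hT _ _ (φ b) (hφ b)).1.symm
  -- At glued fixed points the trace from `Q` to `P` factors into the traces from `Q b` to `N(Q b)`.
  · intro z hz z' hz'
    obtain ⟨x, hx, rfl⟩ := (mem_fixedPoints_blockSub hfree).1 hz
    obtain ⟨y, hy, rfl⟩ := (mem_fixedPoints_blockSub hfree).1 hz'
    rw [tensor_glue, Finset.prod_congr rfl fun b _ => hTa b (x b) (y b)]
    symm
    refine cosetSum_pi Equiv.Perm.sigmaCongrRightHom_injective
      ((cosetInvariant_matrix haQ (glue x) (glue y)).indicator hQP) ?_ ?_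
    · intro g hg
      refine Set.indicator_of_notMem (fun h => hg ?_) _
      obtain ⟨v, -, rfl⟩ := exists_of_mem_blockSub h
      exact ⟨v, rfl⟩
    · intro v
      by_cases hv : ∀ b, v b ∈ Subgroup.normalizer (Q b : Set (Perm (β b)))
      · rw [Set.indicator_of_mem (SetLike.mem_coe.2 (sigmaHom_mem_blockSub.2 hv)), ← map_inv,
          smul_glue, smul_glue, tensor_glue]
        refine Finset.prod_congr rfl fun b _ => ?_
        rw [Set.indicator_of_mem (SetLike.mem_coe.2 (hv b))]
        rfl
      · rw [Set.indicator_of_notMem (fun h => hv (sigmaHom_mem_blockSub.1 h))]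
        push Not at hv
        obtain ⟨b, hb⟩ := hv
        exact (Finset.prod_eq_zero (Finset.mem_univ b)
          (Set.indicator_of_notMem (fun h => hb h) _)).symm
  -- An element of the normalizer permutes the factors of the tensor product; the compatibility `hT`
  -- of the `T b` under block bijections gives invariance after reindexing.
  · intro g hg z hz z' hz'
    obtain ⟨φ, hφ, hφQ⟩ := exists_blockEquiv hg (hτ ⟨g, hg⟩)
    have key : ∀ x x' : ∀ b, regPerm q (β b), glue x' = g • glue x →
        ∀ b, x' (τ ⟨g, hg⟩ b) = regPermCongr (φ b) (x b) := by
      intro x x' hxx b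
      apply Subtype.ext
      ext1 e
      obtain ⟨e, rfl⟩ := (φ b).surjective e
      have h1 := congrArg Subtype.val hxx
      rw [coe_smul_regPerm, coe_glue, coe_glue, eq_mul_inv_iff_mul_eq] at h1
      have h2 := Equiv.ext_iff.1 h1 ⟨b, e⟩
      rw [Equiv.Perm.mul_apply, Equiv.Perm.mul_apply, hφ, sigmaHom_apply, sigmaHom_apply, hφ] at h2
      have h3 := sigma_mk_injective h2
      rw [h3]
      change _ = φ b ((x b : Perm (β b)) ((φ b).symm (φ b e)))
      rw [Equiv.symm_apply_apply]
    obtain ⟨x', -, hx'⟩ := (mem_fixedPoints_blockSub hfree).1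
      (smul_mem_fixedPoints_of_mem_normalizer hg hz)
    obtain ⟨y', -, hy'⟩ := (mem_fixedPoints_blockSub hfree).1
      (smul_mem_fixedPoints_of_mem_normalizer hg hz')
    obtain ⟨x, hx, rfl⟩ := (mem_fixedPoints_blockSub hfree).1 hz
    obtain ⟨y, hy, rfl⟩ := (mem_fixedPoints_blockSub hfree).1 hz'
    rw [← hx', ← hy', tensor_glue, tensor_glue, ← Equiv.prod_comp (τ ⟨g, hg⟩)]
    refine Finset.prod_congr rfl fun b _ => ?_
    rw [key x x' hx', key y y' hy']
    exact (hT _ _ (φ b) (hφQ b)).2 _ _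
  · let e : (∀ b, MulAction.fixedPoints (Q b) (regPerm q (β b))) ≃
        MulAction.fixedPoints (blockSub Q) (regPerm q (Σ b, β b)) :=
      Equiv.ofBijective (fun x => ⟨glue fun b => x b,
        (mem_fixedPoints_blockSub hfree).2 ⟨_, fun b => (x b).2, rfl⟩⟩) ⟨by
          intro x y hxy
          have := glue_injective (congrArg Subtype.val hxy)
          funext b
          exact Subtype.ext (congrFun this b), by
          rintro ⟨z, hz⟩
          obtain ⟨y, hy, rfl⟩ := (mem_fixedPoints_blockSub hfree).1 hz
          exact ⟨fun b => ⟨y b, hy b⟩, rfl⟩⟩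
    convert (NonNilpotent.prod hnn).comp_equiv e.symm using 3 with z z'
    obtain ⟨x, rfl⟩ := e.surjective z
    obtain ⟨y, rfl⟩ := e.surjective z'
    rw [Equiv.symm_apply_apply, Equiv.symm_apply_apply]
    exact tensor_glue T _ _

end BlockTrace

/-! ### Symmetric groups of subsets of `ℕ`. -/

section Lifting

variable {A : Set ℕ} {α : Type}

open Classical in
/-- The permutation of `ℕ` that acts like a given one on the image of `e` and trivially
elsewhere. -/
noncomputable def liftPerm (e : α ≃ A) : Perm α →* Perm ℕ :=
  Equiv.Perm.extendDomainHom e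

theorem liftPerm_apply (e : α ≃ A) (h : Perm α) (a : α) : liftPerm e h (e a) = e (h a) := by
  classical
  exact Equiv.Perm.extendDomain_apply_image h e a

theorem liftPerm_apply_of_notMem (e : α ≃ A) (h : Perm α) {n : ℕ} (hn : n ∉ A) :
    liftPerm e h n = n := by
  classical
  exact Equiv.Perm.extendDomain_apply_not_subtype h e hn

theorem liftPerm_injective (e : α ≃ A) : Function.Injective (liftPerm e) := by
  classical
  exact Equiv.Perm.extendDomainHom_injective e

theorem eq_liftPerm_iff (e : α ≃ A) {ρ : Perm ℕ} {h : Perm α} (hρ : ρ ∈ symOn A) :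
    ρ = liftPerm e h ↔ ∀ a, ρ (e a) = e (h a) := by
  constructor
  · rintro rfl a
    exact liftPerm_apply e h a
  · intro H
    ext1 n
    by_cases hn : n ∈ A
    · obtain ⟨a, ha⟩ := e.surjective ⟨n, hn⟩
      have h1 : n = e a := by rw [ha]
      rw [h1, liftPerm_apply, H]
    · rw [liftPerm_apply_of_notMem e h hn, hρ n hn]

theorem liftPerm_mem_symOn (e : α ≃ A) (h : Perm α) : liftPerm e h ∈ symOn A :=
  fun _ hn => liftPerm_apply_of_notMem e h hn

theorem mem_of_mem_symOn {ρ : Perm ℕ} (hρ : ρ ∈ symOn A) {n : ℕ} (hn : n ∈ A) : ρ n ∈ A := by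
  by_contra h
  have h1 := ρ.injective (hρ _ h)
  rw [h1] at h
  exact h hn

theorem exists_liftPerm_eq (e : α ≃ A) {ρ : Perm ℕ} (hρ : ρ ∈ symOn A) :
    ∃ h, liftPerm e h = ρ := by
  have hmem : ∀ n, ρ n ∈ A ↔ n ∈ A := by
    refine fun n => ⟨fun h => ?_, mem_of_mem_symOn hρ⟩
    have := mem_of_mem_symOn (inv_mem hρ) h
    rwa [← Equiv.Perm.mul_apply, inv_mul_cancel, Equiv.Perm.one_apply] at this
  refine ⟨e.symm.permCongr (ρ.subtypePerm hmem), ((eq_liftPerm_iff e hρ).2 fun a => ?_).symm⟩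
  simp

/-- `Sym(A)` is the symmetric group on any type equivalent to `A`. -/
noncomputable def symEquiv (e : α ≃ A) : Perm α ≃* symOn A :=
  MulEquiv.ofBijective ((liftPerm e).codRestrict (symOn A) (liftPerm_mem_symOn e))
    ⟨fun _ _ h => liftPerm_injective e (congrArg Subtype.val h), fun ρ => by
      obtain ⟨h, hh⟩ := exists_liftPerm_eq e ρ.2
      exact ⟨h, Subtype.ext hh⟩⟩

theorem coe_symEquiv (e : α ≃ A) (h : Perm α) : (symEquiv e h : Perm ℕ) = liftPerm e h := rfl

theorem finite_symOn (hA : A.Finite) : Finite (symOn A) := by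
  have := hA.to_subtype
  exact Finite.of_equiv _ (symEquiv (Equiv.refl A)).toEquiv

/-- Every injection of a finite set of natural numbers into `ℕ` extends to a permutation. -/
theorem exists_perm_extending (hA : A.Finite) {f : ℕ → ℕ} (hf : Set.InjOn f A) :
    ∃ s : Perm ℕ, ∀ n ∈ A, s n = f n := by
  obtain ⟨s, hs⟩ := Cardinal.extend_function_of_lt (s := A)
    ⟨fun n => f n, fun a b hab => Subtype.ext (hf a.2 b.2 hab)⟩ (by
      have := hA.to_subtype
      rw [Cardinal.mk_nat]
      exact Cardinal.lt_aleph0_of_finite A) ⟨Equiv.refl ℕ⟩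
  exact ⟨s, fun n hn => hs ⟨n, hn⟩⟩

end Lifting

/-! ### Conjugacy of regular permutations. -/

section Conjugacy

theorem regPerm_apply_ne {q : ℕ} (hq : 2 ≤ q) {α : Type*} {h : Perm α} (hh : h ∈ regPerm q α)
    (x : α) : h x ≠ x := by
  intro hx
  have := hh x
  rw [Function.minimalPeriod_eq_one_iff_isFixedPt.2 hx] at this
  omega

theorem cycleType_of_mem_regPerm {q : ℕ} (hq : 2 ≤ q) {α : Type*} [Fintype α] [DecidableEq α]
    {h : Perm α} (hh : h ∈ regPerm q α) :
    h.cycleType = Multiset.replicate (Fintype.card α / q) q := by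
  have hmem : ∀ n ∈ h.cycleType, n = q := by
    intro n hn
    rw [Equiv.Perm.cycleType_def, Multiset.mem_map] at hn
    obtain ⟨c, hc, rfl⟩ := hn
    have hc' : c ∈ h.cycleFactorsFinset := hc
    obtain ⟨hcyc, hcx⟩ := Equiv.Perm.mem_cycleFactorsFinset_iff.1 hc'
    obtain ⟨x, hx⟩ := hcyc.nonempty_support
    have hcof := Equiv.Perm.cycle_is_cycleOf hx hc'
    -- The order of the cycle through `x` is the minimal period of `x` under `h`, namely `q`.
    have hpow : ∀ m : ℕ, c ^ m = 1 ↔ q ∣ m := by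
      intro m
      rw [hcyc.pow_eq_one_iff' (Equiv.Perm.mem_support.1 hx), hcof,
        Equiv.Perm.cycleOf_pow_apply_self, ← hh x, ← Function.isPeriodicPt_iff_minimalPeriod_dvd,
        Function.IsPeriodicPt, Function.IsFixedPt, Equiv.Perm.iterate_eq_pow]
    change c.support.card = q
    rw [← hcyc.orderOf]
    refine Nat.dvd_antisymm (orderOf_dvd_of_pow_eq_one ((hpow q).2 dvd_rfl)) ?_
    exact (hpow _).1 (pow_orderOf_eq_one c)
  have h1 := Multiset.eq_replicate.2 ⟨rfl, hmem⟩
  have h2 := h.sum_cycleType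
  have hsupp : h.support = Finset.univ :=
    Finset.eq_univ_of_forall fun x => Equiv.Perm.mem_support.2 (regPerm_apply_ne hq hh x)
  rw [h1, Multiset.sum_replicate, hsupp, Finset.card_univ, smul_eq_mul] at h2
  rw [h1, ← h2, Nat.mul_div_cancel _ (by omega)]

theorem exists_conj_of_mem_regPerm {q : ℕ} (hq : 2 ≤ q) {α : Type*} [Finite α] {h h' : Perm α}
    (hh : h ∈ regPerm q α) (hh' : h' ∈ regPerm q α) : ∃ g : Perm α, g * h * g⁻¹ = h' := by
  classical
  have := Fintype.ofFinite α
  rw [← isConj_iff, Equiv.Perm.isConj_iff_cycleType_eq, cycleType_of_mem_regPerm hq hh,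
    cycleType_of_mem_regPerm hq hh']

end Conjugacy

/-! ### Fixed point sets in terms of regular permutations of the support. -/

section ClassS

variable {q : ℕ} {X : Set (Perm ℕ)}

theorem mem_supp_singleton {ρ : Perm ℕ} {n : ℕ} : n ∈ supp {ρ} ↔ ρ n ≠ n := by
  simp [supp]

theorem apply_ne_iff (hX : X ∈ classS q) {ρ : Perm ℕ} (hρ : ρ ∈ X) {n : ℕ} :
    ρ n ≠ n ↔ n ∈ supp X := by
  rw [← hX.2.2 ρ hρ, mem_supp_singleton]

theorem finite_supp (hX : X ∈ classS q) : (supp X).Finite := by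
  obtain ⟨ρ, hρ⟩ := hX.1.2.1
  rw [← hX.2.2 ρ hρ]
  exact hX.1.1 ρ hρ

theorem nonempty_supp (hX : X ∈ classS q) : (supp X).Nonempty := by
  by_contra h
  rw [Set.not_nonempty_iff_eq_empty] at h
  refine hX.1.2.2.2 ((Set.Nonempty.subset_singleton_iff hX.1.2.1).1 fun ρ hρ => ?_)
  rw [Set.mem_singleton_iff]
  ext1 n
  by_contra hn
  have : n ∈ supp X := (apply_ne_iff hX hρ).1 hn
  rw [h] at this
  exact this

theorem mem_symSupp (hX : X ∈ classS q) {ρ : Perm ℕ} (hρ : ρ ∈ X) : ρ ∈ symSupp X := by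
  intro n hn
  by_contra h
  exact hn ((apply_ne_iff hX hρ).1 h)

variable {α : Type} (e : α ≃ supp X)

theorem liftPerm_minimalPeriod {A : Set ℕ} (e : α ≃ A) (h : Perm α) (a : α) :
    Function.minimalPeriod (liftPerm e h) (e a) = Function.minimalPeriod h a :=
  minimalPeriod_of_semiconj (f := fun a => (e a : ℕ)) (fun _ _ h => e.injective (Subtype.ext h))
    (fun a => liftPerm_apply e h a) a

theorem exists_regPerm_lift_eq (hX : X ∈ classS q) {ρ : Perm ℕ} (hρ : ρ ∈ X) :
    ∃ h ∈ regPerm q α, liftPerm e h = ρ := by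
  obtain ⟨h, hh⟩ := exists_liftPerm_eq e (mem_symSupp hX hρ)
  refine ⟨h, fun a => ?_, hh⟩
  rw [← liftPerm_minimalPeriod e, hh]
  exact hX.2.1 ρ hρ _ ((apply_ne_iff hX hρ).2 (e a).2)

/-- On `supp X` the members of `X` have all cycles of length `q`, and all such permutations of a
finite set are conjugate. So `Ξ_X` depends only on `supp X` and `q`. -/
theorem mem_conjClosure_iff (hq : 2 ≤ q) (hX : X ∈ classS q) {ρ : Perm ℕ} :
    ρ ∈ conjClosure X ↔ ∃ h ∈ regPerm q α, liftPerm e h = ρ := by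
  have := (finite_supp hX).to_subtype
  have : Finite α := Finite.of_equiv _ e.symm
  constructor
  · rintro ⟨g, hg, x, hx, rfl⟩
    obtain ⟨h, hh, rfl⟩ := exists_regPerm_lift_eq e hX hx
    obtain ⟨g', rfl⟩ := exists_liftPerm_eq e hg
    exact ⟨g' * h * g'⁻¹, permCongr_mem_regPerm g' hh, by simp⟩
  · rintro ⟨h, hh, rfl⟩
    obtain ⟨x, hx⟩ := hX.1.2.1
    obtain ⟨h', hh', rfl⟩ := exists_regPerm_lift_eq e hX hx
    obtain ⟨g, rfl⟩ := exists_conj_of_mem_regPerm hq hh' hh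
    exact ⟨liftPerm e g, liftPerm_mem_symOn e g, _, hx, by simp⟩

/-- `Ξ_X` is the set of regular permutations of the support of `X`. -/
noncomputable def conjClosureEquiv (hq : 2 ≤ q) (hX : X ∈ classS q) :
    regPerm q α ≃ conjClosure X :=
  Equiv.ofBijective (fun h => ⟨liftPerm e h, (mem_conjClosure_iff e hq hX).2 ⟨h, h.2, rfl⟩⟩)
    ⟨fun _ _ h => Subtype.ext (liftPerm_injective e (congrArg Subtype.val h)), fun ρ => by
      obtain ⟨h, hh, hρ⟩ := (mem_conjClosure_iff e hq hX).1 ρ.2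
      exact ⟨⟨h, hh⟩, Subtype.ext hρ⟩⟩

theorem coe_conjClosureEquiv (hq : 2 ≤ q) (hX : X ∈ classS q) (h : regPerm q α) :
    (conjClosureEquiv e hq hX h : Perm ℕ) = liftPerm e h := rfl

theorem coe_smul_conjClosure (g : symSupp X) (h : conjClosure X) :
    ((g • h : conjClosure X) : Perm ℕ) = g * h * (g : Perm ℕ)⁻¹ := rfl

theorem conjClosureEquiv_smul (hq : 2 ≤ q) (hX : X ∈ classS q) (g : Perm α) (h : regPerm q α) :
    conjClosureEquiv e hq hX (g • h) = symEquiv e g • conjClosureEquiv e hq hX h := by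
  apply Subtype.ext
  rw [coe_conjClosureEquiv, coe_smul_conjClosure, coe_smul_regPerm, coe_conjClosureEquiv,
    coe_symEquiv, map_mul, map_mul, map_inv]

variable {k : Type u} [Field k] {p : ℕ} [Fact p.Prime] [CharP k p]

theorem finite_conjClosure (hq : 2 ≤ q) (hX : X ∈ classS q) : Finite (conjClosure X) := by
  have := (finite_supp hX).to_subtype
  have : Finite (regPerm q (supp X)) := inferInstance
  exact Finite.of_equiv _ (conjClosureEquiv (Equiv.refl (supp X)) hq hX)

/-- A sufficient condition for a fixed point set, in terms of any model of the support. -/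
theorem isFixedPointSet_of_hasBrauerTrace (hq : 2 ≤ q) (hX : X ∈ classS q) {Q : Subgroup (Perm α)}
    (hQ : HasBrauerTrace k p Q (regPerm q α))
    (hfix : ∀ h : regPerm q α, h ∈ MulAction.fixedPoints Q (regPerm q α) ↔ liftPerm e h ∈ X) :
    IsFixedPointSet k X := by
  have := finite_symOn (finite_supp hX)
  have := finite_conjClosure hq hX
  have : Finite (Perm α) := Finite.of_equiv _ (symEquiv e).symm.toEquiv
  have h1 := (hQ.map (symEquiv e) (conjClosureEquiv e hq hX)
    (conjClosureEquiv_smul e hq hX)).isFixedPointSetOf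
  change IsFixedPointSetOf k (symSupp X) _
  refine (congrArg (IsFixedPointSetOf k (symSupp X)) ?_).mpr h1
  ext ρ
  obtain ⟨h, rfl⟩ := (conjClosureEquiv e hq hX).surjective ρ
  change liftPerm e h ∈ X ↔ _
  rw [← hfix]
  constructor
  · rintro hh ⟨_, g, hg, rfl⟩
    change symEquiv e g • conjClosureEquiv e hq hX h = _
    rw [← conjClosureEquiv_smul, show g • h = h from hh ⟨g, hg⟩]
  · rintro hh ⟨g, hg⟩
    have h2 : symEquiv e g • conjClosureEquiv e hq hX h = conjClosureEquiv e hq hX h :=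
      hh ⟨_, g, hg, rfl⟩
    rw [← conjClosureEquiv_smul] at h2
    exact (conjClosureEquiv e hq hX).injective h2

/-- An exact fixed point set is the fixed point set of a fixed-point-free `p`-group with a nonzero
Brauer trace. -/
theorem exists_hasBrauerTrace (hq : 2 ≤ q) (hX : X ∈ classS q) (hfixed : IsFixedPointSet k X)
    (hexact : IsExact p X) : ∃ Q : Subgroup (Perm α), HasBrauerTrace k p Q (regPerm q α) ∧
      (∀ h : regPerm q α, h ∈ MulAction.fixedPoints Q (regPerm q α) ↔ liftPerm e h ∈ X) ∧
      ∀ a, ∃ u ∈ Q, u a ≠ a := by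
  have := finite_symOn (finite_supp hX)
  have := finite_conjClosure hq hX
  obtain ⟨V, _, _, ρ, Q, hcomp, hind, hvert, hXQ⟩ := hfixed
  have hB : HasBrauerTrace k p Q (conjClosure X) := hasBrauerTrace_of_isVertex hcomp hind hvert
  let φ := (symEquiv e).symm
  let ψ := (conjClosureEquiv e hq hX).symm
  have hψ : ∀ g x, ψ (g • x) = φ g • ψ x := by
    intro g x
    rw [Equiv.symm_apply_eq, conjClosureEquiv_smul, Equiv.apply_symm_apply,
      MulEquiv.apply_symm_apply]
  have hXmem : ∀ x : conjClosure X, (x : Perm ℕ) ∈ X ↔ x ∈ MulAction.fixedPoints Q (conjClosure X) :=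
    fun x => Set.ext_iff.1 hXQ x
  refine ⟨_, hB.map φ ψ hψ, fun h => ?_, ?_⟩
  · obtain ⟨x, rfl⟩ := ψ.surjective h
    have h1 : liftPerm e (ψ x) = x := by
      rw [← coe_conjClosureEquiv e hq hX, Equiv.apply_symm_apply]
    rw [h1, hXmem]
    constructor
    · rintro hx ⟨g, hg⟩
      have h2 : φ g • ψ x = ψ x := hx ⟨φ g, g, hg, rfl⟩
      rw [← hψ] at h2
      exact ψ.injective h2
    · rintro hx ⟨_, g, hg, rfl⟩
      change φ g • ψ x = ψ x
      rw [← hψ, show g • x = x from hx ⟨g, hg⟩]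
  -- The vertex `Q` fixes `X` pointwise, so it lies in a Sylow subgroup `R` of `pointStab X`. Since
  -- `R` fixes the points of `X`, where the trace from `Q` has a nonzero entry, `|R| ≤ |Q|` and `Q =
  -- R`. Exactness then says that `Q` moves every point.
  · have hle : pointStab X ≤ symSupp X := inf_le_left
    let ι := Subgroup.inclusion hle
    have hmem : ∀ g ∈ Q, (g : Perm ℕ) ∈ pointStab X := by
      intro g hg
      refine ⟨g.2, Subgroup.mem_centralizer_iff.2 fun x hx => ?_⟩
      have hx' : x ∈ conjClosure X := ⟨1, one_mem _, x, hx, by simp⟩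
      have h1 : g • (⟨x, hx'⟩ : conjClosure X) = ⟨x, hx'⟩ := (hXmem ⟨x, hx'⟩).1 hx ⟨g, hg⟩
      have h2 := congrArg Subtype.val h1
      rw [coe_smul_conjClosure, mul_inv_eq_iff_eq_mul] at h2
      exact h2.symm
    have hQ'' : IsPGroup p (Q.comap ι) :=
      hB.1.comap_of_injective ι (Subgroup.inclusion_injective hle)
    obtain ⟨R, hR⟩ := hQ''.exists_le_sylow
    have hQR : Q ≤ (R : Subgroup (pointStab X)).map ι := by
      intro g hg
      exact ⟨⟨g, hmem g hg⟩, hR (show ι ⟨g, hmem g hg⟩ ∈ Q from hg), rfl⟩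
    obtain ⟨_, a, ha, hT⟩ := hB
    obtain ⟨x, y, hxy⟩ := hT 0
    have hfixR : ∀ x : conjClosure X, x ∈ MulAction.fixedPoints Q (conjClosure X) →
        ∀ r ∈ (R : Subgroup (pointStab X)).map ι, r • x = x := by
      rintro x hx _ ⟨r, -, rfl⟩
      apply Subtype.ext
      rw [coe_smul_conjClosure, mul_inv_eq_iff_eq_mul]
      exact (Subgroup.mem_centralizer_iff.1 r.2.2 x ((hXmem x).2 hx)).symm
    have hcard := card_le_of_cosetSum_ne_zero (R.isPGroup'.map ι) ha (hfixR x x.2) (hfixR y y.2) hxy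
    have hQeq : Q = (R : Subgroup (pointStab X)).map ι := Subgroup.eq_of_le_of_card_ge hQR hcard
    intro b
    have hb : (e b : ℕ) ∈ supp ((fun g : pointStab X => (g : Perm ℕ)) '' R) := by
      rw [hexact R]
      exact (e b).2
    obtain ⟨_, ⟨r, hr, rfl⟩, hrb⟩ := hb
    have hrQ : ι r ∈ Q := by
      rw [hQeq]
      exact ⟨r, hr, rfl⟩
    refine ⟨φ (ι r), ⟨ι r, hrQ, rfl⟩, fun h => hrb ?_⟩
    have h1 : liftPerm e (φ (ι r)) = r := by
      rw [← coe_symEquiv, MulEquiv.apply_symm_apply]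
      rfl
    change (r : Perm ℕ) (e b) = e b
    rw [← h1, liftPerm_apply, h]

end ClassS

/-! ### Irreducible sets do not split. -/

section Irreducible

variable {q : ℕ} {X : Set (Perm ℕ)}

theorem exists_restriction {B : Set ℕ} (hB : B.Finite) {y : Perm ℕ} (hy : ∀ n ∈ B, y n ∈ B) :
    ∃ ρ ∈ symOn B, ∀ n ∈ B, ρ n = y n := by
  have := hB.to_subtype
  have hinj : Function.Injective (fun n : B => (⟨y n, hy n n.2⟩ : B)) := by
    intro a b hab
    exact Subtype.ext (y.injective (congrArg Subtype.val hab))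
  let h : Perm B := Equiv.ofBijective _ (Finite.injective_iff_bijective.1 hinj)
  refine ⟨liftPerm (Equiv.refl B) h, liftPerm_mem_symOn _ h, fun n hn => ?_⟩
  exact liftPerm_apply (Equiv.refl B) h ⟨n, hn⟩

/-- The restrictions of the elements of `X` to `B`. -/
def restrictionSet (X : Set (Perm ℕ)) (B : Set ℕ) : Set (Perm ℕ) :=
  {ρ | ρ ∈ symOn B ∧ ∃ y ∈ X, ∀ n ∈ B, ρ n = y n}

theorem restrictionSet_mem_classF (hX : X ∈ classS q) {B : Set ℕ} (hB : B ⊆ supp X)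
    (hne : B.Nonempty) (hinv : ∀ y ∈ X, ∀ n ∈ B, y n ∈ B) : restrictionSet X B ∈ classF := by
  have hfin : B.Finite := (finite_supp hX).subset hB
  refine ⟨fun ρ hρ => hfin.subset fun n hn => ?_, ?_, ?_, fun h => ?_⟩
  · by_contra h
    exact mem_supp_singleton.1 hn (hρ.1 n h)
  · obtain ⟨y, hy⟩ := hX.1.2.1
    obtain ⟨ρ, hρ, hρy⟩ := exists_restriction hfin (hinv y hy)
    exact ⟨ρ, hρ, y, hy, hρy⟩
  · have := finite_symOn hfin
    exact (Set.toFinite (symOn B : Set (Perm ℕ))).subset fun ρ hρ => hρ.1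
  · have h1 : (1 : Perm ℕ) ∈ restrictionSet X B := by
      rw [h]
      exact Set.mem_singleton _
    obtain ⟨-, y, hy, hyB⟩ := h1
    obtain ⟨n, hn⟩ := hne
    exact (apply_ne_iff hX hy).2 (hB hn) (hyB n hn).symm

/-- If `B` and its complement `C` in the support were both nonempty, `X` would be equivalent to the
product of its restrictions to `B` and `C`: the splitting property says that these restrictions can
be combined freely. -/
theorem IsIrred.eq_of_isSplit (hirr : IsIrred X) (hX : X ∈ classS q) {B : Set ℕ}
    (hB : B ⊆ supp X) (hsplit : IsSplit X B) : B = ∅ ∨ B = supp X := by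
  by_contra! hcon
  obtain ⟨hne, hne'⟩ := hcon
  set C := supp X \ B
  have hfin := finite_supp hX
  have hCne : C.Nonempty := by
    rw [Set.nonempty_iff_ne_empty]
    intro h
    exact hne' (hB.antisymm (Set.sdiff_eq_empty.1 h))
  have hinvC : ∀ y ∈ X, ∀ n ∈ C, y n ∈ C := by
    intro y hy n hn
    refine ⟨mem_of_mem_symOn (mem_symSupp hX hy) hn.1, fun h => hn.2 ?_⟩
    obtain ⟨ρ, hρ, hρy⟩ := exists_restriction (hfin.subset hB) (hsplit.1 y hy)
    have h1 := mem_of_mem_symOn (inv_mem hρ) h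
    have h2 := hρy _ h1
    rw [← Equiv.Perm.mul_apply, mul_inv_cancel, Equiv.Perm.one_apply] at h2
    rwa [y.injective h2]
  let ν := Equiv.natSumNatEquivNat
  classical
  -- The conjugating permutation puts `B` into the even and `C` into the odd copy of `ℕ`.
  obtain ⟨s, hs⟩ := exists_perm_extending (A := supp X) hfin
    (f := fun n => if n ∈ B then ν (Sum.inl n) else ν (Sum.inr n)) (by
      intro m _ n _ hmn
      simp only at hmn
      split_ifs at hmn <;> simpa using ν.injective hmn)
  have hsB : ∀ n ∈ B, s n = ν (Sum.inl n) := fun n hn => by rw [hs n (hB hn), if_pos hn]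
  have hsC : ∀ n ∈ C, s n = ν (Sum.inr n) := fun n hn => by rw [hs n hn.1, if_neg hn.2]
  have key : ∀ y ∈ X, ∀ ρ ∈ symOn B, ∀ τ ∈ symOn C, (∀ n ∈ B, ρ n = y n) → (∀ n ∈ C, τ n = y n) →
      s * y * s⁻¹ = ν.permCongr (Equiv.Perm.sumCongr ρ τ) := by
    intro y hy ρ hρ τ hτ hρy hτy
    rw [mul_inv_eq_iff_eq_mul]
    ext1 n
    rw [Equiv.Perm.mul_apply, Equiv.Perm.mul_apply]
    by_cases hn : n ∈ supp X
    · by_cases hnB : n ∈ B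
      · rw [hsB n hnB, hsB _ (hsplit.1 y hy n hnB), ← hρy n hnB]
        simp
      · have hnC : n ∈ C := ⟨hn, hnB⟩
        rw [hsC n hnC, hsC _ (hinvC y hy n hnC), ← hτy n hnC]
        simp
    -- Off the support, injectivity of `s` keeps `s n` away from the copies of `B` and `C`, so both
    -- sides fix it.
    · rw [mem_symSupp hX hy n hn]
      obtain ⟨m, hm⟩ := ν.surjective (s n)
      rw [← hm]
      rcases m with m | m
      · have hmB : m ∉ B := fun h => hn (by
          rw [← hsB m h] at hm
          rw [← s.injective hm]
          exact hB h)
        simp [hρ m hmB]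
      · have hmC : m ∉ C := fun h => hn (by
          rw [← hsC m h] at hm
          rw [← s.injective hm]
          exact h.1)
        simp [hτ m hmC]
  refine hirr ⟨restrictionSet X B, restrictionSet_mem_classF hX hB hne hsplit.1,
    restrictionSet X C, restrictionSet_mem_classF hX Set.sdiff_subset hCne hinvC, s, ?_⟩
  ext z
  constructor
  · rintro ⟨ρ, ⟨hρ, y, hy, hρy⟩, τ, ⟨hτ, y', hy', hτy⟩, rfl⟩
    obtain ⟨w, hw, hwy, hwy'⟩ := hsplit.2 y hy y' hy'
    refine ⟨w, hw, key w hw ρ hρ τ hτ (fun n hn => ?_) (fun n hn => ?_)⟩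
    · rw [hρy n hn, hwy n hn]
    · rw [hτy n hn, hwy' n hn.2]
  · rintro ⟨y, hy, rfl⟩
    obtain ⟨ρ, hρ, hρy⟩ := exists_restriction (hfin.subset hB) (hsplit.1 y hy)
    obtain ⟨τ, hτ, hτy⟩ := exists_restriction (hfin.subset Set.sdiff_subset) (hinvC y hy)
    exact ⟨ρ, ⟨hρ, y, hy, hρy⟩, τ, ⟨hτ, y, hy, hτy⟩, (key y hy ρ hρ τ hτ hρy hτy).symm⟩

/-- Irreducibility in terms of a model of the support. -/
theorem IsIrred.eq_empty_or_univ (hirr : IsIrred X) (hX : X ∈ classS q) {α : Type} (e : α ≃ supp X)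
    {W : Set (Perm α)} (hW : ∀ ρ, ρ ∈ X ↔ ∃ h ∈ W, liftPerm e h = ρ) {A : Set α}
    (hA : IsSplit W A) : A = ∅ ∨ A = Set.univ := by
  let B : Set ℕ := (fun a => (e a : ℕ)) '' A
  have hinj : Function.Injective fun a => (e a : ℕ) := fun _ _ h => e.injective (Subtype.ext h)
  have hB : B ⊆ supp X := by
    rintro _ ⟨a, -, rfl⟩
    exact (e a).2
  have hsplit : IsSplit X B := by
    constructor
    · rintro y hy _ ⟨a, ha, rfl⟩
      obtain ⟨h, hh, rfl⟩ := (hW y).1 hy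
      exact ⟨h a, hA.1 h hh a ha, (liftPerm_apply e h a).symm⟩
    · intro y hy y' hy'
      obtain ⟨h, hh, rfl⟩ := (hW y).1 hy
      obtain ⟨h', hh', rfl⟩ := (hW y').1 hy'
      obtain ⟨w, hw, hwh, hwh'⟩ := hA.2 h hh h' hh'
      refine ⟨liftPerm e w, (hW _).2 ⟨w, hw, rfl⟩, ?_, fun n hn => ?_⟩
      · rintro _ ⟨a, ha, rfl⟩
        simp only [liftPerm_apply, hwh a ha]
      · by_cases hnX : n ∈ supp X
        · obtain ⟨a, ha⟩ := e.surjective ⟨n, hnX⟩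
          have hna : n = e a := by rw [ha]
          rw [hna, liftPerm_apply, liftPerm_apply, hwh' a fun h => hn ⟨a, h, hna.symm⟩]
        · rw [liftPerm_apply_of_notMem e _ hnX, liftPerm_apply_of_notMem e _ hnX]
  rcases hirr.eq_of_isSplit hX hB hsplit with h | h
  · exact Or.inl (Set.image_eq_empty.1 h)
  · refine Or.inr (Set.eq_univ_of_forall fun a => ?_)
    have : (e a : ℕ) ∈ B := h.ge (e a).2
    exact (hinj.mem_set_image).1 this

/-- Sets of permutations that correspond to each other under a bijection of the supports are
equivalent. -/
theorem equivalent_of_equiv {X' : Set (Perm ℕ)} {α α' : Type} {A A' : Set ℕ} (hA : A.Finite)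
    (e : α ≃ A) (e' : α' ≃ A') (φ : α ≃ α') {W : Set (Perm α)} {W' : Set (Perm α')}
    (hW : ∀ ρ, ρ ∈ X ↔ ∃ h ∈ W, liftPerm e h = ρ)
    (hW' : ∀ ρ, ρ ∈ X' ↔ ∃ h ∈ W', liftPerm e' h = ρ)
    (hφ : ∀ h, h ∈ W ↔ φ.permCongr h ∈ W') : Equivalent X X' := by
  classical
  obtain ⟨s, hs⟩ := exists_perm_extending hA
    (f := fun n => if hn : n ∈ A then (e' (φ (e.symm ⟨n, hn⟩)) : ℕ) else 0) (by
      intro m hm n hn hmn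
      simp only [dif_pos hm, dif_pos hn] at hmn
      simpa using e.symm.injective (φ.injective (e'.injective (Subtype.ext hmn))))
  have hse : ∀ a, s (e a) = e' (φ a) := by
    intro a
    rw [hs _ (e a).2, dif_pos (e a).2, Subtype.coe_eta, Equiv.symm_apply_apply]
  have key : ∀ h, s * liftPerm e h * s⁻¹ = liftPerm e' (φ.permCongr h) := by
    intro h
    rw [mul_inv_eq_iff_eq_mul]
    ext1 n
    rw [Equiv.Perm.mul_apply, Equiv.Perm.mul_apply]
    by_cases hn : n ∈ A
    · obtain ⟨a, ha⟩ := e.surjective ⟨n, hn⟩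
      have hna : n = e a := by rw [ha]
      rw [hna, liftPerm_apply, hse, hse, liftPerm_apply]
      simp
    · rw [liftPerm_apply_of_notMem e h hn, liftPerm_apply_of_notMem]
      intro hsn
      apply hn
      obtain ⟨b, hb⟩ := e'.surjective ⟨s n, hsn⟩
      have h1 := hse (φ.symm b)
      rw [Equiv.apply_symm_apply, hb] at h1
      rw [← s.injective h1]
      exact (e _).2
  refine ⟨s, ?_⟩
  ext ρ
  rw [hW']
  constructor
  · rintro ⟨h, hh, rfl⟩
    refine ⟨liftPerm e (φ.symm.permCongr h), (hW _).2 ⟨_, (hφ _).2 ?_, rfl⟩, ?_⟩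
    · convert hh
      ext x
      simp
    · simp only [key]
      congr 1
      ext x
      simp
  · rintro ⟨y, hy, rfl⟩
    obtain ⟨h, hh, rfl⟩ := (hW y).1 hy
    exact ⟨_, (hφ h).1 hh, (key h).symm⟩

end Irreducible

/-! ### Iterated products indexed by blocks. -/

section StarProducts

/-- `Z` is the product of the sets `Y b`, realized by embeddings `f b` of `ℕ` into `ℕ` with disjoint
images. -/
def IsStarProduct {I : Type} (Y : I → Set (Perm ℕ)) (f : I → ℕ → ℕ) (Z : Set (Perm ℕ)) : Prop :=
  Function.Injective (fun x : I × ℕ => f x.1 x.2) ∧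
    ∀ z, z ∈ Z ↔ (∀ m, (∀ b n, f b n ≠ m) → z m = m) ∧
      ∃ y : I → Perm ℕ, (∀ b, y b ∈ Y b) ∧ ∀ b n, z (f b n) = f b (y b n)

variable {I I' : Type}

theorem isStarProduct_one [IsEmpty I] (Y : I → Set (Perm ℕ)) (f : I → ℕ → ℕ) :
    IsStarProduct Y f {1} := by
  refine ⟨fun x => isEmptyElim x.1, fun z => ⟨?_, ?_⟩⟩
  · rintro rfl
    exact ⟨fun _ _ => rfl, fun b => isEmptyElim b, fun b => isEmptyElim b, fun b => isEmptyElim b⟩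
  · rintro ⟨hz, -⟩
    rw [Set.mem_singleton_iff]
    ext1 m
    exact hz m fun b => isEmptyElim b

theorem isStarProduct_single (X : Set (Perm ℕ)) :
    IsStarProduct (fun _ : Unit => X) (fun _ n => n) X := by
  refine ⟨fun x y h => Prod.ext rfl h, fun z => ⟨fun hz => ?_, ?_⟩⟩
  · exact ⟨fun m hm => absurd rfl (hm () m), fun _ => z, fun _ => hz, fun _ _ => rfl⟩
  · rintro ⟨-, y, hy, hyz⟩
    have : z = y () := by
      ext1 n
      exact hyz () n
    exact this ▸ hy ()

theorem IsStarProduct.reindex (e : I ≃ I') {Y : I' → Set (Perm ℕ)} {f : I → ℕ → ℕ}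
    {Z : Set (Perm ℕ)} (h : IsStarProduct (fun b => Y (e b)) f Z) :
    IsStarProduct Y (fun b => f (e.symm b)) Z := by
  refine ⟨fun x x' hxx => ?_, fun z => ?_⟩
  · have h1 := h.1 (a₁ := (e.symm x.1, x.2)) (a₂ := (e.symm x'.1, x'.2)) hxx
    obtain ⟨h2, h3⟩ := Prod.ext_iff.1 h1
    exact Prod.ext (e.symm.injective h2) h3
  · rw [h.2 z]
    refine and_congr ?_ ?_
    · refine forall_congr' fun m => imp_congr_left ?_
      exact ⟨fun H b => H (e.symm b), fun H b n => by simpa using H (e b) n⟩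
    · constructor
      · rintro ⟨y, hy, hyz⟩
        exact ⟨fun b => y (e.symm b), fun b => by simpa using hy (e.symm b), fun b => hyz (e.symm b)⟩
      · rintro ⟨y, hy, hyz⟩
        exact ⟨fun b => y (e b), fun b => hy (e b), fun b n => by simpa using hyz (e b) n⟩

theorem IsStarProduct.conj {Y : I → Set (Perm ℕ)} {f : I → ℕ → ℕ} {Z Z' : Set (Perm ℕ)}
    (h : IsStarProduct Y f Z) {s : Perm ℕ} (hs : Z' = (fun x => s * x * s⁻¹) '' Z) :
    IsStarProduct Y (fun b n => s (f b n)) Z' := by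
  refine ⟨s.injective.comp h.1, fun z => ?_⟩
  have hmem : z ∈ Z' ↔ s⁻¹ * z * s ∈ Z := by
    rw [hs]
    constructor
    · rintro ⟨x, hx, rfl⟩
      convert hx using 1
      group
    · intro hz
      exact ⟨_, hz, by group⟩
  rw [hmem, h.2]
  have happ : ∀ m m', (s⁻¹ * z * s) m = m' ↔ z (s m) = s m' := by
    intro m m'
    rw [Equiv.Perm.mul_apply, Equiv.Perm.mul_apply, Equiv.Perm.inv_eq_iff_eq, eq_comm]
  simp only [happ]
  refine and_congr_left fun _ => ?_
  constructor
  · intro H m hm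
    obtain ⟨m, rfl⟩ := s.surjective m
    exact H m fun b n hbn => hm b n (congrArg s hbn)
  · intro H m hm
    exact H (s m) fun b n hbn => hm b n (s.injective hbn)

theorem IsStarProduct.starMul {Y : I → Set (Perm ℕ)} {f : I → ℕ → ℕ} {Z : Set (Perm ℕ)}
    (h : IsStarProduct Y f Z) {Y' : I' → Set (Perm ℕ)} {f' : I' → ℕ → ℕ} {Z' : Set (Perm ℕ)}
    (h' : IsStarProduct Y' f' Z') : IsStarProduct (Sum.elim Y Y')
      (Sum.elim (fun b n => Equiv.natSumNatEquivNat (Sum.inl (f b n)))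
        (fun b n => Equiv.natSumNatEquivNat (Sum.inr (f' b n)))) (starMul Z Z') := by
  let ν := Equiv.natSumNatEquivNat
  refine ⟨?_, fun z => ⟨?_, ?_⟩⟩
  · rintro ⟨b | b, n⟩ ⟨b' | b', n'⟩ hbb
    · have h1 := h.1 (a₁ := (b, n)) (a₂ := (b', n')) (Sum.inl_injective (ν.injective hbb))
      rw [Prod.mk.injEq] at h1 ⊢
      exact ⟨congrArg _ h1.1, h1.2⟩
    · exact absurd (ν.injective hbb) Sum.inl_ne_inr
    · exact absurd (ν.injective hbb) Sum.inr_ne_inl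
    · have h1 := h'.1 (a₁ := (b, n)) (a₂ := (b', n')) (Sum.inr_injective (ν.injective hbb))
      rw [Prod.mk.injEq] at h1 ⊢
      exact ⟨congrArg _ h1.1, h1.2⟩
  · rintro ⟨x, hx, x', hx', rfl⟩
    obtain ⟨hx0, y, hy, hyx⟩ := (h.2 x).1 hx
    obtain ⟨hx0', y', hy', hyx'⟩ := (h'.2 x').1 hx'
    refine ⟨fun m hm => ?_, Sum.elim y y', ?_, ?_⟩
    · obtain ⟨m, rfl⟩ := ν.surjective m
      rcases m with m | m
      · have h1 := hx0 m fun b n hbn => hm (Sum.inl b) n (congrArg (fun m => ν (Sum.inl m)) hbn)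
        simp [ν, h1]
      · have h1 := hx0' m fun b n hbn => hm (Sum.inr b) n (congrArg (fun m => ν (Sum.inr m)) hbn)
        simp [ν, h1]
    · rintro (b | b)
      · exact hy b
      · exact hy' b
    · rintro (b | b) n
      · simp [hyx]
      · simp [hyx']
  · rintro ⟨hz0, w, hw, hwz⟩
    -- For the converse, `z` preserves the even and the odd half of `ℕ`, and its restrictions to the
    -- halves are the two factors.
    let u : Perm (ℕ ⊕ ℕ) := ν.symm.permCongr z
    have hu : ∀ m, u m = ν.symm (z (ν m)) := fun m => rfl
    have hmaps : Set.MapsTo u (Set.range (Sum.inl : ℕ → ℕ ⊕ ℕ)) (Set.range Sum.inl) ∧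
        Set.MapsTo u (Set.range (Sum.inr : ℕ → ℕ ⊕ ℕ)) (Set.range Sum.inr) := by
      constructor
      · rintro _ ⟨m, rfl⟩
        by_cases hm : ∃ b n, f b n = m
        · obtain ⟨b, n, rfl⟩ := hm
          have h1 : z (ν (Sum.inl (f b n))) = ν (Sum.inl (f b (w (Sum.inl b) n))) :=
            hwz (Sum.inl b) n
          rw [hu, h1, Equiv.symm_apply_apply]
          exact ⟨_, rfl⟩
        · push Not at hm
          rw [hu, hz0, Equiv.symm_apply_apply]
          · exact ⟨m, rfl⟩
          · rintro (b | b) n hbn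
            · exact hm b n (Sum.inl_injective (ν.injective hbn))
            · exact absurd (ν.injective hbn) Sum.inr_ne_inl
      · rintro _ ⟨m, rfl⟩
        by_cases hm : ∃ b n, f' b n = m
        · obtain ⟨b, n, rfl⟩ := hm
          have h1 : z (ν (Sum.inr (f' b n))) = ν (Sum.inr (f' b (w (Sum.inr b) n))) :=
            hwz (Sum.inr b) n
          rw [hu, h1, Equiv.symm_apply_apply]
          exact ⟨_, rfl⟩
        · push Not at hm
          rw [hu, hz0, Equiv.symm_apply_apply]
          · exact ⟨m, rfl⟩
          · rintro (b | b) n hbn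
            · exact absurd (ν.injective hbn) Sum.inl_ne_inr
            · exact hm b n (Sum.inr_injective (ν.injective hbn))
    have hex : ∀ v : Perm (ℕ ⊕ ℕ), Set.MapsTo v (Set.range Sum.inl) (Set.range Sum.inl) →
        Set.MapsTo v (Set.range Sum.inr) (Set.range Sum.inr) →
        ∃ x x' : Perm ℕ, Equiv.Perm.sumCongr x x' = v := by
      intro v hv hv'
      choose x hx using fun m => hv ⟨m, rfl⟩
      choose x' hx' using fun m => hv' ⟨m, rfl⟩
      have hbij : Function.Bijective x := by
        refine ⟨fun a b hab => ?_, fun m => ?_⟩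
        · exact Sum.inl_injective (v.injective (by rw [← hx, ← hx, hab]))
        · obtain ⟨a | a, ha⟩ := v.surjective (Sum.inl m)
          · exact ⟨a, Sum.inl_injective ((hx a).trans ha)⟩
          · exact absurd ((hx' a).trans ha) Sum.inr_ne_inl
      have hbij' : Function.Bijective x' := by
        refine ⟨fun a b hab => ?_, fun m => ?_⟩
        · exact Sum.inr_injective (v.injective (by rw [← hx', ← hx', hab]))
        · obtain ⟨a | a, ha⟩ := v.surjective (Sum.inr m)
          · exact absurd ((hx a).trans ha) Sum.inl_ne_inr
          · exact ⟨a, Sum.inr_injective ((hx' a).trans ha)⟩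
      refine ⟨Equiv.ofBijective x hbij, Equiv.ofBijective x' hbij', ?_⟩
      ext1 m
      rcases m with m | m
      · exact hx m
      · exact hx' m
    obtain ⟨x, x', hxx⟩ := hex u hmaps.1 hmaps.2
    have hz : ν.permCongr (Equiv.Perm.sumCongr x x') = z := by
      rw [hxx]
      ext1 m
      simp [u]
    have hzl : ∀ m, z (ν (Sum.inl m)) = ν (Sum.inl (x m)) := by
      intro m
      rw [← hz]
      simp
    have hzr : ∀ m, z (ν (Sum.inr m)) = ν (Sum.inr (x' m)) := by
      intro m
      rw [← hz]
      simp
    refine ⟨x, (h.2 x).2 ⟨fun m hm => ?_, fun b => w (Sum.inl b), fun b => hw (Sum.inl b),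
      fun b n => ?_⟩, x', (h'.2 x').2 ⟨fun m hm => ?_, fun b => w (Sum.inr b),
      fun b => hw (Sum.inr b), fun b n => ?_⟩, hz⟩
    · have h1 := hz0 (ν (Sum.inl m)) (by
        rintro (b | b) n hbn
        · exact hm b n (Sum.inl_injective (ν.injective hbn))
        · exact absurd (ν.injective hbn) Sum.inr_ne_inl)
      rw [hzl] at h1
      exact Sum.inl_injective (ν.injective h1)
    · have h1 := (hzl (f b n)).symm.trans (hwz (Sum.inl b) n)
      exact Sum.inl_injective (ν.injective h1)
    · have h1 := hz0 (ν (Sum.inr m)) (by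
        rintro (b | b) n hbn
        · exact absurd (ν.injective hbn) Sum.inl_ne_inr
        · exact hm b n (Sum.inr_injective (ν.injective hbn)))
      rw [hzr] at h1
      exact Sum.inr_injective (ν.injective h1)
    · have h1 := (hzr (f' b n)).symm.trans (hwz (Sum.inr b) n)
      exact Sum.inr_injective (ν.injective h1)

theorem exists_isStarProduct_starPow (X : Set (Perm ℕ)) (s : ℕ) :
    ∃ f, IsStarProduct (fun _ : Fin s => X) f (starPow X s) := by
  induction s with
  | zero => exact ⟨fun _ n => n, isStarProduct_one _ _⟩
  | succ s ih =>
    obtain ⟨f, hf⟩ := ih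
    have h1 := (isStarProduct_single X).starMul hf
    let e : Unit ⊕ Fin s ≃ Fin (s + 1) :=
      ((finSuccEquiv s).trans ((Equiv.optionEquivSumPUnit _).trans (Equiv.sumComm _ _))).symm
    have h2 : Sum.elim (fun _ : Unit => X) (fun _ : Fin s => X) = fun b => (fun _ => X) (e b) := by
      funext b
      rcases b with b | b <;> rfl
    rw [h2] at h1
    exact ⟨_, h1.reindex e⟩

theorem exists_isStarProduct_starProd {t : ℕ} (Y : Fin t → Set (Perm ℕ)) (s : Fin t → ℕ) :
    ∃ f, IsStarProduct (fun b : Σ i, Fin (s i) => Y b.1) f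
      (starProd (List.ofFn fun i => starPow (Y i) (s i))) := by
  induction t with
  | zero => exact ⟨fun _ n => n, by rw [List.ofFn_zero]; exact isStarProduct_one _ _⟩
  | succ t ih =>
    obtain ⟨f, hf⟩ := ih (fun i => Y i.succ) (fun i => s i.succ)
    obtain ⟨f', hf'⟩ := exists_isStarProduct_starPow (Y 0) (s 0)
    have h1 := hf'.starMul hf
    let e : Fin (s 0) ⊕ (Σ i : Fin t, Fin (s i.succ)) ≃ Σ i, Fin (s i) :=
      Equiv.ofBijective (Sum.elim (fun j => ⟨0, j⟩) (fun x => ⟨x.1.succ, x.2⟩)) ⟨by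
        rintro (j | ⟨i, j⟩) (j' | ⟨i', j'⟩) h
        · have h3 : j = j' := sigma_mk_injective (β := fun i => Fin (s i)) h
          rw [h3]
        · exact absurd (congrArg Sigma.fst h) (Fin.succ_ne_zero i').symm
        · exact absurd (congrArg Sigma.fst h) (Fin.succ_ne_zero i)
        · have h2 : i = i' := Fin.succ_injective _ (congrArg Sigma.fst h)
          subst h2
          have h3 : j = j' := sigma_mk_injective (β := fun i => Fin (s i)) h
          rw [h3], by
        rintro ⟨i, j⟩
        induction i using Fin.cases with
        | zero => exact ⟨Sum.inl j, rfl⟩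
        | succ i => exact ⟨Sum.inr ⟨i, j⟩, rfl⟩⟩
    have h2 : Sum.elim (fun _ : Fin (s 0) => Y 0)
        (fun b : Σ i : Fin t, Fin (s i.succ) => Y b.1.succ) = fun b => Y (e b).1 := by
      funext b
      rcases b with b | b <;> rfl
    rw [h2] at h1
    rw [List.ofFn_succ]
    exact ⟨_, h1.reindex e⟩

variable {Y : I → Set (Perm ℕ)} {f : I → ℕ → ℕ} {Z : Set (Perm ℕ)} {q : ℕ}

theorem IsStarProduct.eq_of_apply_eq (h : IsStarProduct Y f Z) {b b' : I} {n n' : ℕ}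
    (hbb : f b n = f b' n') : b = b' ∧ n = n' :=
  Prod.ext_iff.1 (h.1 (a₁ := (b, n)) (a₂ := (b', n')) hbb)

theorem IsStarProduct.apply_ne_iff (h : IsStarProduct Y f Z) (hY : ∀ b, Y b ∈ classS q)
    {z : Perm ℕ} (hz : z ∈ Z) {m : ℕ} : z m ≠ m ↔ ∃ b, ∃ n ∈ supp (Y b), f b n = m := by
  obtain ⟨hz0, y, hy, hyz⟩ := (h.2 z).1 hz
  constructor
  · intro hm
    have h1 : ∃ b n, f b n = m := by
      by_contra! hcon
      exact hm (hz0 m hcon)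
    obtain ⟨b, n, rfl⟩ := h1
    refine ⟨b, n, (FixedPointSets.apply_ne_iff (hY b) (hy b)).1 fun hn => hm ?_, rfl⟩
    rw [hyz, hn]
  · rintro ⟨b, n, hn, rfl⟩ hm
    rw [hyz] at hm
    exact (FixedPointSets.apply_ne_iff (hY b) (hy b)).2 hn (h.eq_of_apply_eq hm).2

theorem IsStarProduct.nonempty (h : IsStarProduct Y f Z) (hY : ∀ b, Y b ∈ classS q) :
    Z.Nonempty := by
  classical
  choose y hy using fun b => (hY b).1.2.1
  have hinj : Function.Injective fun x : Σ _ : I, ℕ => f x.1 x.2 := by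
    rintro ⟨b, n⟩ ⟨b', n'⟩ hbb
    obtain ⟨rfl, rfl⟩ := h.eq_of_apply_eq hbb
    rfl
  let e : (Σ _ : I, ℕ) ≃ Set.range fun x : Σ _ : I, ℕ => f x.1 x.2 := Equiv.ofInjective _ hinj
  refine ⟨liftPerm e (Equiv.Perm.sigmaCongrRight y), (h.2 _).2 ⟨fun m hm => ?_, y, hy, fun b n => ?_⟩⟩
  · refine liftPerm_apply_of_notMem e _ ?_
    rintro ⟨⟨b, n⟩, hbn⟩
    exact hm b n hbn
  · exact liftPerm_apply e _ ⟨b, n⟩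

theorem IsStarProduct.mem_supp_iff (h : IsStarProduct Y f Z) (hY : ∀ b, Y b ∈ classS q) {m : ℕ} :
    m ∈ supp Z ↔ ∃ b, ∃ n ∈ supp (Y b), f b n = m := by
  constructor
  · rintro ⟨z, hz, hm⟩
    exact (h.apply_ne_iff hY hz).1 hm
  · intro hm
    obtain ⟨z, hz⟩ := h.nonempty hY
    exact ⟨z, hz, (h.apply_ne_iff hY hz).2 hm⟩

/-- The class `classS q` is closed under products. -/
theorem IsStarProduct.mem_classS [Finite I] [Nonempty I] (h : IsStarProduct Y f Z)
    (hY : ∀ b, Y b ∈ classS q) : Z ∈ classS q := by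
  have hsupp : ∀ z ∈ Z, supp {z} = supp Z := by
    intro z hz
    ext m
    rw [mem_supp_singleton, h.apply_ne_iff hY hz, h.mem_supp_iff hY]
  have hfin : (supp Z).Finite := by
    refine (Set.finite_iUnion fun b => (finite_supp (hY b)).image (f b)).subset fun m hm => ?_
    obtain ⟨b, n, hn, rfl⟩ := (h.mem_supp_iff hY).1 hm
    exact Set.mem_iUnion.2 ⟨b, n, hn, rfl⟩
  refine ⟨⟨fun z hz => (hsupp z hz).symm ▸ hfin, h.nonempty hY, ?_, fun h1 => ?_⟩, ?_, hsupp⟩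
  · have := finite_symOn hfin
    refine (Set.toFinite (symOn (supp Z) : Set (Perm ℕ))).subset fun z hz n hn => ?_
    by_contra hne
    exact hn ⟨z, hz, hne⟩
  · obtain ⟨b⟩ := ‹Nonempty I›
    obtain ⟨n, hn⟩ := nonempty_supp (hY b)
    obtain ⟨z, hz, hne⟩ := (h.mem_supp_iff hY).2 ⟨b, n, hn, rfl⟩
    rw [h1, Set.mem_singleton_iff] at hz
    rw [hz] at hne
    exact hne rfl
  · intro z hz m hm
    obtain ⟨b, n, hn, rfl⟩ := (h.apply_ne_iff hY hz).1 hm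
    obtain ⟨-, y, hy, hyz⟩ := (h.2 z).1 hz
    rw [minimalPeriod_of_semiconj (f := f b) (fun n n' hnn => (h.eq_of_apply_eq hnn).2) (hyz b)]
    exact (hY b).2.1 (y b) (hy b) n ((FixedPointSets.apply_ne_iff (hY b) (hy b)).2 hn)

/-- The support of a product is the disjoint union of the supports of the factors. -/
noncomputable def IsStarProduct.suppEquiv (h : IsStarProduct Y f Z) (hY : ∀ b, Y b ∈ classS q) :
    (Σ b, supp (Y b)) ≃ supp Z :=
  Equiv.ofBijective (fun x => ⟨f x.1 x.2, (h.mem_supp_iff hY).2 ⟨x.1, x.2, x.2.2, rfl⟩⟩) ⟨by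
    rintro ⟨b, n, hn⟩ ⟨b', n', hn'⟩ hbb
    obtain ⟨rfl, rfl⟩ := h.eq_of_apply_eq (congrArg Subtype.val hbb)
    rfl, by
    rintro ⟨m, hm⟩
    obtain ⟨b, n, hn, rfl⟩ := (h.mem_supp_iff hY).1 hm
    exact ⟨⟨b, n, hn⟩, rfl⟩⟩

theorem IsStarProduct.coe_suppEquiv (h : IsStarProduct Y f Z) (hY : ∀ b, Y b ∈ classS q) (b : I)
    (n : supp (Y b)) : (h.suppEquiv hY ⟨b, n⟩ : ℕ) = f b n := rfl

/-- This matches the product with `glue`, so that `mem_fixedPoints_blockSub` recognizes it as a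
fixed point set. -/
theorem IsStarProduct.liftPerm_mem_iff (h : IsStarProduct Y f Z) (hY : ∀ b, Y b ∈ classS q)
    {z : regPerm q (Σ b, supp (Y b))} : liftPerm (h.suppEquiv hY) z ∈ Z ↔
      ∃ y : ∀ b, regPerm q (supp (Y b)), (∀ b, liftPerm (Equiv.refl (supp (Y b))) (y b) ∈ Y b) ∧
        glue y = z := by
  rw [h.2]
  constructor
  · rintro ⟨-, y, hy, hyz⟩
    choose y' hy' hyy using fun b => exists_regPerm_lift_eq (Equiv.refl (supp (Y b))) (hY b) (hy b)
    refine ⟨fun b => ⟨y' b, hy' b⟩, fun b => (hyy b).symm ▸ hy b, Subtype.ext ?_⟩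
    ext1 ⟨b, n⟩
    apply (h.suppEquiv hY).injective
    apply Subtype.ext
    have h1 := hyz b n
    rw [← h.coe_suppEquiv hY b n, liftPerm_apply] at h1
    refine Eq.trans ?_ h1.symm
    rw [← hyy b]
    exact (congrArg (f b) (liftPerm_apply (Equiv.refl (supp (Y b))) (y' b) n)).symm
  · rintro ⟨y, hy, rfl⟩
    have hout : ∀ m, m ∉ supp Z → liftPerm (h.suppEquiv hY) (glue y : regPerm q _) m = m :=
      fun m hm => liftPerm_apply_of_notMem _ _ hm
    refine ⟨fun m hm => hout m fun hm' => ?_, _, hy, fun b n => ?_⟩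
    · obtain ⟨b, n, -, hbn⟩ := (h.mem_supp_iff hY).1 hm'
      exact hm b n hbn
    · by_cases hn : n ∈ supp (Y b)
      · exact (liftPerm_apply (h.suppEquiv hY) _ ⟨b, n, hn⟩).trans
          (congrArg (f b) (liftPerm_apply (Equiv.refl (supp (Y b))) (y b) ⟨n, hn⟩)).symm
      · rw [liftPerm_apply_of_notMem _ _ hn, hout]
        intro hm
        obtain ⟨b', n', hn', hbn⟩ := (h.mem_supp_iff hY).1 hm
        obtain ⟨rfl, rfl⟩ := h.eq_of_apply_eq hbn
        exact hn hn'

end StarProducts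

/-- Transport of centralized permutations along `φ`. With `equivalent_of_equiv` it shows that blocks
whose groups correspond under a bijection come from equivalent factors. -/
theorem permCongr_mem_image_fixedPoints {α β : Type*} {q : ℕ} (φ : α ≃ β) {Q : Subgroup (Perm α)}
    {Q' : Subgroup (Perm β)} (hφ : ∀ u, u ∈ Q ↔ φ.permCongr u ∈ Q') {h : Perm α}
    (hh : h ∈ Subtype.val '' MulAction.fixedPoints Q (regPerm q α)) :
    φ.permCongr h ∈ Subtype.val '' MulAction.fixedPoints Q' (regPerm q β) := by
  obtain ⟨h, hfix, rfl⟩ := hh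
  refine ⟨regPermCongr φ h, fun u => ?_, rfl⟩
  have hu : φ.symm.permCongr (u : Perm β) ∈ Q := by
    rw [hφ]
    convert u.2 using 1
    ext x
    simp
  have h1 := smul_eq_self_iff.1 (hfix ⟨_, hu⟩)
  refine smul_eq_self_iff.2 fun x => ?_
  have h2 := congrArg φ (h1 (φ.symm x))
  simpa [regPermCongr] using h2

theorem permCongr_mem_image_fixedPoints_iff {α β : Type*} {q : ℕ} (φ : α ≃ β)
    {Q : Subgroup (Perm α)} {Q' : Subgroup (Perm β)} (hφ : ∀ u, u ∈ Q ↔ φ.permCongr u ∈ Q')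
    {h : Perm α} : h ∈ Subtype.val '' MulAction.fixedPoints Q (regPerm q α) ↔
      φ.permCongr h ∈ Subtype.val '' MulAction.fixedPoints Q' (regPerm q β) := by
  refine ⟨permCongr_mem_image_fixedPoints φ hφ, fun hh => ?_⟩
  have h1 := permCongr_mem_image_fixedPoints φ.symm (Q := Q') (Q' := Q) (fun u => by
    rw [hφ]
    refine iff_of_eq (congrArg (· ∈ Q') ?_)
    ext x
    simp) hh
  convert h1 using 1
  ext x
  simp

end FixedPointSets

/-! ### The main theorem. -/

theorem theorem5p9 {k : Type*} [Field k] {p : ℕ} [Fact p.Prime] [CharP k p]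
    {q : ℕ} (hq : 2 ≤ q) {t : ℕ} (ht : 1 ≤ t) (Y : Fin t → Set (Equiv.Perm ℕ))
    (hY : ∀ i, Y i ∈ classS q)
    (hdistinct : ∀ i j, i ≠ j → ¬ Equivalent (Y i) (Y j))
    (hirred : ∀ i, IsIrred (Y i))
    (hexact : ∀ i, IsExact p (Y i))
    (hfixed : ∀ i, IsFixedPointSet k (Y i))
    (s : Fin t → ℕ) (hs_pos : ∀ i, 0 < s i) (hs_lt : ∀ i, s i < p)
    (Z : Set (Equiv.Perm ℕ))
    (hZ : Equivalent (starProd (List.ofFn fun i => starPow (Y i) (s i))) Z) :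
    Z ∈ classS q ∧ IsFixedPointSet k Z := by
  obtain ⟨τ, hτ⟩ := hZ
  obtain ⟨f, hf⟩ := exists_isStarProduct_starProd Y s
  have hstar := hf.conj hτ
  have hYb : ∀ b : Σ i, Fin (s i), Y b.1 ∈ classS q := fun b => hY b.1
  have : Nonempty (Σ i, Fin (s i)) := ⟨⟨⟨0, ht⟩, ⟨0, hs_pos _⟩⟩⟩
  have hZS : Z ∈ classS q := hstar.mem_classS hYb
  refine ⟨hZS, ?_⟩
  have hfin := fun i => (finite_supp (hY i)).to_subtype
  have hnonempty := fun i => (nonempty_supp (hY i)).to_subtype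
  -- The groups and matrices are chosen for each `i`, not for each block, so that equal factors
  -- carry identical data.
  choose Q hB hQ hfree using fun i =>
    exists_hasBrauerTrace (Equiv.refl (supp (Y i))) hq (hY i) (hfixed i) (hexact i)
  choose a T ha hTa hT hnn using fun i => (hB i).exists_normalizer_invariant
  have hW : ∀ i ρ, ρ ∈ Y i ↔ ∃ h ∈ Subtype.val '' MulAction.fixedPoints (Q i) (regPerm q (supp (Y i))),
      liftPerm (Equiv.refl (supp (Y i))) h = ρ := by
    intro i ρ
    constructor
    · intro hρ
      obtain ⟨h, hh, rfl⟩ := exists_regPerm_lift_eq (Equiv.refl (supp (Y i))) (hY i) hρ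
      exact ⟨h, ⟨⟨h, hh⟩, (hQ i ⟨h, hh⟩).2 hρ, rfl⟩, rfl⟩
    · rintro ⟨_, ⟨h, hh, rfl⟩, rfl⟩
      exact (hQ i h).1 hh
  have hblock : HasBrauerTrace k p (blockSub fun b : Σ i, Fin (s i) => Q b.1)
      (regPerm q (Σ b : Σ i, Fin (s i), supp (Y b.1))) := by
    -- A block is coloured by the index `i` of its factor; the fibre over `i` has `s i < p`
    -- elements.
    refine hasBrauerTrace_blockSub (c := Sigma.fst) (fun i => ?_) (fun b => (hB b.1).1)
      (fun b => hfree b.1)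
      (fun b A hA => (hirred b.1).eq_empty_or_univ (hY b.1) _ (hW b.1) hA)
      (a := fun b => a b.1) (T := fun b => T b.1) (fun b => ha b.1) (fun b => hTa b.1) ?_
      (fun b => hnn b.1)
    · have hcard := Nat.card_eq_of_bijective
        (fun j : Fin (s i) => (⟨⟨i, j⟩, rfl⟩ : {b : Σ i, Fin (s i) // b.1 = i}))
        ⟨fun j j' h => sigma_mk_injective (β := fun i => Fin (s i)) (congrArg Subtype.val h), by
          rintro ⟨⟨_, j⟩, rfl⟩
          exact ⟨j, rfl⟩⟩
      rw [← hcard, Nat.card_eq_fintype_card, Fintype.card_fin]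
      exact hs_lt i
    · rintro ⟨i, j⟩ ⟨i', j'⟩ φ hφ
      -- A bijection matching the groups of two blocks makes their factors equivalent, hence equal.
      -- It then normalizes `Q i`, under which `T i` is invariant.
      have hii : i = i' := by
        by_contra hne
        exact hdistinct i i' hne (equivalent_of_equiv (finite_supp (hY i)) _ _ φ (hW i) (hW i')
          fun h => permCongr_mem_image_fixedPoints_iff φ hφ)
      subst hii
      refine ⟨rfl, fun x y => hT i φ (Subgroup.mem_normalizer_iff.2 hφ) x y⟩
  refine isFixedPointSet_of_hasBrauerTrace (hstar.suppEquiv hYb) hq hZS hblock fun h => ?_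
  rw [mem_fixedPoints_blockSub (fun b => hfree b.1), hstar.liftPerm_mem_iff hYb]
  simp only [hQ]
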